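/- **Setting.** Let $\mathcal X\subseteq\mathbb R^{n_x}$, $\mathcal Y\subseteq\mathbb R^{n_y}$ be measurable. The pair $(X_0,Y_0)$ has density $p_0$ on $\mathcal X\times\mathcal Y$, the state evolves with transition density $p(x_{k+1}\mid x_k,y_k)$, and the private input $Y_k$ is a Markov process with transition density $p(y_{k+1}\mid y_k)$. At each time $k=0,\dots,K$ a sampler takes a decision $N_k\in\{0,1\}$; its output is $Z_k=X_k$ if $N_k=1$ and $Z_k=\emptyset$ if $N_k=0$. The memory $M_k$ is the finite sequence of the samples discarded before time $k$ ($M_0$ is empty, $M_{k+1}=M_k$ if $N_k=1$, $M_{k+1}=(M_k,X_k)$ if $N_k=0$). A sampling policy $\mathcal A$ selects at time $k$, measurably from $Z^{k-1}=(Z_0,\dots,Z_{k-1})$, a collection $\mathcal A_k=\{a_k(n\mid x,m)\}$ of conditional probability mass functions, and $N_k$ is drawn from $a_k(\cdot\mid X_k,M_k)$. A reconstruction policy gives measurable reconstructions $\tilde X_k=\tilde\pi_k(Z^k)\in\mathbb R^{n_x}$. Let $l_D\ge 0$ be measurable with $l_D(x,x)=0$, and let $\lambda>0$. The sampling problem is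 to minimize $$L(\mathcal A,\tilde\pi)=\sum_{k=0}^K\mathsf E[l_D(X_k,\tilde X_k)]+\lambda I(Z^K;Y^K)\in[0,\infty],$$ where for each $\mathcal A$ the reconstruction is chosen optimally, that is, $\tilde\pi_k^\star(Z^k)$ minimizes $\mathsf E[l_D(X_k,\tilde\pi_k(Z^k))\mid Z^k]$. The belief state is the conditional density $b_k(x_k,m_k,y^k)=p(x_k,m_k,y^k\mid Z^{k-1})$. The optimal cost-to-go at time $k$ is the (essential) infimum, over all reconstruction policies and all sampling policies with the given collections before time $k$, of $$\sum_{j=k}^K\mathsf E\Big[l_D(X_j,\tilde X_j)+\lambda\log\tfrac{p(Y^j\mid Z^j)}{p(Y^j\mid Z^{j-1})}\,\Big|\,Z^{k-1}\Big].$$ All values lie in $[0,\infty]$; minima are read as infima. **Theorem.** There are functions $V_k^\star$ ($0\le k\le K+1$) of the belief state, not depending on the sampling policy, with $V_{K+1}^\star=0$ and, for $0\le k\le K$ and every $b_k$, $$V_k^\star(b_k)=\inf_{\mathcal A_k}\Big\{\tilde l_D(\mathcal A_k,b_k)+\lambda\, l_I(\mathcal A_k,b_k)+\mathsf E\big[V_{k+1}^\star(\Phi(b_k,\mathcal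 A_k,Z_k))\mid Z^{k-1}\big]\Big\},$$ such that for every sampling policy and every $k\le K$ the optimal cost-to-go at time $k$ given $Z^{k-1}$ is almost surely $V_k^\star(b_k)$. The optimal value $\inf L$ is $V_0^\star(b_0)$. If a policy attains the optimal cost-to-go at time $k$, then its collection almost surely attains the infimum in the Bellman equation at $b_k$. Here all terms are functions of $(\mathcal A_k,b_k)$: 1. The distortion loss is $\tilde l_D(\mathcal A_k,b_k)=\inf_{\tilde x}\int\!\!\int\!\!\int a_k(0\mid x,m)\,b_k(x,m,y^k)\,l_D(x,\tilde x)\,dx\,dm\,dy^k$. If $\tilde\pi^\star_k$ is an optimal reconstruction, then almost surely the infimum is attained at $\tilde x=\tilde\pi_k^\star(Z^{k-1},Z_k=\emptyset)$ and equals $\mathsf E[l_D(X_k,\tilde\pi_k^\star(Z^k))\mid Z^{k-1}]$. 2. The information loss is $l_I(\mathcal A_k,b_k)=\mathsf E\big[\log\frac{p(Y^k\mid Z^k)}{p(Y^k\mid Z^{k-1})}\,\big|\,Z^{k-1}\big]$ almost surely. As a function of $(\mathcal A_k,b_k)$ it is the expectation of this log-ratio when $(X_k,M_k,Y^k)$ has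 density $b_k$, $N_k$ is drawn from $a_k(\cdot\mid X_k,M_k)$, and $$p(y^k\mid Z^{k-1})=\int\!\!\int b_k\,dx\,dm,\qquad p(y^k\mid Z^k)=\begin{cases}\dfrac{\iint a_k(0\mid x,m)\,b_k(x,m,y^k)\,dx\,dm}{\iiint a_k(0\mid x,m)\,b_k(x,m,y^k)\,dx\,dm\,dy^k},&Z_k=\emptyset,\\[3mm]\dfrac{\int a_k(1\mid X_k,m)\,b_k(X_k,m,y^k)\,dm}{\iint a_k(1\mid X_k,m)\,b_k(X_k,m,y^k)\,dm\,dy^k},&Z_k=X_k.\end{cases}$$ 3. The expected next value $\mathsf E[V_{k+1}^\star(\Phi(b_k,\mathcal A_k,Z_k))\mid Z^{k-1}]$ is almost surely $$\int\!\!\int\!\!\int b_k(x,m,y^k)\Big[a_k(0\mid x,m)\,V_{k+1}^\star(\Phi(b_k,\mathcal A_k,\emptyset))+a_k(1\mid x,m)\,V_{k+1}^\star(\Phi(b_k,\mathcal A_k,x))\Big]dx\,dm\,dy^k .$$ 4. The conditional density $b_k$ exists, $b_0$ is the density $p_0$ of $(X_0,Y_0)$ (with empty memory), and for $k<K$ almost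 surely $b_{k+1}=\Phi(b_k,\mathcal A_k,Z_k)$, where $$\Phi(b_k,\mathcal A_k,Z_k)(x_{k+1},m_{k+1},y^{k+1})=\begin{cases}\dfrac{p(x_{k+1}\mid x_k,y_k)\,p(y_{k+1}\mid y_k)\,b_k(x_k,m_k,y^k)\,a_k(0\mid x_k,m_k)}{\iiint a_k(0\mid x,m)\,b_k(x,m,y^k)\,dx\,dm\,dy^k},\quad m_{k+1}=(m_k,x_k),&Z_k=\emptyset,\\[3mm]\dfrac{p(x_{k+1}\mid X_k,y_k)\,p(y_{k+1}\mid y_k)\,b_k(X_k,m_{k+1},y^k)\,a_k(1\mid X_k,m_{k+1})}{\iint a_k(1\mid X_k,m)\,b_k(X_k,m,y^k)\,dm\,dy^k},&Z_k=X_k,\end{cases}$$ and in the case $Z_k=\emptyset$ the value is $0$ when $m_{k+1}$ is empty. -/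

import Mathlib

open MeasureTheory
open scoped ENNReal NNReal

noncomputable section

/-- The space `ℝⁿ`. -/
abbrev Vec (n : ℕ) : Type := EuclideanSpace ℝ (Fin n)

/-- The output of the sampler: `Sum.inl x` is a retained sample `x`, and `Sum.inr ()` is the
empty output `∅` of a discarded sample. -/
abbrev Output (nx : ℕ) : Type := Vec nx ⊕ Unit

/-- The local memory of the sampler: the finite sequence of the samples discarded so far. -/
abbrev Memory (nx : ℕ) : Type := Σ r : ℕ, (Fin r → Vec nx)

/-- The empty memory. -/
def Memory.empty (nx : ℕ) : Memory nx := ⟨0, fun i => i.elim0⟩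

/-- Appending a discarded sample to the memory. -/
def Memory.discard {nx : ℕ} (m : Memory nx) (x : Vec nx) : Memory nx :=
  ⟨m.1 + 1, Fin.snoc (α := fun _ => Vec nx) m.2 x⟩

/-- The points `(x_k, m_k, y^k)` on which a belief state at time `k` is defined. -/
abbrev BState (nx ny k : ℕ) : Type := Vec nx × Memory nx × (Fin (k + 1) → Vec ny)

/-- A belief state at time `k`: a (density) function of `(x_k, m_k, y^k)`. -/
abbrev Belief (nx ny k : ℕ) : Type := BState nx ny k → ℝ≥0∞

/-- A stochastic system with state `X_k ∈ 𝒳 ⊆ ℝ^nx` and private Markov input `Y_k ∈ 𝒴 ⊆ ℝ^ny`.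
All densities are with respect to Lebesgue measure on `𝒳` and on `𝒴`. -/
structure PrivateSystem (nx ny : ℕ) where
  /-- the state space `𝒳` -/
  stateSet : Set (Vec nx)
  /-- the space `𝒴` of private inputs -/
  inputSet : Set (Vec ny)
  measurableSet_stateSet : MeasurableSet stateSet
  measurableSet_inputSet : MeasurableSet inputSet
  /-- `p0 x y` is the initial joint density of `(X_0, Y_0)` -/
  p0 : Vec nx → Vec ny → ℝ≥0
  /-- `px x' x y` is the transition density `p(x' | x, y)` of the state -/
  px : Vec nx → Vec nx → Vec ny → ℝ≥0
  /-- `py y' y` is the transition density `p(y' | y)` of the private input -/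
  py : Vec ny → Vec ny → ℝ≥0
  measurable_p0 : Measurable fun q : Vec nx × Vec ny => p0 q.1 q.2
  measurable_px : Measurable fun q : Vec nx × Vec nx × Vec ny => px q.1 q.2.1 q.2.2
  measurable_py : Measurable fun q : Vec ny × Vec ny => py q.1 q.2
  lintegral_p0 : ∫⁻ x in stateSet, ∫⁻ y in inputSet, (p0 x y : ℝ≥0∞) = 1
  lintegral_px : ∀ x ∈ stateSet, ∀ y ∈ inputSet, ∫⁻ x' in stateSet, (px x' x y : ℝ≥0∞) = 1
  lintegral_py : ∀ y ∈ inputSet, ∫⁻ y' in inputSet, (py y' y : ℝ≥0∞) = 1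

/-- A collection `{a(n | x, m)}` of conditional probability mass functions of the decision
`n` (`true` for retaining, `false` for discarding the sample) given the state `x` and the
memory `m`. -/
structure Collection (nx : ℕ) where
  /-- `prob n x m` is `a(n | x, m)` -/
  prob : Bool → Vec nx → Memory nx → ℝ≥0
  measurable_prob : ∀ n, Measurable fun q : Vec nx × Memory nx => prob n q.1 q.2
  sum_prob : ∀ x m, prob false x m + prob true x m = 1

/-- A sampling policy: at time `k` it selects from the past outputs `z^{k-1}` a policy
collection `𝒜_k(z^{k-1})`. -/
structure SamplingPolicy (nx : ℕ) where
  /-- `coll k z` is the collection `𝒜_k(z)` selected after the outputs `z = z^{k-1}` -/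
  coll : (k : ℕ) → (Fin k → Output nx) → Collection nx
  measurable_coll : ∀ k n, Measurable fun q : (Fin k → Output nx) × Vec nx × Memory nx =>
    (coll k q.1).prob n q.2.1 q.2.2

/-- A reconstruction policy: `rec k z` is the reconstruction of `X_k` from the outputs
`z = z^k`. -/
structure ReconstructionPolicy (nx : ℕ) where
  /-- `val k z` is the reconstruction of `X_k` from the outputs `z = z^k` -/
  val : (k : ℕ) → (Fin (k + 1) → Output nx) → Vec nx
  measurable_val : ∀ k, Measurable (val k)

/-! ### Trajectories -/

/-- The trajectories `(x^K, y^K, n^K)`. -/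
abbrev Traj (nx ny K : ℕ) : Type :=
  (Fin (K + 1) → Vec nx) × (Fin (K + 1) → Vec ny) × (Fin (K + 1) → Bool)

namespace Traj

variable {nx ny K : ℕ}

/-- The state at time `k` (used for `k ≤ K` only). -/
def x (ω : Traj nx ny K) (k : ℕ) : Vec nx := ω.1 (Fin.ofNat (K + 1) k)

/-- The private input at time `k` (used for `k ≤ K` only). -/
def y (ω : Traj nx ny K) (k : ℕ) : Vec ny := ω.2.1 (Fin.ofNat (K + 1) k)

/-- The sampling decision at time `k` (used for `k ≤ K` only). -/
def n (ω : Traj nx ny K) (k : ℕ) : Bool := ω.2.2 (Fin.ofNat (K + 1) k)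

/-- The output of the sampler at time `k`. -/
def z (ω : Traj nx ny K) (k : ℕ) : Output nx := if ω.n k then Sum.inl (ω.x k) else Sum.inr ()

/-- The first `k` outputs `(z_0, …, z_{k-1})`, that is, `z^{k-1}`. -/
def outputs (k : ℕ) (ω : Traj nx ny K) : Fin k → Output nx := fun j => ω.z j

/-- The private inputs `y^k = (y_0, …, y_k)`. -/
def inputs (k : ℕ) (ω : Traj nx ny K) : Fin (k + 1) → Vec ny := fun j => ω.y j

/-- The memory at time `k`: the samples discarded before time `k`. -/
def memory (ω : Traj nx ny K) : ℕ → Memory nx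
  | 0 => Memory.empty nx
  | k + 1 => if ω.n k then memory ω k else (memory ω k).discard (ω.x k)

/-- The triple `(x_k, m_k, y^k)`. -/
def bstate (k : ℕ) (ω : Traj nx ny K) : BState nx ny k := (ω.x k, ω.memory k, inputs k ω)

/-- The distortion `l_D(X_k, X̃_k)` under the reconstruction policy `R`. -/
def distortion (lD : Vec nx → Vec nx → ℝ≥0) (R : ReconstructionPolicy nx) (k : ℕ)
    (ω : Traj nx ny K) : ℝ≥0∞ :=
  lD (ω.x k) (R.val k (outputs (k + 1) ω))

end Traj

/-- The conditional density `p(t | u)` of a random variable `T` given a random variable `U`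
with respect to the reference measure `ref`: the density of the joint law of `(U, T)` with
respect to the product of the law of `U` and `ref`. -/
def condDensity {Ω α β : Type*} [MeasurableSpace Ω] [MeasurableSpace α] [MeasurableSpace β]
    (P : Measure Ω) (U : Ω → α) (T : Ω → β) (ref : Measure β) (u : α) (t : β) : ℝ≥0∞ :=
  (P.map fun ω => (U ω, T ω)).rnDeriv ((P.map U).prod ref) (u, t)

namespace PrivateSystem

variable {nx ny : ℕ} (S : PrivateSystem nx ny)

/-! ### Reference measures -/

/-- Lebesgue measure on `𝒳`. -/
def refX : Measure (Vec nx) := volume.restrict S.stateSet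

/-- Lebesgue measure on `𝒴`. -/
def refY : Measure (Vec ny) := volume.restrict S.inputSet

/-- Lebesgue measure on the sequences `y^k`. -/
def refInputs (k : ℕ) : Measure (Fin (k + 1) → Vec ny) := Measure.pi fun _ => S.refY

/-- Lebesgue measure `dm` on the memories: on the memories of length `r` it is the `r`-fold
product of Lebesgue measure on `𝒳`. -/
def refMemory : Measure (Memory nx) :=
  Measure.sum fun r : ℕ => (Measure.pi fun _ : Fin r => S.refX).map (Sigma.mk r)

/-- The measure `dx dm dy^k`. -/
def refState (k : ℕ) : Measure (BState nx ny k) :=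
  S.refX.prod (S.refMemory.prod (S.refInputs k))

/-! ### Quantities that depend on a policy collection and a belief state only -/

/-- The initial belief state: the memory is empty and `(X_0, Y_0)` has density `p0`. -/
def initialBelief : Belief nx ny 0
  | (x, ⟨0, _⟩, y) => S.p0 x (y 0)
  | (_, ⟨_ + 1, _⟩, _) => 0

/-- The probability `P(N_k = 0 | Z^{k-1}) = ∫∫∫ a(0 | x, m) b(x, m, y^k) dx dm dy^k`. -/
def discardProb {k : ℕ} (a : Collection nx) (b : Belief nx ny k) : ℝ≥0∞ :=
  ∫⁻ w, a.prob false w.1 w.2.1 * b w ∂S.refState k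

/-- The density `∫∫ a(1 | x, m) b(x, m, y^k) dm dy^k` of the retained sample at `x`. -/
def retainDensity {k : ℕ} (a : Collection nx) (b : Belief nx ny k) (x : Vec nx) : ℝ≥0∞ :=
  ∫⁻ q, a.prob true x q.1 * b (x, q.1, q.2) ∂S.refMemory.prod (S.refInputs k)

/-- The belief update `b_{k+1} = Φ(b_k, 𝒜_k, Z_k)`. After an empty output the memory
`m_{k+1}` is `(m_k, x_k)`; after a retained sample it is `m_k`. -/
def update {k : ℕ} (b : Belief nx ny k) (a : Collection nx) :
    Output nx → Belief nx ny (k + 1)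
  | Sum.inr _, (_, ⟨0, _⟩, _) => 0
  | Sum.inr _, (x', ⟨r + 1, v⟩, y) =>
      S.px x' (v (Fin.last r)) (y (Fin.last k).castSucc)
        * S.py (y (Fin.last (k + 1))) (y (Fin.last k).castSucc)
        * b (v (Fin.last r), ⟨r, Fin.init v⟩, Fin.init y)
        * a.prob false (v (Fin.last r)) ⟨r, Fin.init v⟩
      / S.discardProb a b
  | Sum.inl x, (x', m, y) =>
      S.px x' x (y (Fin.last k).castSucc)
        * S.py (y (Fin.last (k + 1))) (y (Fin.last k).castSucc)
        * b (x, m, Fin.init y)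
        * a.prob true x m
      / S.retainDensity a b x

/-- The expectation of `f(Z_k, (X_k, M_k, Y^k))` when `(X_k, M_k, Y^k)` has density `b` and
the decision `N_k` is drawn from `a(· | X_k, M_k)`. -/
def stepExp {k : ℕ} (a : Collection nx) (b : Belief nx ny k)
    (f : Output nx → BState nx ny k → ℝ≥0∞) : ℝ≥0∞ :=
  ∫⁻ w, (a.prob false w.1 w.2.1 * b w * f (Sum.inr ()) w
    + a.prob true w.1 w.2.1 * b w * f (Sum.inl w.1) w) ∂S.refState k

/-- The density `p(y^k | Z^{k-1})` under the belief `b`. -/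
def priorInputs {k : ℕ} (b : Belief nx ny k) (y : Fin (k + 1) → Vec ny) : ℝ≥0∞ :=
  ∫⁻ q, b (q.1, q.2, y) ∂S.refX.prod S.refMemory

/-- The density `p(y^k | Z^k)` under the belief `b` and the collection `a`. -/
def posteriorInputs {k : ℕ} (a : Collection nx) (b : Belief nx ny k) :
    Output nx → (Fin (k + 1) → Vec ny) → ℝ≥0∞
  | Sum.inr _, y =>
      (∫⁻ q, a.prob false q.1 q.2 * b (q.1, q.2, y) ∂S.refX.prod S.refMemory)
        / S.discardProb a b
  | Sum.inl x, y => (∫⁻ m, a.prob true x m * b (x, m, y) ∂S.refMemory) / S.retainDensity a b x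

/-- The distortion loss of the reconstruction `xt` of a discarded sample: the expectation of
`l_D(X_k, xt)` on the event `N_k = 0`. -/
def distortionLoss {k : ℕ} (lD : Vec nx → Vec nx → ℝ≥0) (a : Collection nx)
    (b : Belief nx ny k) (xt : Vec nx) : ℝ≥0∞ :=
  ∫⁻ w, a.prob false w.1 w.2.1 * b w * lD w.1 xt ∂S.refState k

/-- The information loss `l_I(a, b)`, the expectation of `log (p(Y^k | Z^k) / p(Y^k | Z^{k-1}))`,
as the expectation of the positive part minus the expectation of the negative part. (The latter
is finite for every probability density `b`.) -/
def infoLoss {k : ℕ} (a : Collection nx) (b : Belief nx ny k) : ℝ≥0∞ :=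
  S.stepExp a b (fun z w => ENNReal.ofReal
      (Real.log (S.posteriorInputs a b z w.2.2 / S.priorInputs b w.2.2).toReal))
    - S.stepExp a b (fun z w => ENNReal.ofReal
      (-Real.log (S.posteriorInputs a b z w.2.2 / S.priorInputs b w.2.2).toReal))

/-- The expression that is minimized over the collections `a` in the Bellman equation, where
`V` is the cost-to-go function of the next time. -/
def bellmanValue {k : ℕ} (lD : Vec nx → Vec nx → ℝ≥0) (lam : ℝ≥0)
    (V : Belief nx ny (k + 1) → ℝ≥0∞) (a : Collection nx) (b : Belief nx ny k) : ℝ≥0∞ :=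
  (⨅ xt : Vec nx, S.distortionLoss lD a b xt) + lam * S.infoLoss a b
    + S.stepExp a b (fun z _ => V (S.update b a z))

/-! ### The closed loop under a sampling policy -/

variable (K : ℕ)

/-- The law of the trajectory `(X^K, Y^K, N^K)` under the sampling policy `A`. -/
def law (A : SamplingPolicy nx) : Measure (Traj nx ny K) :=
  ((Measure.pi fun _ : Fin (K + 1) => S.refX).prod
      ((Measure.pi fun _ : Fin (K + 1) => S.refY).prod Measure.count)).withDensity fun ω : Traj nx ny K =>
    S.p0 (ω.x 0) (ω.y 0)
      * (∏ k ∈ Finset.range K,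
          (S.px (ω.x (k + 1)) (ω.x k) (ω.y k) * S.py (ω.y (k + 1)) (ω.y k) : ℝ≥0∞))
      * ∏ k ∈ Finset.range (K + 1),
          ((A.coll k (Traj.outputs k ω)).prob (ω.n k) (ω.x k) (ω.memory k) : ℝ≥0∞)

/-- The conditional expectation, under the sampling policy `A`, of a nonnegative random variable
given the outputs `Z^{k-1}`. -/
def condExpOutputs (A : SamplingPolicy nx) (k : ℕ) (f : Traj nx ny K → ℝ≥0∞) :
    Traj nx ny K → ℝ≥0∞ :=
  condLExp (MeasurableSpace.comap (Traj.outputs k) inferInstance) (S.law K A) f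

/-- The belief state `b_k`: the conditional density `p(x_k, m_k, y^k | z^{k-1})`. -/
def belief (A : SamplingPolicy nx) (k : ℕ) (z : Fin k → Output nx) : Belief nx ny k :=
  condDensity (S.law K A) (Traj.outputs k) (Traj.bstate k) (S.refState k) z

/-- The random variable `log (p(Y^k | Z^k) / p(Y^k | Z^{k-1}))`. -/
def infoGain (A : SamplingPolicy nx) (k : ℕ) (ω : Traj nx ny K) : ℝ :=
  Real.log
    (condDensity (S.law K A) (Traj.outputs (k + 1)) (Traj.inputs k) (S.refInputs k)
        (Traj.outputs (k + 1) ω) (Traj.inputs k ω)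
      / condDensity (S.law K A) (Traj.outputs k) (Traj.inputs k) (S.refInputs k)
        (Traj.outputs k ω) (Traj.inputs k ω)).toReal

/-- The conditional expectation of `log (p(Y^j | Z^j) / p(Y^j | Z^{j-1}))` given `Z^{k-1}`, as
the conditional expectation of the positive part minus that of the negative part. (The latter
is almost surely finite for `k ≤ j`.) -/
def condInfoGain (A : SamplingPolicy nx) (j k : ℕ) (ω : Traj nx ny K) : ℝ≥0∞ :=
  S.condExpOutputs K A k (fun ω' => ENNReal.ofReal (S.infoGain K A j ω')) ω
    - S.condExpOutputs K A k (fun ω' => ENNReal.ofReal (-S.infoGain K A j ω')) ω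

/-- The objective: total expected distortion plus `λ I(Z^K; Y^K)`, where the mutual information
is the Kullback-Leibler divergence of the joint law from the product of the marginals. -/
def objective (lD : Vec nx → Vec nx → ℝ≥0) (lam : ℝ≥0) (A : SamplingPolicy nx)
    (R : ReconstructionPolicy nx) : ℝ≥0∞ :=
  ∑ k ∈ Finset.range (K + 1), ∫⁻ ω, Traj.distortion lD R k ω ∂S.law K A
    + lam * InformationTheory.klDiv
        ((S.law K A).map fun ω => (Traj.outputs (K + 1) ω, Traj.inputs K ω))
        (((S.law K A).map (Traj.outputs (K + 1))).prod ((S.law K A).map (Traj.inputs K)))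

/-- The reconstruction policy `R` is optimal at time `k` for the sampling policy `A`: it minimizes
the conditional expected distortion given `Z^k`. -/
def IsOptimalReconstruction (lD : Vec nx → Vec nx → ℝ≥0) (A : SamplingPolicy nx)
    (R : ReconstructionPolicy nx) (k : ℕ) : Prop :=
  ∀ R' : ReconstructionPolicy nx,
    S.condExpOutputs K A (k + 1) (Traj.distortion lD R k)
      ≤ᵐ[S.law K A] S.condExpOutputs K A (k + 1) (Traj.distortion lD R' k)

/-- The cost-to-go at time `k` of a pair of policies: the conditional expectation given `Z^{k-1}`
of the distortions and of `λ` times the information gains at the times `k, …, K`. -/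
def costToGo (lD : Vec nx → Vec nx → ℝ≥0) (lam : ℝ≥0) (A : SamplingPolicy nx)
    (R : ReconstructionPolicy nx) (k : ℕ) (ω : Traj nx ny K) : ℝ≥0∞ :=
  ∑ j ∈ Finset.Icc k K,
    (S.condExpOutputs K A k (Traj.distortion lD R j) ω + lam * S.condInfoGain K A j k ω)

/-- `V`, as a function of `Z^{k-1}`, is the optimal cost-to-go at time `k` when the sampling
policy `A` is used before time `k`: it is the (essential) infimum of the costs-to-go at time `k`
over all reconstruction policies and all sampling policies that agree with `A` before time `k`. -/
def IsOptimalCostToGo (lD : Vec nx → Vec nx → ℝ≥0) (lam : ℝ≥0) (A : SamplingPolicy nx)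
    (k : ℕ) (V : (Fin k → Output nx) → ℝ≥0∞) : Prop :=
  AEMeasurable V ((S.law K A).map (Traj.outputs k)) ∧
  (∀ A' : SamplingPolicy nx, (∀ j < k, A'.coll j = A.coll j) → ∀ R : ReconstructionPolicy nx,
    (fun ω => V (Traj.outputs k ω)) ≤ᵐ[S.law K A'] S.costToGo K lD lam A' R k) ∧
  ∀ U : (Fin k → Output nx) → ℝ≥0∞, Measurable U →
    (∀ A' : SamplingPolicy nx, (∀ j < k, A'.coll j = A.coll j) → ∀ R : ReconstructionPolicy nx,
      (fun ω => U (Traj.outputs k ω)) ≤ᵐ[S.law K A'] S.costToGo K lD lam A' R k) →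
    (fun ω => U (Traj.outputs k ω)) ≤ᵐ[S.law K A] fun ω => V (Traj.outputs k ω)

end PrivateSystem

end

/-! The belief state is a sufficient statistic for the history, so the problem is a Markov decision
problem whose state is a density. Iterating the update from the initial density gives an explicit
measurable `iterBelief`. Induction on time (`hasBeliefLaw`) shows that, given the past outputs, the
triple (state, memory, inputs) has this density and the decision is then drawn from the selected
collection. Hence every one-step conditional expectation given the outputs is an integral against
the belief (`condExpOutputs_stepExp`), and the conditional densities in the statement agree almost
everywhere with the explicit ones (`condDensity_ae_eq`).

The objective becomes additive by the chain rule for mutual information. The private input is a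
Markov chain that the sampler does not influence, so its transition density enters both the prior
and the marginal density of the inputs at the next time and cancels; the log-ratios telescope
(`sum_iterGain_ae`, `klDiv_eq`). Gibbs' inequality bounds the expected negative part of each
log-ratio by 1, which makes the truncated differences of positive and negative parts in [0,∞]
meaningful and compatible with conditioning. Thus the objective is the expected cost-to-go at time 0
(`objective_eq`), and the cost-to-go satisfies a one-step recursion (`costToGo_eq_add`).

The value functions are defined by backward Bellman recursion. Backward induction shows that no
policy beats them (`valueFn_le_costToGo`), and a measurable choice of nearly optimal collections and
reconstructions shows that they are approached (`exists_policy_costToGo_le`).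

The real difficulty is measurability, since the Bellman infimum runs over an uncountable family. Up
to null sets, all collections are sections of one jointly measurable function with a parameter in
the Baire space (`exists_measurable_code`). Along measurable families of beliefs the value functions
are therefore lower semianalytic, that is, infima of measurable functions over such a parameter.
This class is stable under sums, infima and integrals, and measurable selection
(`exists_measurable_selector`) makes its members almost everywhere measurable and provides nearly
optimal selectors. Since the value functions ignore null sets (`valueIter_congr`), any version of
the belief may be used. -/

noncomputable section

/-! ### Measurable selection from Borel sets, by compact approximation in the Baire space -/

section Selection

open Filter Topology Set

/-- The sequences dominated by `n` in their first `i` entries. -/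
def dominatedUpTo (n : ℕ → ℕ) (i : ℕ) : Set (ℕ → ℕ) := {σ | ∀ j < i, σ j ≤ n j}

/-- A decreasing intersection of closures of images of dominated sets is contained in the image of
the compact set of dominated sequences. -/
lemma mem_image_dominated {X : Type*} [TopologicalSpace X] [PolishSpace X]
    {ψ : (ℕ → ℕ) → X} (hψ : Continuous ψ) (n : ℕ → ℕ) {x : X}
    (hx : ∀ i, x ∈ closure (ψ '' dominatedUpTo n i)) : x ∈ ψ '' {σ | ∀ j, σ j ≤ n j} := by
  let _ := TopologicalSpace.upgradeIsCompletelyMetrizable X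
  have h1 : ∀ i : ℕ, ∃ σ ∈ dominatedUpTo n i, dist (ψ σ) x < 1 / ((i : ℝ) + 1) := by
    intro i
    obtain ⟨y, ⟨σ, hσ, rfl⟩, hy⟩ := Metric.mem_closure_iff.1 (hx i) (1 / ((i : ℝ) + 1)) (by positivity)
    exact ⟨σ, hσ, by rwa [dist_comm]⟩
  choose σ hσ hd using h1
  -- Truncation moves `σ i` into the compact box without changing its first `i` entries, so a
  -- subsequential limit of `τ` is also one of `σ`.
  let τ : ℕ → ℕ → ℕ := fun i j => min (σ i j) (n j)
  have hK : IsCompact {σ : ℕ → ℕ | ∀ j, σ j ≤ n j} := by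
    have : {σ : ℕ → ℕ | ∀ j, σ j ≤ n j} = Set.pi univ fun j => Set.Iic (n j) := by
      ext; simp [Pi.le_def]
    rw [this]
    exact isCompact_univ_pi fun j => (Set.finite_Iic (n j)).isCompact
  obtain ⟨t, ht, φ, hφ, hlim⟩ := hK.tendsto_subseq (x := τ) (fun i j => min_le_right _ _)
  have hlim' : Tendsto (σ ∘ φ) atTop (𝓝 t) := by
    rw [tendsto_pi_nhds] at hlim ⊢
    intro j
    refine (hlim j).congr' ?_
    filter_upwards [eventually_gt_atTop j] with i hi
    exact min_eq_left (hσ (φ i) j (hi.trans_le (hφ.id_le i)))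
  refine ⟨t, ht, ?_⟩
  have hl1 : Tendsto (fun i => ψ (σ i)) atTop (𝓝 x) := by
    rw [tendsto_iff_dist_tendsto_zero]
    exact squeeze_zero (fun _ => dist_nonneg) (fun i => (hd i).le)
      tendsto_one_div_add_atTop_nhds_zero_nat
  exact tendsto_nhds_unique ((hψ.tendsto t).comp hlim') (hl1.comp hφ.tendsto_atTop)

/-- Inner approximation of the measure of an analytic set by images of compact sets. -/
lemma exists_dominated_measure_image_ge {X : Type*} [TopologicalSpace X] [PolishSpace X]
    [MeasurableSpace X] [BorelSpace X] (μ : Measure X) [IsFiniteMeasure μ]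
    {ψ : (ℕ → ℕ) → X} (hψ : Continuous ψ) {c : ℝ≥0∞} (hc : c < μ (range ψ)) :
    ∃ n : ℕ → ℕ, c ≤ μ (ψ '' {σ | ∀ j, σ j ≤ n j}) := by
  have step : ∀ (i : ℕ) (s : Set (ℕ → ℕ)), c < μ (ψ '' s) →
      ∃ m : ℕ, c < μ (ψ '' (s ∩ {σ | σ i ≤ m})) := by
    intro i s hs
    have hU : ψ '' s = ⋃ m : ℕ, ψ '' (s ∩ {σ | σ i ≤ m}) := by
      rw [← image_iUnion, ← inter_iUnion]
      congr 1
      ext σ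
      simp only [mem_inter_iff, mem_iUnion, mem_ofPred_eq]
      exact ⟨fun h => ⟨h, σ i, le_rfl⟩, fun h => h.1⟩
    have hdir : Directed (· ⊆ ·) fun m : ℕ => ψ '' (s ∩ {σ | σ i ≤ m}) := by
      refine Monotone.directed_le fun a b hab => ?_
      exact image_mono (inter_subset_inter_right _ fun σ (hσ : σ i ≤ a) => hσ.trans hab)
    -- The images need not be measurable; continuity from below along a directed union holds for
    -- arbitrary sets.
    rw [hU, hdir.measure_iUnion] at hs
    exact lt_iSup_iff.1 hs
  choose! m hm using step
  let S : ℕ → Set (ℕ → ℕ) := fun i => Nat.rec univ (fun i s => s ∩ {σ | σ i ≤ m i s}) i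
  have hS0 : S 0 = univ := rfl
  have hS1 : ∀ i, S (i + 1) = S i ∩ {σ | σ i ≤ m i (S i)} := fun i => rfl
  have hS : ∀ i, c < μ (ψ '' S i) := by
    intro i
    induction i with
    | zero => rw [hS0, image_univ]; exact hc
    | succ i ih => rw [hS1]; exact hm i (S i) ih
  refine ⟨fun i => m i (S i), ?_⟩
  have hS2 : ∀ i, S i = dominatedUpTo (fun i => m i (S i)) i := by
    intro i
    induction i with
    | zero => ext; simp [hS0, dominatedUpTo]
    | succ i ih =>
      rw [hS1]
      ext σ
      constructor
      · rintro ⟨h1, h2⟩ j hj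
        rcases Nat.lt_succ_iff_lt_or_eq.1 hj with h | rfl
        · rw [ih] at h1; exact h1 j h
        · exact h2
      · intro h
        refine ⟨?_, h i (Nat.lt_succ_self i)⟩
        rw [ih]
        exact fun j hj => h j (hj.trans (Nat.lt_succ_self i))
  -- Closures are taken to have measurable sets, for which continuity from above is available. In
  -- the limit nothing is gained, by compactness.
  have hsub : (⋂ i, closure (ψ '' S i)) ⊆ ψ '' {σ | ∀ j, σ j ≤ m j (S j)} := by
    intro x hx
    refine mem_image_dominated hψ _ fun i => ?_
    rw [← hS2 i]
    exact mem_iInter.1 hx i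
  refine le_trans ?_ (measure_mono hsub)
  have hanti : Antitone fun i => closure (ψ '' S i) := by
    refine antitone_nat_of_succ_le fun i => closure_mono (image_mono ?_)
    rw [hS1]; exact inter_subset_left
  rw [hanti.measure_iInter (fun i => isClosed_closure.measurableSet.nullMeasurableSet)
    ⟨0, measure_ne_top _ _⟩]
  exact le_iInf fun i => (hS i).le.trans (measure_mono subset_closure)

/-- The least index satisfying a measurable family of conditions depends measurably on the
parameter. -/
lemma measurable_sInf_nat {X : Type*} [MeasurableSpace X] {P : ℕ → Set X}
    (hP : ∀ j, MeasurableSet (P j)) : Measurable fun x => sInf {j : ℕ | x ∈ P j} := by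
  classical
  have hE : MeasurableSet (⋃ j, P j) := MeasurableSet.iUnion hP
  -- The second alternative makes the search succeed everywhere, with value 0 off the union, in
  -- accordance with `sInf ∅ = 0`.
  have h : Measurable fun x => Nat.find (p := fun j => x ∈ P j ∨ x ∉ ⋃ j, P j)
      (by by_cases hx : x ∈ ⋃ j, P j
          · obtain ⟨j, hj⟩ := mem_iUnion.1 hx; exact ⟨j, Or.inl hj⟩
          · exact ⟨0, Or.inr hx⟩) := by
    refine measurable_find _ fun k => ?_
    exact (hP k).union hE.compl
  convert h using 2 with x
  by_cases hx : x ∈ ⋃ j, P j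
  · have hne : {j : ℕ | x ∈ P j}.Nonempty := by
      obtain ⟨j, hj⟩ := mem_iUnion.1 hx; exact ⟨j, hj⟩
    refine le_antisymm (Nat.sInf_le ?_) (Nat.find_min' _ (Or.inl (Nat.sInf_mem hne)))
    exact (Nat.find_spec (p := fun j => x ∈ P j ∨ x ∉ ⋃ j, P j) _).resolve_right (fun h => h hx)
  · have he : {j : ℕ | x ∈ P j} = ∅ := by
      ext j; simp only [mem_ofPred_eq, mem_empty_iff_false, iff_false]
      exact fun h => hx (mem_iUnion.2 ⟨j, h⟩)
    rw [he, Nat.sInf_empty, eq_comm, Nat.find_eq_zero]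
    exact Or.inr hx

/-- A continuous function on a compact set of sequences has a measurable section on its image. -/
lemma exists_measurable_section_of_isCompact {X : Type*} [TopologicalSpace X] [PolishSpace X]
    [MeasurableSpace X] [BorelSpace X] {ψ : (ℕ → ℕ) → X} (hψ : Continuous ψ)
    {K : Set (ℕ → ℕ)} (hK : IsCompact K) :
    ∃ s : X → ℕ → ℕ, Measurable s ∧ ∀ x ∈ ψ '' K, ψ (s x) = x := by
  classical
  let cyl : List ℕ → Set (ℕ → ℕ) := fun l => {σ | ∀ j : ℕ, ∀ h : j < l.length, σ j = l[j]}
  have hcyl : ∀ l, IsClosed (cyl l) := by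
    intro l
    simp only [cyl, ofPred_forall]
    exact isClosed_iInter fun j => isClosed_iInter fun h =>
      isClosed_eq (continuous_apply j) continuous_const
  -- `D l` is the set of points whose fibre in `K` meets the cylinder of `l`; it is closed by
  -- compactness. The section follows the leftmost branch: each new entry is the least one that
  -- keeps the fibre nonempty.
  let D : List ℕ → Set X := fun l => ψ '' (K ∩ cyl l)
  have hD : ∀ l, MeasurableSet (D l) := fun l =>
    ((hK.inter_right (hcyl l)).image hψ).isClosed.measurableSet
  obtain ⟨nxt, hnxt_def⟩ : ∃ nxt : X → List ℕ → ℕ, ∀ x l, nxt x l = sInf {j | x ∈ D (l ++ [j])} :=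
    ⟨_, fun _ _ => rfl⟩
  obtain ⟨L, hL0, hL1⟩ : ∃ L : ℕ → X → List ℕ, (∀ x, L 0 x = []) ∧
      ∀ i x, L (i + 1) x = L i x ++ [nxt x (L i x)] :=
    ⟨fun i x => Nat.rec [] (fun _ l => l ++ [nxt x l]) i, fun _ => rfl, fun _ _ => rfl⟩
  let _ : MeasurableSpace (List ℕ) := ⊤
  have : MeasurableSingletonClass (List ℕ) := ⟨fun _ => trivial⟩
  have hnxt : Measurable fun q : List ℕ × X => nxt q.2 q.1 := by
    refine measurable_from_prod_countable_right fun l => ?_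
    simp only [hnxt_def]
    exact measurable_sInf_nat fun j => hD (l ++ [j])
  have hL : ∀ i, Measurable (L i) := by
    intro i
    induction i with
    | zero => rw [funext hL0]; exact measurable_const
    | succ i ih =>
      rw [funext (hL1 i)]
      have h1 : Measurable fun x => nxt x (L i x) := hnxt.comp (ih.prodMk measurable_id)
      have h2 : Measurable fun q : List ℕ × ℕ => q.1 ++ [q.2] := measurable_of_countable _
      exact h2.comp (ih.prodMk h1)
  have hlen : ∀ i x, (L i x).length = i := by
    intro i x
    induction i with
    | zero => rw [hL0]; rfl
    | succ i ih => rw [hL1]; simp [ih]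
  refine ⟨fun x i => nxt x (L i x), ?_, ?_⟩
  · exact measurable_pi_lambda _ fun i => hnxt.comp ((hL i).prodMk measurable_id)
  · intro x hx
    have hmem : ∀ i, x ∈ D (L i x) := by
      intro i
      induction i with
      | zero =>
        obtain ⟨σ, hσ, h⟩ := hx
        exact ⟨σ, ⟨hσ, fun j h => absurd h (by simp [hL0])⟩, h⟩
      | succ i ih =>
        rw [hL1]
        have hne : {j | x ∈ D (L i x ++ [j])}.Nonempty := by
          obtain ⟨σ, ⟨hσ, hc⟩, h⟩ := ih
          refine ⟨σ i, σ, ⟨hσ, fun j hj => ?_⟩, h⟩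
          rw [List.length_append, hlen] at hj
          rcases Nat.lt_succ_iff_lt_or_eq.1 hj with h' | rfl
          · rw [List.getElem_append_left (by rwa [hlen])]
            exact hc j (by rwa [hlen])
          · rw [List.getElem_append_right (by rw [hlen])]
            simp
        rw [hnxt_def]
        exact Nat.sInf_mem hne
    have hget : ∀ i j : ℕ, ∀ h : j < (L i x).length, (L i x)[j] = nxt x (L j x) := by
      intro i
      induction i with
      | zero => intro j h; simp [hL0] at h
      | succ i ih =>
        intro j h
        have h' := h
        rw [hlen] at h'
        simp only [hL1]
        rcases Nat.lt_succ_iff_lt_or_eq.1 h' with h'' | rfl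
        · rw [List.getElem_append_left (by rwa [hlen])]
          exact ih j _
        · rw [List.getElem_append_right (by rw [hlen])]
          simp
    -- These points of the fibre agree with the branch on longer and longer initial segments, so
    -- they converge to it, and continuity puts the branch itself in the fibre.
    choose σ hσ hσx using hmem
    have hlim : Tendsto σ atTop (𝓝 fun i => nxt x (L i x)) := by
      rw [tendsto_pi_nhds]
      intro j
      refine tendsto_const_nhds.congr' ?_
      filter_upwards [eventually_gt_atTop j] with i hi
      have hj : j < (L i x).length := by rwa [hlen]
      rw [(hσ i).2 j hj, hget i j hj]
    refine tendsto_nhds_unique ((hψ.tendsto _).comp hlim) ?_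
    exact tendsto_const_nhds.congr fun i => (hσx i).symm

/-- A continuous function on the Baire space has a measurable section almost everywhere. -/
lemma exists_measurable_section_ae {X : Type*} [TopologicalSpace X] [PolishSpace X]
    [MeasurableSpace X] [BorelSpace X] (μ : Measure X) [IsFiniteMeasure μ]
    {ψ : (ℕ → ℕ) → X} (hψ : Continuous ψ) :
    ∃ s : X → ℕ → ℕ, Measurable s ∧ ∀ᵐ x ∂μ, x ∈ range ψ → ψ (s x) = x := by
  classical
  rcases eq_or_ne (μ (range ψ)) 0 with h0 | h0
  · refine ⟨fun _ _ => 0, measurable_const, ?_⟩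
    filter_upwards [measure_eq_zero_iff_ae_notMem.1 h0] with x hx h using absurd h hx
  -- The levels `c i` increase to the measure of the range, so the images of countably many compact
  -- boxes exhaust the range up to a null set. The first box whose image contains `x` decides which
  -- section is used.
  obtain ⟨c, -, hc, hclim⟩ := exists_seq_strictMono_tendsto' (pos_iff_ne_zero.2 h0)
  choose n hn using fun i => exists_dominated_measure_image_ge μ hψ (hc i).2
  let K : ℕ → Set (ℕ → ℕ) := fun i => {σ | ∀ j, σ j ≤ n i j}
  have hK : ∀ i, IsCompact (K i) := by
    intro i
    have : K i = Set.pi univ fun j => Set.Iic (n i j) := by ext; simp [K, Pi.le_def]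
    rw [this]
    exact isCompact_univ_pi fun j => (Set.finite_Iic (n i j)).isCompact
  have hKm : ∀ i, MeasurableSet (ψ '' K i) := fun i => ((hK i).image hψ).isClosed.measurableSet
  choose s hs hsK using fun i => exists_measurable_section_of_isCompact hψ (hK i)
  have hidx : Measurable fun x => sInf {i : ℕ | x ∈ ψ '' K i} := measurable_sInf_nat hKm
  refine ⟨fun x => s (sInf {i : ℕ | x ∈ ψ '' K i}) x, ?_, ?_⟩
  · have : Measurable fun q : ℕ × X => s q.1 q.2 := measurable_from_prod_countable_right hs
    exact this.comp (hidx.prodMk measurable_id)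
  · have hU : MeasurableSet (⋃ i, ψ '' K i) := MeasurableSet.iUnion hKm
    have hUsub : (⋃ i, ψ '' K i) ⊆ range ψ := iUnion_subset fun i => image_subset_range _ _
    have hle : μ (range ψ) ≤ μ (⋃ i, ψ '' K i) :=
      le_of_tendsto' hclim fun i => (hn i).trans (measure_mono (subset_iUnion (fun i => ψ '' K i) i))
    have hae : (⋃ i, ψ '' K i) =ᵐ[μ] range ψ :=
      ae_eq_of_subset_of_measure_ge hUsub hle hU.nullMeasurableSet (measure_ne_top _ _)
    filter_upwards [hae.mem_iff] with x hx hxr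
    have hne : {i : ℕ | x ∈ ψ '' K i}.Nonempty := by
      obtain ⟨i, hi⟩ := mem_iUnion.1 (hx.2 hxr); exact ⟨i, hi⟩
    exact hsK _ x (Nat.sInf_mem hne)

/-- The indicators of a generating sequence map the space to the Cantor space and recover all its
measurable sets. Selection is thereby carried over from Polish spaces to spaces that need not be
standard Borel. -/
lemma comap_mapNatBool (X : Type*) [m : MeasurableSpace X] [MeasurableSpace.CountablyGenerated X] :
    MeasurableSpace.comap (MeasurableSpace.mapNatBool X) inferInstance = m := by
  refine le_antisymm (MeasurableSpace.measurable_mapNatBool X).comap_le ?_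
  conv_lhs => rw [← MeasurableSpace.generateFrom_natGeneratingSequence X]
  refine MeasurableSpace.generateFrom_le ?_
  rintro _ ⟨n, rfl⟩
  refine ⟨{f | f n = true}, ?_, ?_⟩
  · exact measurableSet_eq_fun (measurable_pi_apply n) measurable_const
  · ext x; simp [MeasurableSpace.mapNatBool]

/-- **Measurable selection**: a measurable set in a product with the Baire space is uniformized,
almost everywhere on its projection, by a measurable function. -/
theorem exists_measurable_selector {X : Type*} [m : MeasurableSpace X]
    [MeasurableSpace.CountablyGenerated X] (μ : Measure X) [SFinite μ]
    {B : Set (X × (ℕ → ℕ))} (hB : MeasurableSet B) :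
    ∃ g : X → ℕ → ℕ, Measurable g ∧ ∀ᵐ x ∂μ, (∃ c, (x, c) ∈ B) → (x, g x) ∈ B := by
  let f := MeasurableSpace.mapNatBool X
  have hf : Measurable f := MeasurableSpace.measurable_mapNatBool X
  obtain ⟨B', hB', rfl⟩ : ∃ B' : Set ((ℕ → Bool) × (ℕ → ℕ)), MeasurableSet B' ∧
      Prod.map f id ⁻¹' B' = B := by
    have : m.prod (inferInstance : MeasurableSpace (ℕ → ℕ))
        = MeasurableSpace.comap (Prod.map f id) inferInstance := by
      refine Eq.trans ?_ (MeasurableSpace.comap_prodMap (mα := inferInstance)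
        (mβ := inferInstance) f id).symm
      rw [comap_mapNatBool, MeasurableSpace.comap_id]
    change MeasurableSet[m.prod inferInstance] B at hB
    rw [this] at hB
    exact hB
  have : PolishSpace Bool := inferInstance
  have key : ∃ g : (ℕ → Bool) → ℕ → ℕ, Measurable g ∧
      ∀ᵐ x ∂(μ.toFinite.map f), (∃ c, (x, c) ∈ B') → (x, g x) ∈ B' := by
    -- A nonempty Borel set is a continuous image of the Baire space. A section of the first
    -- coordinate of this parametrization finds a point of the set above `x`, whose second
    -- coordinate is the selected value.
    have hana := hB'.analyticSet
    rw [AnalyticSet] at hana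
    rcases hana with rfl | ⟨φ, hφ, rfl⟩
    · exact ⟨fun _ _ => 0, measurable_const, by simp⟩
    · obtain ⟨s, hs, hsr⟩ := exists_measurable_section_ae (μ.toFinite.map f)
        (continuous_fst.comp hφ)
      refine ⟨fun x => (φ (s x)).2, (continuous_snd.comp hφ).measurable.comp hs, ?_⟩
      filter_upwards [hsr] with x hx
      rintro ⟨c, σ, hσ⟩
      have h1 : (φ (s x)).1 = x := hx ⟨σ, by simp [hσ]⟩
      exact ⟨s x, Prod.ext h1 rfl⟩
  obtain ⟨g, hg, hgB⟩ := key
  refine ⟨fun x => g (f x), hg.comp hf, ?_⟩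
  have h2 := ae_of_ae_map hf.aemeasurable hgB
  rw [ae_toFinite] at h2
  exact h2

end Selection

/-! ### One measurable function that codes all measurable functions up to null sets -/

section Coding

open Filter Topology Set

/-- Up to null sets, all measurable sets are limits superior of sequences from one countable
family of measurable sets. -/
lemma exists_measurableSet_code {X : Type*} [MeasurableSpace X]
    [MeasurableSpace.CountablyGenerated X] (μ : Measure X) [SFinite μ] :
    ∃ E : Set ((ℕ → ℕ) × X), MeasurableSet E ∧ ∀ s, MeasurableSet s →
      ∃ c : ℕ → ℕ, ∀ᵐ x ∂μ, (c, x) ∈ E ↔ x ∈ s := by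
  obtain ⟨𝒜, h𝒜c, h𝒜⟩ := exists_countable_measureDense (μ := μ.toFinite)
  obtain ⟨a, ha⟩ := h𝒜c.exists_eq_range h𝒜.nonempty
  have ham : ∀ n, MeasurableSet (a n) := fun n => h𝒜.measurable _ (ha ▸ mem_range_self n)
  have hpre : MeasurableSet {q : ℕ × X | q.2 ∈ a q.1} := by
    have : {q : ℕ × X | q.2 ∈ a q.1} = ⋃ n : ℕ, ({n} : Set ℕ) ×ˢ a n := by ext ⟨n, x⟩; simp
    rw [this]
    exact MeasurableSet.iUnion fun n => (measurableSet_singleton n).prod (ham n)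
  have hk : ∀ k : ℕ, MeasurableSet {q : (ℕ → ℕ) × X | q.2 ∈ a (q.1 k)} := by
    intro k
    have hm : Measurable fun q : (ℕ → ℕ) × X => ((q.1 k, q.2) : ℕ × X) := by fun_prop
    exact hm hpre
  refine ⟨⋂ n : ℕ, ⋃ k : ℕ, ⋃ _ : n ≤ k, {q | q.2 ∈ a (q.1 k)}, ?_, ?_⟩
  · exact MeasurableSet.iInter fun n => MeasurableSet.iUnion fun k => MeasurableSet.iUnion fun _ => hk k
  · intro s hs
    -- Geometric errors are summable, so by Borel–Cantelli almost every point lies in finitely many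
    -- of the symmetric differences; membership then stabilizes and the limit superior is `s` up to
    -- a null set.
    have h1 : ∀ k : ℕ, ∃ n, μ.toFinite (symmDiff s (a n)) < ENNReal.ofReal ((1 / 2) ^ k) := by
      intro k
      obtain ⟨t, ht, h⟩ := h𝒜.approx s hs (measure_ne_top _ _) ((1 / 2) ^ k) (by positivity)
      rw [ha] at ht
      obtain ⟨n, rfl⟩ := ht
      exact ⟨n, h⟩
    choose c hc using h1
    refine ⟨c, ?_⟩
    have hsum : ∑' k, μ.toFinite (symmDiff s (a (c k))) ≠ ∞ := by
      refine ne_top_of_le_ne_top ?_ (ENNReal.tsum_le_tsum fun k => (hc k).le)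
      rw [← ENNReal.ofReal_tsum_of_nonneg (fun k => by positivity)
        (summable_geometric_of_lt_one (by norm_num) (by norm_num))]
      exact ENNReal.ofReal_ne_top
    have hae := ae_eventually_notMem hsum
    rw [ae_toFinite] at hae
    filter_upwards [hae] with x hx
    obtain ⟨N, hN⟩ := eventually_atTop.1 hx
    have hiff : ∀ k ≥ N, x ∈ a (c k) ↔ x ∈ s := by
      intro k hk
      have := hN k hk
      rw [Set.mem_symmDiff] at this
      tauto
    simp only [mem_iInter, mem_iUnion, mem_ofPred_eq, exists_prop]
    constructor
    · intro h
      obtain ⟨k, hk, hx⟩ := h N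
      exact (hiff k hk).1 hx
    · exact fun h n => ⟨max n N, le_max_left _ _, (hiff _ (le_max_right _ _)).2 h⟩

/-- A measurable surjection from the Baire space onto its countable power. -/
def unpairCode (c : ℕ → ℕ) (i j : ℕ) : ℕ := c (Nat.pair i j)

lemma measurable_unpairCode : Measurable unpairCode :=
  measurable_pi_lambda _ fun _ => measurable_pi_lambda _ fun _ => measurable_pi_apply _

lemma unpairCode_surjective : Function.Surjective unpairCode := by
  intro d
  refine ⟨fun n => d n.unpair.1 n.unpair.2, ?_⟩
  funext i j
  simp [unpairCode]

lemma not_countable_nat_fun_bool : ¬ Countable (ℕ → Bool) := by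
  rw [not_countable_iff, ← Cardinal.aleph0_lt_mk_iff]
  simpa using Cardinal.aleph0_lt_continuum

lemma not_countable_nat_fun_nat : ¬ Countable (ℕ → ℕ) := by
  rw [not_countable_iff, ← Cardinal.aleph0_lt_mk_iff]
  simpa using Cardinal.aleph0_lt_continuum

/-- Every nonempty standard Borel space is a measurable retract of the Cantor space. -/
lemma exists_measurable_retract_bool (T : Type*) [MeasurableSpace T] [StandardBorelSpace T]
    [Nonempty T] : ∃ (i : T → ℕ → Bool) (r : (ℕ → Bool) → T), Measurable i ∧ Measurable r ∧
      ∀ t, r (i t) = t := by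
  obtain ⟨f, hf⟩ := exists_measurableEmbedding_real T
  have hR : ¬ Countable ℝ := by rw [not_countable_iff]; infer_instance
  let e : ℝ ≃ᵐ (ℕ → Bool) := PolishSpace.measurableEquivOfNotCountable hR not_countable_nat_fun_bool
  exact ⟨e ∘ f, hf.invFun ∘ e.symm, e.measurable.comp hf.measurable,
    hf.measurable_invFun.comp e.symm.measurable, fun t => by simp [hf.leftInverse_invFun t]⟩

/-- Every nonempty standard Borel space is a measurable image of the Baire space. -/
lemma exists_measurable_surjective (T : Type*) [MeasurableSpace T] [StandardBorelSpace T]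
    [Nonempty T] : ∃ r : (ℕ → ℕ) → T, Measurable r ∧ Function.Surjective r := by
  obtain ⟨i, r, -, hr, hri⟩ := exists_measurable_retract_bool T
  let e : (ℕ → ℕ) ≃ᵐ (ℕ → Bool) :=
    PolishSpace.measurableEquivOfNotCountable not_countable_nat_fun_nat not_countable_nat_fun_bool
  exact ⟨r ∘ e, hr.comp e.measurable, fun t => ⟨e.symm (i t), by simp [hri]⟩⟩

/-- Up to null sets, all measurable functions with values in a standard Borel space are the
sections of one jointly measurable function with parameter in the Baire space. -/
theorem exists_measurable_code {X T : Type*} [MeasurableSpace X]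
    [MeasurableSpace.CountablyGenerated X] (μ : Measure X) [SFinite μ]
    [MeasurableSpace T] [StandardBorelSpace T] [Nonempty T] :
    ∃ e : (ℕ → ℕ) × X → T, Measurable e ∧ ∀ f : X → T, Measurable f →
      ∃ c : ℕ → ℕ, ∀ᵐ x ∂μ, e (c, x) = f x := by
  classical
  obtain ⟨i, r, hi, hr, hri⟩ := exists_measurable_retract_bool T
  obtain ⟨E, hE, hEs⟩ := exists_measurableSet_code μ
  have hdec : ∀ n : ℕ, Measurable fun q : (ℕ → ℕ) × X => decide ((unpairCode q.1 n, q.2) ∈ E) := by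
    intro n
    refine measurable_to_bool ?_
    have : (fun q : (ℕ → ℕ) × X => decide ((unpairCode q.1 n, q.2) ∈ E)) ⁻¹' {true}
        = (fun q : (ℕ → ℕ) × X => (unpairCode q.1 n, q.2)) ⁻¹' E := by ext; simp
    rw [this]
    exact ((((measurable_pi_apply n).comp measurable_unpairCode).comp measurable_fst).prodMk
      measurable_snd) hE
  refine ⟨fun q => r fun n => decide ((unpairCode q.1 n, q.2) ∈ E),
    hr.comp (measurable_pi_lambda _ hdec), ?_⟩
  intro f hf
  have hs : ∀ n : ℕ, MeasurableSet {x | i (f x) n = true} := fun n =>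
    measurableSet_eq_fun ((measurable_pi_apply n).comp (hi.comp hf)) measurable_const
  choose c hc using fun n => hEs _ (hs n)
  -- One sequence packs the codes of the countably many sets given by the Boolean coordinates of
  -- `f`.
  obtain ⟨d, rfl⟩ := unpairCode_surjective c
  refine ⟨d, ?_⟩
  filter_upwards [ae_all_iff.2 hc] with x hx
  rw [← hri (f x)]
  congr 1
  funext n
  rw [Bool.eq_iff_iff, decide_eq_true_iff]
  exact hx n

end Coding

/-! ### Lower semianalytic functions and their stability properties -/

section LowerSemianalytic

open Set

/-- A lower semianalytic function: an infimum of a measurable function over a parameter in the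
Baire space. -/
def LowerSemianalytic {X : Type*} [MeasurableSpace X] (h : X → ℝ≥0∞) : Prop :=
  ∃ F : X × (ℕ → ℕ) → ℝ≥0∞, Measurable F ∧ ∀ x, h x = ⨅ c, F (x, c)

namespace LowerSemianalytic

variable {X Y T : Type*} [MeasurableSpace X] [MeasurableSpace Y] [MeasurableSpace T]

lemma of_measurable {h : X → ℝ≥0∞} (hh : Measurable h) : LowerSemianalytic h :=
  ⟨fun q => h q.1, hh.comp measurable_fst, fun _ => by simp⟩

lemma comp {h : X → ℝ≥0∞} (hh : LowerSemianalytic h) {g : Y → X} (hg : Measurable g) :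
    LowerSemianalytic fun y => h (g y) := by
  obtain ⟨F, hF, h1⟩ := hh
  exact ⟨fun q => F (g q.1, q.2), hF.comp ((hg.comp measurable_fst).prodMk measurable_snd),
    fun y => h1 _⟩

/-- A lower semianalytic function may be represented with a parameter in a standard Borel space. -/
lemma of_iInf_measurable [StandardBorelSpace T] [Nonempty T] {h : X → ℝ≥0∞}
    {F : X × T → ℝ≥0∞} (hF : Measurable F) (hh : ∀ x, h x = ⨅ t, F (x, t)) :
    LowerSemianalytic h := by
  obtain ⟨r, hr, hrs⟩ := exists_measurable_surjective T
  refine ⟨fun q => F (q.1, r q.2), hF.comp (measurable_fst.prodMk (hr.comp measurable_snd)), ?_⟩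
  intro x
  rw [hh]
  exact (hrs.iInf_comp fun t => F (x, t)).symm

/-- The new parameter and the one already present merge into a pair, so no selection is needed. -/
lemma iInf_param [StandardBorelSpace T] [Nonempty T] {g : X × T → ℝ≥0∞}
    (hg : LowerSemianalytic g) : LowerSemianalytic fun x => ⨅ t, g (x, t) := by
  obtain ⟨F, hF, h1⟩ := hg
  refine of_iInf_measurable (T := T × (ℕ → ℕ)) (F := fun q => F ((q.1, q.2.1), q.2.2))
    (by fun_prop) fun x => ?_
  rw [iInf_prod]
  exact iInf_congr fun t => h1 _

/-- The two infima run over independent parameters, so their sum is an infimum over pairs. -/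
lemma add {g h : X → ℝ≥0∞} (hg : LowerSemianalytic g) (hh : LowerSemianalytic h) :
    LowerSemianalytic fun x => g x + h x := by
  obtain ⟨F, hF, h1⟩ := hg
  obtain ⟨G, hG, h2⟩ := hh
  refine of_iInf_measurable (T := (ℕ → ℕ) × (ℕ → ℕ))
    (F := fun q => F (q.1, q.2.1) + G (q.1, q.2.2)) (by fun_prop) fun x => ?_
  rw [h1, h2, iInf_prod, ENNReal.iInf_add]
  exact iInf_congr fun c => ENNReal.add_iInf

/-- Multiplication by a measurable function which is finite on the relevant set. -/
lemma mul_of_ne_top {g h : X → ℝ≥0∞} (hg : Measurable g) (hg' : ∀ x, g x ≠ ∞)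
    (hh : LowerSemianalytic h) : LowerSemianalytic fun x => g x * h x := by
  obtain ⟨F, hF, h1⟩ := hh
  refine ⟨fun q => g q.1 * F q, (hg.comp measurable_fst).mul hF, fun x => ?_⟩
  simp only [h1]
  exact ENNReal.mul_iInf fun h => absurd h (hg' x)

variable [MeasurableSpace.CountablyGenerated X]

/-- A lower semianalytic function is almost everywhere equal to a measurable function. -/
lemma aemeasurable {h : X → ℝ≥0∞} (hh : LowerSemianalytic h) (μ : Measure X) [SFinite μ] :
    AEMeasurable h μ := by
  obtain ⟨F, hF, h1⟩ := hh
  -- For each rational level a selector goes below that level wherever this is possible. The infimum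
  -- along these countably many selectors is measurable and almost everywhere equals the full
  -- infimum.
  choose g hg hgB using fun q : ℚ => exists_measurable_selector μ
    (B := {p : X × (ℕ → ℕ) | F p < ENNReal.ofReal q}) (measurableSet_lt hF measurable_const)
  refine ⟨fun x => ⨅ q : ℚ, F (x, g q x),
    Measurable.iInf fun q => hF.comp (measurable_id.prodMk (hg q)), ?_⟩
  filter_upwards [ae_all_iff.2 hgB] with x hx
  refine le_antisymm ?_ ?_
  · rw [h1]
    exact le_iInf fun q => iInf_le _ _
  · refine le_of_forall_gt fun b hb => ?_
    rw [h1] at hb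
    obtain ⟨q, -, hq, hqb⟩ := ENNReal.lt_iff_exists_rat_btwn.1 hb
    obtain ⟨c, hc⟩ := iInf_lt_iff.1 hq
    exact (iInf_le _ q).trans_lt ((hx q ⟨c, hc⟩).trans hqb)

/-- Almost optimal measurable selection. -/
lemma exists_selector {F : X × T → ℝ≥0∞} [StandardBorelSpace T] [Nonempty T]
    (hF : Measurable F) (μ : Measure X) [SFinite μ]
    {ε : X → ℝ≥0∞} (hε : Measurable ε) (hε0 : ∀ x, ε x ≠ 0) :
    ∃ g : X → T, Measurable g ∧ ∀ᵐ x ∂μ, F (x, g x) ≤ (⨅ t, F (x, t)) + ε x := by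
  obtain ⟨r, hr, hrs⟩ := exists_measurable_surjective T
  have hlsa : LowerSemianalytic fun x => ⨅ t, F (x, t) := of_iInf_measurable hF fun _ => rfl
  -- The infimum need not be measurable, so the set to select from is defined with a measurable
  -- version of it.
  obtain ⟨h', hh', hae⟩ := hlsa.aemeasurable μ
  obtain ⟨g, hg, hgB⟩ := exists_measurable_selector μ
    (B := {p : X × (ℕ → ℕ) | F (p.1, r p.2) ≤ h' p.1 + ε p.1})
    (measurableSet_le (by fun_prop) (by fun_prop))
  refine ⟨fun x => r (g x), hr.comp hg, ?_⟩
  filter_upwards [hgB, hae] with x hx hx'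
  rw [hx']
  refine hx ?_
  rcases eq_or_ne (h' x) ∞ with h | h
  · exact ⟨fun _ => 0, by simp [h]⟩
  · have : (⨅ t, F (x, t)) < h' x + ε x := by
      rw [hx']; exact ENNReal.lt_add_right h (hε0 x)
    obtain ⟨t, ht⟩ := iInf_lt_iff.1 this
    obtain ⟨c, rfl⟩ := hrs t
    exact ⟨c, ht.le⟩

/-- The integral of a lower semianalytic function over one of two variables is lower
semianalytic. -/
lemma lintegral_right {g : Y × X → ℝ≥0∞} (hg : LowerSemianalytic g) (μ : Measure X) [SigmaFinite μ] :
    LowerSemianalytic fun y => ∫⁻ x, g (y, x) ∂μ := by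
  obtain ⟨F, hF, h1⟩ := hg
  obtain ⟨e, he, hecode⟩ := exists_measurable_code (T := ℕ → ℕ) μ
  -- The parameter now codes a whole function of `x`, that is, a selector; this is how the infimum
  -- is moved outside the integral.
  refine ⟨fun q => ∫⁻ x, F ((q.1, x), e (q.2, x)) ∂μ, ?_, ?_⟩
  · refine Measurable.lintegral_prod_right'
      (f := fun p : (Y × (ℕ → ℕ)) × X => F ((p.1.1, p.2), e (p.1.2, p.2))) ?_
    fun_prop
  · intro y
    refine le_antisymm (le_iInf fun c => lintegral_mono fun x => ?_) ?_
    · rw [h1]; exact iInf_le _ _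
    · refine ENNReal.le_of_forall_pos_le_add fun δ hδ _ => ?_
      -- The pointwise slack is strictly positive but has integral below `δ`, which is possible
      -- because the measure is σ-finite.
      obtain ⟨ε, hε0, hεm, hεi⟩ := exists_pos_lintegral_lt_of_sigmaFinite μ
        (ENNReal.coe_ne_zero.2 hδ.ne')
      obtain ⟨s, hs, hsF⟩ := exists_selector (F := fun p : X × (ℕ → ℕ) => F ((y, p.1), p.2))
        (by fun_prop) μ (ε := fun x => ε x) (by fun_prop) (fun x => by simpa using (hε0 x).ne')
      obtain ⟨c, hc⟩ := hecode s hs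
      refine (iInf_le _ c).trans ?_
      calc ∫⁻ x, F ((y, x), e (c, x)) ∂μ ≤ ∫⁻ x, (g (y, x) + ε x) ∂μ := by
            refine lintegral_mono_ae ?_
            filter_upwards [hsF, hc] with x hx hx'
            rw [hx', h1]; exact hx
        _ = (∫⁻ x, g (y, x) ∂μ) + ∫⁻ x, ε x ∂μ := lintegral_add_right _ (by fun_prop)
        _ ≤ _ := by gcongr

end LowerSemianalytic

end LowerSemianalytic

/-! ### Reference measures on memories and belief states, and changes of variables -/

section ReferenceMeasures

open Set

lemma measurable_fin_snoc {α : Type*} [MeasurableSpace α] (n : ℕ) :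
    Measurable fun p : (Fin n → α) × α => (Fin.snoc (α := fun _ => α) p.1 p.2 : Fin (n + 1) → α) := by
  refine measurable_pi_lambda _ fun j => ?_
  refine Fin.lastCases ?_ (fun j => ?_) j
  · simpa using measurable_snd
  · simpa [Function.comp_def] using (measurable_pi_apply j).comp measurable_fst

lemma measurable_fin_init {α : Type*} [MeasurableSpace α] (n : ℕ) :
    Measurable fun p : Fin (n + 1) → α => (Fin.init p : Fin n → α) :=
  measurable_pi_lambda _ fun _ => measurable_pi_apply _

@[fun_prop]
lemma Measurable.fin_snoc {α β : Type*} [MeasurableSpace α] [MeasurableSpace β] {n : ℕ}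
    {f : β → Fin n → α} {g : β → α} (hf : Measurable f) (hg : Measurable g) :
    Measurable fun b => (Fin.snoc (α := fun _ => α) (f b) (g b) : Fin (n + 1) → α) :=
  (measurable_fin_snoc n).comp (hf.prodMk hg)

@[fun_prop]
lemma Measurable.fin_init {α β : Type*} [MeasurableSpace α] [MeasurableSpace β] {n : ℕ}
    {f : β → Fin (n + 1) → α} (hf : Measurable f) :
    Measurable fun b => (Fin.init (f b) : Fin n → α) :=
  (measurable_fin_init n).comp hf

/-- Splitting off the last coordinate drives both the recursion in the length of the memory and the
recursion in time. -/
lemma lintegral_pi_snoc {α : Type*} [MeasurableSpace α] (μ : Measure α) [SigmaFinite μ] (n : ℕ)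
    {f : (Fin (n + 1) → α) → ℝ≥0∞} (hf : Measurable f) :
    ∫⁻ v, f v ∂(Measure.pi fun _ => μ)
      = ∫⁻ v, ∫⁻ x, f (Fin.snoc (α := fun _ => α) v x) ∂μ ∂(Measure.pi fun _ => μ) := by
  have h := (measurePreserving_piFinSuccAbove (fun _ : Fin (n + 1) => μ) (Fin.last n)).symm
  have hg : Measurable fun p : (Fin n → α) × α => f (Fin.snoc (α := fun _ => α) p.1 p.2) := by
    fun_prop
  rw [← h.lintegral_comp hf, lintegral_prod _ (by fun_prop), lintegral_lintegral_swap]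
  · refine lintegral_congr fun v => lintegral_congr fun x => ?_
    congr 1
    exact Fin.insertNth_last' x v
  · exact (hf.comp h.measurable).aemeasurable

variable {nx ny : ℕ}

lemma measurableEmbedding_sigmaMk {ι : Type*} {α : ι → Type*} [∀ i, MeasurableSpace (α i)] (i : ι) :
    MeasurableEmbedding (Sigma.mk i : α i → Σ i, α i) where
  injective := sigma_mk_injective
  measurable := by
    intro s hs
    exact MeasurableSpace.measurableSet_iInf.1 hs i
  measurableSet_image' := by
    intro s hs
    refine MeasurableSpace.measurableSet_iInf.2 fun j => ?_
    change MeasurableSet (Sigma.mk j ⁻¹' (Sigma.mk i '' s))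
    rcases eq_or_ne j i with rfl | hij
    · rwa [preimage_image_eq _ sigma_mk_injective]
    · convert MeasurableSet.empty
      ext x
      simp only [mem_preimage, mem_image, mem_empty_iff_false, iff_false]
      rintro ⟨y, -, hy⟩
      exact hij (congrArg Sigma.fst hy).symm

/-- A function on a product with a countable disjoint union is measurable if its restrictions to
the pieces are. -/
lemma measurable_of_sigma_prod {ι : Type*} [Countable ι] {α : ι → Type*}
    [∀ i, MeasurableSpace (α i)] {Y Z : Type*} [MeasurableSpace Y] [MeasurableSpace Z]
    {f : (Σ i, α i) × Y → Z} (hf : ∀ i, Measurable fun p : α i × Y => f (⟨i, p.1⟩, p.2)) :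
    Measurable f := by
  intro s hs
  have h : f ⁻¹' s = ⋃ i, Prod.map (Sigma.mk i) id '' ((fun p : α i × Y => f (⟨i, p.1⟩, p.2)) ⁻¹' s) := by
    ext ⟨⟨i, x⟩, y⟩
    simp only [mem_preimage, mem_iUnion, mem_image, Prod.map_apply, id_eq, Prod.exists]
    constructor
    · intro h; exact ⟨i, x, y, h, rfl⟩
    · rintro ⟨j, x', y', h, he⟩
      rw [Prod.mk.injEq] at he
      obtain ⟨h1, rfl⟩ := he
      rw [← h1]; exact h
  rw [h]
  exact MeasurableSet.iUnion fun i =>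
    ((measurableEmbedding_sigmaMk i).prodMap MeasurableEmbedding.id).measurableSet_image' (hf i hs)

lemma measurable_of_sigma {ι : Type*} [Countable ι] {α : ι → Type*}
    [∀ i, MeasurableSpace (α i)] {Z : Type*} [MeasurableSpace Z]
    {f : (Σ i, α i) → Z} (hf : ∀ i, Measurable fun p : α i => f ⟨i, p⟩) : Measurable f := by
  have : Measurable fun p : (Σ i, α i) × Unit => f p.1 :=
    measurable_of_sigma_prod fun i => (hf i).comp measurable_fst
  exact this.comp (measurable_id.prodMk (measurable_const (a := ())))

@[fun_prop]
lemma Measurable.memory_discard {β : Type*} [MeasurableSpace β] {f : β → Memory nx} {g : β → Vec nx}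
    (hf : Measurable f) (hg : Measurable g) : Measurable fun b => (f b).discard (g b) := by
  have : Measurable fun p : Memory nx × Vec nx => p.1.discard p.2 := by
    refine measurable_of_sigma_prod fun r => ?_
    exact (measurableEmbedding_sigmaMk (α := fun r => Fin r → Vec nx) (r + 1)).measurable.comp
      (measurable_fin_snoc r)
  exact this.comp (hf.prodMk hg)

lemma countablyGenerated_of_eq_comap {X Y : Type*} [mX : MeasurableSpace X] [mY : MeasurableSpace Y]
    [MeasurableSpace.CountablyGenerated Y] (f : X → Y) (h : mX = MeasurableSpace.comap f mY) :
    MeasurableSpace.CountablyGenerated X := by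
  subst h
  exact MeasurableSpace.CountablyGenerated.comap f

/-- Coding and selection require countably generated spaces. A memory is recorded as its length
together with its entries padded by zeros, and every measurable set is a pullback under this map. -/
instance : MeasurableSpace.CountablyGenerated (Memory nx) := by
  let f : Memory nx → ℕ × (ℕ → Vec nx) :=
    fun m => (m.1, fun j => if h : j < m.1 then m.2 ⟨j, h⟩ else 0)
  have hf : Measurable f := by
    refine measurable_of_sigma fun r => measurable_const.prodMk (measurable_pi_lambda _ fun j => ?_)
    by_cases h : j < r
    · simpa [h] using measurable_pi_apply (⟨j, h⟩ : Fin r)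
    · simp [h]
  refine countablyGenerated_of_eq_comap f (le_antisymm ?_ hf.comap_le)
  · intro s hs
    have hr : ∀ r, MeasurableSet ((fun v : Fin r → Vec nx => (⟨r, v⟩ : Memory nx)) ⁻¹' s) := fun r =>
      (measurableEmbedding_sigmaMk (α := fun r => Fin r → Vec nx) r).measurable hs
    refine ⟨⋃ r : ℕ, {r} ×ˢ ((fun (v : ℕ → Vec nx) (j : Fin r) => v j) ⁻¹' ((fun v : Fin r → Vec nx => (⟨r, v⟩ : Memory nx)) ⁻¹' s)), ?_, ?_⟩
    · refine MeasurableSet.iUnion fun r => (measurableSet_singleton r).prod ?_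
      exact (measurable_pi_lambda _ fun j => measurable_pi_apply _) (hr r)
    · ext ⟨r, v⟩
      simp [f]

instance : MeasurableSpace.CountablyGenerated (Output nx) := by
  let f : Output nx → Bool × Vec nx := Sum.elim (fun x => (true, x)) (fun _ => (false, 0))
  have hf : Measurable f := by
    refine Measurable.sumElim ?_ ?_ <;> fun_prop
  refine countablyGenerated_of_eq_comap f (le_antisymm ?_ hf.comap_le)
  · intro s hs
    refine ⟨({true} ×ˢ (Sum.inl ⁻¹' s)) ∪ ({false} ×ˢ {x | Sum.inr () ∈ s}), ?_, ?_⟩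
    · exact ((measurableSet_singleton _).prod (measurable_inl hs)).union
        ((measurableSet_singleton _).prod (MeasurableSet.const _))
    · ext z
      rcases z with x | ⟨⟩ <;> simp [f]

instance {ι α : Type*} [Countable ι] [MeasurableSpace α] [MeasurableSpace.CountablyGenerated α] :
    MeasurableSpace.CountablyGenerated (ι → α) := by
  have h : ∀ i : ι, ∃ b : Set (Set (ι → α)), b.Countable ∧
      MeasurableSpace.comap (fun f : ι → α => f i) inferInstance = MeasurableSpace.generateFrom b :=
    fun i => (MeasurableSpace.CountablyGenerated.comap fun f : ι → α => f i).isCountablyGenerated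
  choose b hb hbg using h
  refine ⟨⋃ i, b i, countable_iUnion hb, ?_⟩
  rw [← MeasurableSpace.iSup_generateFrom]
  exact iSup_congr hbg

namespace PrivateSystem

variable (S : PrivateSystem nx ny)

instance : SigmaFinite S.refX := by unfold refX; infer_instance
instance : SigmaFinite S.refY := by unfold refY; infer_instance
instance (k : ℕ) : SigmaFinite (S.refInputs k) := by unfold refInputs; infer_instance

lemma lintegral_refMemory (f : Memory nx → ℝ≥0∞) :
    ∫⁻ m, f m ∂S.refMemory = ∑' r : ℕ, ∫⁻ v, f ⟨r, v⟩ ∂(Measure.pi fun _ : Fin r => S.refX) := by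
  rw [refMemory, lintegral_sum_measure]
  exact tsum_congr fun r => (measurableEmbedding_sigmaMk (α := fun r => Fin r → Vec nx) r).lintegral_map _

instance : SigmaFinite S.refMemory := by
  -- The `n`-th set is of finite measure because it takes only finitely many lengths, up to `n`, and
  -- the `n`-th spanning set of each.
  let A : ℕ → Set (Memory nx) := fun n => ⋃ r ∈ Finset.range (n + 1),
    Sigma.mk r '' spanningSets (Measure.pi fun _ : Fin r => S.refX) n
  have hA : ∀ n, MeasurableSet (A n) := fun n => Finset.measurableSet_biUnion _ fun r _ =>
    (measurableEmbedding_sigmaMk (α := fun r => Fin r → Vec nx) r).measurableSet_image'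
      (measurableSet_spanningSets _ n)
  refine ⟨⟨⟨A, fun _ => trivial, fun n => ?_, ?_⟩⟩⟩
  · refine (measure_biUnion_finset_le _ _).trans_lt (ENNReal.sum_lt_top.2 fun r _ => ?_)
    have hm : MeasurableSet (Sigma.mk r '' spanningSets (Measure.pi fun _ : Fin r => S.refX) n) :=
      (measurableEmbedding_sigmaMk (α := fun r => Fin r → Vec nx) r).measurableSet_image'
        (measurableSet_spanningSets _ n)
    rw [← lintegral_indicator_one hm, lintegral_refMemory, tsum_eq_single r]
    · have : ∀ v : Fin r → Vec nx, (Sigma.mk r '' spanningSets (Measure.pi fun _ : Fin r => S.refX) n).indicator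
          (1 : Memory nx → ℝ≥0∞) ⟨r, v⟩
          = (spanningSets (Measure.pi fun _ : Fin r => S.refX) n).indicator 1 v := by
        intro v
        refine indicator_eq_indicator ?_ rfl
        exact sigma_mk_injective.mem_set_image
      simp only [this]
      rw [lintegral_indicator_one (measurableSet_spanningSets _ n)]
      exact measure_spanningSets_lt_top _ n
    · intro r' hr'
      refine (lintegral_congr fun v => ?_).trans lintegral_zero
      refine indicator_of_notMem ?_ _
      rintro ⟨w, -, hw⟩
      exact hr' (congrArg Sigma.fst hw).symm
  · refine eq_univ_of_forall fun m => ?_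
    obtain ⟨r, v⟩ := m
    have hv : v ∈ ⋃ n, spanningSets (Measure.pi fun _ : Fin r => S.refX) n := by
      rw [iUnion_spanningSets]; trivial
    obtain ⟨n, hn⟩ := mem_iUnion.1 hv
    refine mem_iUnion.2 ⟨max n r, mem_iUnion₂.2 ⟨r, ?_, v, ?_, rfl⟩⟩
    · simp
    · exact monotone_spanningSets _ (le_max_left n r) hn

instance (k : ℕ) : SigmaFinite (S.refState k) := by unfold refState; infer_instance

/-- A memory is either empty or obtained in exactly one way by appending a sample, and appending
turns the product of the two reference measures into the reference measure. -/
lemma lintegral_refMemory_discard {f : Memory nx → ℝ≥0∞} (hf : Measurable f) :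
    ∫⁻ m, f m ∂S.refMemory
      = f (Memory.empty nx) + ∫⁻ m, ∫⁻ x, f (m.discard x) ∂S.refX ∂S.refMemory := by
  rw [lintegral_refMemory, lintegral_refMemory, tsum_eq_zero_add' ENNReal.summable]
  congr 1
  · rw [lintegral_unique]
    simp only [Measure.pi_empty_univ, mul_one]
    rfl
  · refine tsum_congr fun r => ?_
    exact lintegral_pi_snoc _ _
      (hf.comp (measurableEmbedding_sigmaMk (α := fun r => Fin r → Vec nx) (r + 1)).measurable)

lemma lintegral_refInputs_succ (k : ℕ) {f : (Fin (k + 2) → Vec ny) → ℝ≥0∞} (hf : Measurable f) :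
    ∫⁻ y, f y ∂S.refInputs (k + 1)
      = ∫⁻ y, ∫⁻ y', f (Fin.snoc (α := fun _ => Vec ny) y y') ∂S.refY ∂S.refInputs k :=
  lintegral_pi_snoc _ _ hf

lemma lintegral_refState {k : ℕ} {f : BState nx ny k → ℝ≥0∞} (hf : Measurable f) :
    ∫⁻ w, f w ∂S.refState k
      = ∫⁻ x, ∫⁻ q, f (x, q.1, q.2) ∂S.refMemory.prod (S.refInputs k) ∂S.refX :=
  lintegral_prod _ hf.aemeasurable

/-- After a retained sample the memory persists, so the only new coordinates are the next state and
the next private input, here collected in `p`. -/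
lemma lintegral_refState_retain (k : ℕ) {f : BState nx ny (k + 1) → ℝ≥0∞} (hf : Measurable f) :
    ∫⁻ w, f w ∂S.refState (k + 1)
      = ∫⁻ q, ∫⁻ p, f (p.1, q.1, Fin.snoc (α := fun _ => Vec ny) q.2 p.2) ∂S.refX.prod S.refY
          ∂S.refMemory.prod (S.refInputs k) := by
  rw [lintegral_prod _ (by fun_prop), lintegral_refState S hf]
  rw [lintegral_lintegral_swap (by fun_prop), lintegral_prod _ (by fun_prop)]
  refine lintegral_congr fun m => ?_
  rw [lintegral_refInputs_succ _ _ (by fun_prop)]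
  refine lintegral_congr fun y => ?_
  rw [lintegral_prod_symm' _ (by fun_prop)]

/-- After a discard the old state becomes the last memory entry. The old triple together with the
next state and input are thus coordinates on the part with nonempty memory; the hypothesis on `f`
disposes of the empty memory. -/
lemma lintegral_refState_discard (k : ℕ) {f : BState nx ny (k + 1) → ℝ≥0∞} (hf : Measurable f)
    (hf0 : ∀ x y, f (x, Memory.empty nx, y) = 0) :
    ∫⁻ w, f w ∂S.refState (k + 1)
      = ∫⁻ w, ∫⁻ p, f (p.1, w.2.1.discard w.1, Fin.snoc (α := fun _ => Vec ny) w.2.2 p.2)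
          ∂S.refX.prod S.refY ∂S.refState k := by
  rw [lintegral_refState_retain S k hf, lintegral_prod _ (by fun_prop),
    lintegral_refMemory_discard S (by fun_prop), lintegral_refState S (by fun_prop)]
  simp only [hf0, lintegral_zero, zero_add]
  rw [lintegral_lintegral_swap (by fun_prop)]
  refine lintegral_congr fun x => ?_
  rw [lintegral_prod _ (by fun_prop)]

lemma ae_refState_retain (k : ℕ) {P : BState nx ny (k + 1) → Prop}
    (h : ∀ᵐ q ∂S.refMemory.prod (S.refInputs k), ∀ x' y',
      P (x', q.1, Fin.snoc (α := fun _ => Vec ny) q.2 y')) : ∀ᵐ w ∂S.refState (k + 1), P w := by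
  -- No measurability of `P` is assumed, so the exceptional set is enlarged to a measurable null
  -- set.
  let N := toMeasurable (S.refMemory.prod (S.refInputs k))
    {q | ¬ ∀ x' y', P (x', q.1, Fin.snoc (α := fun _ => Vec ny) q.2 y')}
  have hN : MeasurableSet N := measurableSet_toMeasurable _ _
  have hN0 : S.refMemory.prod (S.refInputs k) N = 0 := by rw [measure_toMeasurable]; exact h
  have hφ : Measurable fun w : BState nx ny (k + 1) => (w.2.1, (Fin.init w.2.2 : Fin (k + 1) → Vec ny)) := by
    fun_prop
  have h1 : S.refState (k + 1) ((fun w : BState nx ny (k + 1) => (w.2.1, (Fin.init w.2.2 : Fin (k + 1) → Vec ny))) ⁻¹' N) = 0 := by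
    rw [← lintegral_indicator_one (hφ hN),
      lintegral_refState_retain S k (measurable_one.indicator (hφ hN))]
    rw [lintegral_eq_zero_of_ae_eq_zero]
    filter_upwards [measure_eq_zero_iff_ae_notMem.1 hN0] with q hq
    refine (lintegral_congr fun p => ?_).trans lintegral_zero
    refine indicator_of_notMem ?_ _
    simpa using hq
  filter_upwards [measure_eq_zero_iff_ae_notMem.1 h1] with w hw
  by_contra hP
  refine hw (subset_toMeasurable _ _ fun h' => hP ?_)
  have := h' w.1 (w.2.2 (Fin.last _))
  simpa using this

lemma ae_refState_discard (k : ℕ) {P : BState nx ny (k + 1) → Prop}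
    (h0 : ∀ x' y, P (x', Memory.empty nx, y))
    (h : ∀ᵐ w ∂S.refState k, ∀ x' y',
      P (x', w.2.1.discard w.1, Fin.snoc (α := fun _ => Vec ny) w.2.2 y')) :
    ∀ᵐ w ∂S.refState (k + 1), P w := by
  let N := toMeasurable (S.refState k)
    {w | ¬ ∀ x' y', P (x', w.2.1.discard w.1, Fin.snoc (α := fun _ => Vec ny) w.2.2 y')}
  have hN : MeasurableSet N := measurableSet_toMeasurable _ _
  have hN0 : S.refState k N = 0 := by rw [measure_toMeasurable]; exact h
  -- The indicator of `N` after undoing a discard: the last memory entry becomes the state again. It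
  -- is 0 at the empty memory, as the change of variables requires.
  let e : BState nx ny (k + 1) → ℝ≥0∞ := fun w => match w with
    | (_, ⟨0, _⟩, _) => 0
    | (_, ⟨r + 1, v⟩, y) => N.indicator 1 (v (Fin.last r), ⟨r, Fin.init v⟩, Fin.init y)
  have he : Measurable e := by
    have : Measurable fun p : Memory nx × Vec nx × (Fin (k + 2) → Vec ny) => e (p.2.1, p.1, p.2.2) := by
      refine measurable_of_sigma_prod fun r => ?_
      rcases r with _ | r
      · exact measurable_const
      · refine (measurable_one.indicator hN).comp ?_
        refine ((measurable_pi_apply _).comp measurable_fst).prodMk (Measurable.prodMk ?_ ?_)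
        · exact (measurableEmbedding_sigmaMk (α := fun r => Fin r → Vec nx) r).measurable.comp
            (by fun_prop)
        · fun_prop
    exact this.comp (by fun_prop : Measurable fun w : BState nx ny (k + 1) => (w.2.1, w.1, w.2.2))
  have he1 : ∀ (x' : Vec nx) (w : BState nx ny k) (y' : Vec ny),
      e (x', w.2.1.discard w.1, Fin.snoc (α := fun _ => Vec ny) w.2.2 y') = N.indicator 1 w := by
    intro x' w y'
    simp [e, Memory.discard]
  have h1 : ∫⁻ w, e w ∂S.refState (k + 1) = 0 := by
    rw [lintegral_refState_discard S k he (fun _ _ => rfl)]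
    rw [lintegral_eq_zero_of_ae_eq_zero]
    filter_upwards [measure_eq_zero_iff_ae_notMem.1 hN0] with w hw
    simp only [he1]
    simp [hw]
  rw [lintegral_eq_zero_iff he] at h1
  filter_upwards [h1] with w hw
  obtain ⟨x', ⟨r, v⟩, y⟩ := w
  rcases r with _ | r
  · have : (⟨0, v⟩ : Memory nx) = Memory.empty nx := by
      unfold Memory.empty; congr 1; exact Subsingleton.elim _ _
    rw [this]; exact h0 _ _
  · by_contra hP
    have hmem : ((v (Fin.last r), ⟨r, Fin.init v⟩, Fin.init y) : BState nx ny k) ∉ N := by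
      intro hmem
      have : e (x', ⟨r + 1, v⟩, y) = 1 := by simp [e, hmem]
      rw [this] at hw
      simp at hw
    refine hmem (subset_toMeasurable _ _ fun h' => hP ?_)
    have := h' x' (y (Fin.last _))
    simpa [Memory.discard] using this

end PrivateSystem

end ReferenceMeasures

/-! ### Joint measurability of the functionals of a collection and a belief -/

section BeliefFunctionals

open Set

variable {nx ny k : ℕ} {Θ : Type*} [MeasurableSpace Θ]

lemma measurableEmbedding_sumInl {α β : Type*} [MeasurableSpace α] [MeasurableSpace β] :
    MeasurableEmbedding (Sum.inl : α → α ⊕ β) where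
  injective := Sum.inl_injective
  measurable := measurable_inl
  measurableSet_image' := fun _ hs => MeasurableSet.inl_image hs

instance : MeasurableSingletonClass (Output nx) where
  measurableSet_singleton z := by
    rcases z with x | u
    · rw [← image_singleton]; exact (measurableSet_singleton x).inl_image
    · rw [← image_singleton]; exact (measurableSet_singleton u).inr_image

/-- A measurable family of policy collections. -/
def MeasurableColl (a : Θ → Collection nx) : Prop :=
  ∀ n, Measurable fun p : Θ × Vec nx × Memory nx => (a p.1).prob n p.2.1 p.2.2

/-- A measurable family of beliefs. -/
def MeasurableBelief (b : Θ → Belief nx ny k) : Prop :=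
  Measurable fun p : Θ × BState nx ny k => b p.1 p.2

lemma measurable_of_sum_prod {α β Y Z : Type*} [MeasurableSpace α] [MeasurableSpace β]
    [MeasurableSpace Y] [MeasurableSpace Z] {f : (α ⊕ β) × Y → Z}
    (h1 : Measurable fun p : α × Y => f (Sum.inl p.1, p.2))
    (h2 : Measurable fun p : β × Y => f (Sum.inr p.1, p.2)) : Measurable f := by
  have h : Measurable (Sum.elim (fun p : α × Y => f (Sum.inl p.1, p.2))
      (fun p : β × Y => f (Sum.inr p.1, p.2)) ∘ MeasurableEquiv.sumProdDistrib α β Y) :=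
    (Measurable.sumElim h1 h2).comp (MeasurableEquiv.sumProdDistrib α β Y).measurable
  convert h using 1
  funext ⟨z, y⟩
  rcases z with x | u <;> rfl

lemma MeasurableColl.prob {a : Θ → Collection nx} (ha : MeasurableColl a) (n : Bool)
    {β : Type*} [MeasurableSpace β] {f : β → Θ} {g : β → Vec nx} {h : β → Memory nx}
    (hf : Measurable f) (hg : Measurable g) (hh : Measurable h) :
    Measurable fun p => ((a (f p)).prob n (g p) (h p) : ℝ≥0∞) :=
  ((ha n).comp (hf.prodMk (hg.prodMk hh))).coe_nnreal_ennreal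

lemma MeasurableBelief.val {b : Θ → Belief nx ny k} (hb : MeasurableBelief b)
    {β : Type*} [MeasurableSpace β] {f : β → Θ} {g : β → BState nx ny k}
    (hf : Measurable f) (hg : Measurable g) : Measurable fun p => b (f p) (g p) :=
  Measurable.comp hb (hf.prodMk hg)

lemma MeasurableColl.comp {a : Θ → Collection nx} (ha : MeasurableColl a)
    {β : Type*} [MeasurableSpace β] {f : β → Θ} (hf : Measurable f) :
    MeasurableColl fun p => a (f p) := fun n =>
  (ha n).comp ((hf.comp measurable_fst).prodMk measurable_snd)

lemma MeasurableBelief.comp {b : Θ → Belief nx ny k} (hb : MeasurableBelief b)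
    {β : Type*} [MeasurableSpace β] {f : β → Θ} (hf : Measurable f) :
    MeasurableBelief fun p => b (f p) :=
  Measurable.comp hb ((hf.comp measurable_fst).prodMk measurable_snd)

lemma measurableColl_const (a : Collection nx) : MeasurableColl fun _ : Θ => a := fun n =>
  (a.measurable_prob n).comp measurable_snd

lemma measurableBelief_const {b : Belief nx ny k} (hb : Measurable b) :
    MeasurableBelief fun _ : Θ => b := hb.comp measurable_snd

lemma Collection.prob_add (a : Collection nx) (x : Vec nx) (m : Memory nx) :
    (a.prob false x m : ℝ≥0∞) + a.prob true x m = 1 := by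
  rw [← ENNReal.coe_add, a.sum_prob, ENNReal.coe_one]

namespace PrivateSystem

variable (S : PrivateSystem nx ny)

/-- The reference measure on the outputs of the sampler. -/
def refOutput : Measure (Output nx) := S.refX.map Sum.inl + Measure.dirac (Sum.inr ())

instance : SigmaFinite S.refOutput := by
  have : SigmaFinite (S.refX.map (Sum.inl : Vec nx → Output nx)) :=
    measurableEmbedding_sumInl.sigmaFinite_map
  unfold refOutput
  infer_instance

lemma lintegral_refOutput {f : Output nx → ℝ≥0∞} :
    ∫⁻ z, f z ∂S.refOutput = ∫⁻ x, f (Sum.inl x) ∂S.refX + f (Sum.inr ()) := by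
  rw [refOutput, lintegral_add_measure, measurableEmbedding_sumInl.lintegral_map, lintegral_dirac]

lemma ae_refOutput_iff {P : Output nx → Prop} :
    (∀ᵐ z ∂S.refOutput, P z) ↔ (∀ᵐ x ∂S.refX, P (Sum.inl x)) ∧ P (Sum.inr ()) := by
  rw [refOutput, ae_add_measure_iff, measurableEmbedding_sumInl.ae_map_iff]
  simp [ae_dirac_eq]

/-- The joint density of the output `z` and of the private inputs `y`. -/
def jointDensity (a : Collection nx) (b : Belief nx ny k) :
    Output nx → (Fin (k + 1) → Vec ny) → ℝ≥0∞
  | Sum.inr _, y => ∫⁻ q, a.prob false q.1 q.2 * b (q.1, q.2, y) ∂S.refX.prod S.refMemory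
  | Sum.inl x, y => ∫⁻ m, a.prob true x m * b (x, m, y) ∂S.refMemory

/-- The density of the output. -/
def outputDensity (a : Collection nx) (b : Belief nx ny k) : Output nx → ℝ≥0∞
  | Sum.inr _ => S.discardProb a b
  | Sum.inl x => S.retainDensity a b x

/-- Bayes' rule in a form common to both kinds of output, so that later arguments need not
distinguish them. -/
lemma posteriorInputs_eq (a : Collection nx) (b : Belief nx ny k) (z : Output nx)
    (y : Fin (k + 1) → Vec ny) :
    S.posteriorInputs a b z y = S.jointDensity a b z y / S.outputDensity a b z := by
  rcases z with x | u <;> rfl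

section Measurability

variable {a : Θ → Collection nx} {b : Θ → Belief nx ny k}

lemma measurable_jointDensity (ha : MeasurableColl a) (hb : MeasurableBelief b) :
    Measurable fun p : Output nx × Θ × (Fin (k + 1) → Vec ny) =>
      S.jointDensity (a p.2.1) (b p.2.1) p.1 p.2.2 := by
  refine measurable_of_sum_prod ?_ ?_
  · refine Measurable.lintegral_prod_right' (f := fun q : (Vec nx × Θ × (Fin (k + 1) → Vec ny)) × Memory nx =>
      (a q.1.2.1).prob true q.1.1 q.2 * b q.1.2.1 (q.1.1, q.2, q.1.2.2)) ?_
    exact (ha.prob _ (by fun_prop) (by fun_prop) (by fun_prop)).mul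
      (hb.val (by fun_prop) (by fun_prop))
  · refine Measurable.lintegral_prod_right' (f := fun q : (Unit × Θ × (Fin (k + 1) → Vec ny)) × Vec nx × Memory nx =>
      (a q.1.2.1).prob false q.2.1 q.2.2 * b q.1.2.1 (q.2.1, q.2.2, q.1.2.2)) ?_
    exact (ha.prob _ (by fun_prop) (by fun_prop) (by fun_prop)).mul
      (hb.val (by fun_prop) (by fun_prop))

lemma measurable_outputDensity (ha : MeasurableColl a) (hb : MeasurableBelief b) :
    Measurable fun p : Output nx × Θ => S.outputDensity (a p.2) (b p.2) p.1 := by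
  refine measurable_of_sum_prod ?_ ?_
  · refine Measurable.lintegral_prod_right' (f := fun q : (Vec nx × Θ) × Memory nx × (Fin (k + 1) → Vec ny) =>
      (a q.1.2).prob true q.1.1 q.2.1 * b q.1.2 (q.1.1, q.2.1, q.2.2)) ?_
    exact (ha.prob _ (by fun_prop) (by fun_prop) (by fun_prop)).mul
      (hb.val (by fun_prop) (by fun_prop))
  · refine Measurable.lintegral_prod_right' (f := fun q : (Unit × Θ) × BState nx ny k =>
      (a q.1.2).prob false q.2.1 q.2.2.1 * b q.1.2 q.2) ?_
    exact (ha.prob _ (by fun_prop) (by fun_prop) (by fun_prop)).mul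
      (hb.val (by fun_prop) (by fun_prop))

lemma measurable_posteriorInputs (ha : MeasurableColl a) (hb : MeasurableBelief b) :
    Measurable fun p : Output nx × Θ × (Fin (k + 1) → Vec ny) =>
      S.posteriorInputs (a p.2.1) (b p.2.1) p.1 p.2.2 := by
  simp only [posteriorInputs_eq]
  exact (S.measurable_jointDensity ha hb).div
    ((S.measurable_outputDensity ha hb).comp (by fun_prop : Measurable
      fun p : Output nx × Θ × (Fin (k + 1) → Vec ny) => (p.1, p.2.1)))

lemma measurable_priorInputs (hb : MeasurableBelief b) :
    Measurable fun p : Θ × (Fin (k + 1) → Vec ny) => S.priorInputs (b p.1) p.2 := by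
  refine Measurable.lintegral_prod_right' (f := fun q : (Θ × (Fin (k + 1) → Vec ny)) × Vec nx × Memory nx =>
    b q.1.1 (q.2.1, q.2.2, q.1.2)) ?_
  exact hb.val (by fun_prop) (by fun_prop)

lemma measurable_distortionLoss {lD : Vec nx → Vec nx → ℝ≥0}
    (hlD : Measurable fun q : Vec nx × Vec nx => lD q.1 q.2)
    (ha : MeasurableColl a) (hb : MeasurableBelief b) :
    Measurable fun p : Θ × Vec nx => S.distortionLoss lD (a p.1) (b p.1) p.2 := by
  refine Measurable.lintegral_prod_right' (f := fun q : (Θ × Vec nx) × BState nx ny k =>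
    (a q.1.1).prob false q.2.1 q.2.2.1 * b q.1.1 q.2 * lD q.2.1 q.1.2) ?_
  refine ((ha.prob _ (by fun_prop) (by fun_prop) (by fun_prop)).mul
    (hb.val (by fun_prop) (by fun_prop))).mul ?_
  exact (hlD.comp (by fun_prop : Measurable
    fun q : (Θ × Vec nx) × BState nx ny k => (q.2.1, q.1.2))).coe_nnreal_ennreal

lemma measurable_stepExp (ha : MeasurableColl a) (hb : MeasurableBelief b)
    {f : Θ → Output nx → BState nx ny k → ℝ≥0∞}
    (hf : Measurable fun p : Θ × Output nx × BState nx ny k => f p.1 p.2.1 p.2.2) :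
    Measurable fun θ => S.stepExp (a θ) (b θ) (f θ) := by
  refine Measurable.lintegral_prod_right' (f := fun q : Θ × BState nx ny k =>
    (a q.1).prob false q.2.1 q.2.2.1 * b q.1 q.2 * f q.1 (Sum.inr ()) q.2
      + (a q.1).prob true q.2.1 q.2.2.1 * b q.1 q.2 * f q.1 (Sum.inl q.2.1) q.2) ?_
  refine Measurable.add ?_ ?_
  · refine ((ha.prob _ (by fun_prop) (by fun_prop) (by fun_prop)).mul
      (hb.val (by fun_prop) (by fun_prop))).mul ?_
    exact hf.comp (by fun_prop : Measurable
      fun q : Θ × BState nx ny k => (q.1, (Sum.inr () : Output nx), q.2))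
  · refine ((ha.prob _ (by fun_prop) (by fun_prop) (by fun_prop)).mul
      (hb.val (by fun_prop) (by fun_prop))).mul ?_
    exact hf.comp (measurable_fst.prodMk
      ((measurable_inl.comp (measurable_fst.comp measurable_snd)).prodMk measurable_snd))

/-- The logarithm of the ratio of posterior and prior. -/
def logRatio (a : Collection nx) (b : Belief nx ny k) (z : Output nx)
    (y : Fin (k + 1) → Vec ny) : ℝ :=
  Real.log (S.posteriorInputs a b z y / S.priorInputs b y).toReal

lemma measurable_logRatio (ha : MeasurableColl a) (hb : MeasurableBelief b) :
    Measurable fun p : Output nx × Θ × (Fin (k + 1) → Vec ny) =>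
      S.logRatio (a p.2.1) (b p.2.1) p.1 p.2.2 := by
  refine Real.measurable_log.comp (((S.measurable_posteriorInputs ha hb).div ?_).ennreal_toReal)
  exact (S.measurable_priorInputs hb).comp measurable_snd

lemma measurable_infoLoss (ha : MeasurableColl a) (hb : MeasurableBelief b) :
    Measurable fun θ => S.infoLoss (a θ) (b θ) := by
  have h : Measurable fun p : Θ × Output nx × BState nx ny k =>
      S.logRatio (a p.1) (b p.1) p.2.1 p.2.2.2.2 :=
    (S.measurable_logRatio ha hb).comp (by fun_prop : Measurable
      fun p : Θ × Output nx × BState nx ny k => (p.2.1, p.1, p.2.2.2.2))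
  refine Measurable.sub ?_ ?_
  · exact S.measurable_stepExp ha hb (f := fun θ z w => ENNReal.ofReal
      (S.logRatio (a θ) (b θ) z w.2.2)) h.ennreal_ofReal
  · exact S.measurable_stepExp ha hb (f := fun θ z w => ENNReal.ofReal
      (-S.logRatio (a θ) (b θ) z w.2.2)) h.neg.ennreal_ofReal

lemma measurable_discardProb (ha : MeasurableColl a) (hb : MeasurableBelief b) :
    Measurable fun θ => S.discardProb (a θ) (b θ) :=
  (S.measurable_outputDensity ha hb).comp (by fun_prop : Measurable
    fun θ : Θ => ((Sum.inr () : Output nx), θ))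

lemma measurable_retainDensity (ha : MeasurableColl a) (hb : MeasurableBelief b) :
    Measurable fun p : Vec nx × Θ => S.retainDensity (a p.2) (b p.2) p.1 :=
  (S.measurable_outputDensity ha hb).comp (measurable_inl.prodMap measurable_id)

lemma measurable_px_comp {β : Type*} [MeasurableSpace β] {f g : β → Vec nx} {h : β → Vec ny}
    (hf : Measurable f) (hg : Measurable g) (hh : Measurable h) :
    Measurable fun p => (S.px (f p) (g p) (h p) : ℝ≥0∞) :=
  (S.measurable_px.comp (hf.prodMk (hg.prodMk hh))).coe_nnreal_ennreal

lemma measurable_py_comp {β : Type*} [MeasurableSpace β] {f g : β → Vec ny}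
    (hf : Measurable f) (hg : Measurable g) :
    Measurable fun p => (S.py (f p) (g p) : ℝ≥0∞) :=
  (S.measurable_py.comp (hf.prodMk hg)).coe_nnreal_ennreal

/-- The update is defined by cases on the output and on the length of the memory; these are
countably many measurable pieces, on each of which the formula is a product and quotient of
measurable functions. -/
lemma measurableBelief_update (ha : MeasurableColl a) (hb : MeasurableBelief b) :
    MeasurableBelief fun p : Θ × Output nx => S.update (b p.1) (a p.1) p.2 := by
  have : Measurable fun p : Output nx × Memory nx × Θ × Vec nx × (Fin (k + 2) → Vec ny) =>
      S.update (b p.2.2.1) (a p.2.2.1) p.1 (p.2.2.2.1, p.2.1, p.2.2.2.2) := by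
    refine measurable_of_sum_prod ?_ ?_
    · have h1 : Measurable fun p : Vec nx × Memory nx × Θ × Vec nx × (Fin (k + 2) → Vec ny) =>
          (S.px p.2.2.2.1 p.1 (p.2.2.2.2 (Fin.last k).castSucc) : ℝ≥0∞)
            * S.py (p.2.2.2.2 (Fin.last (k + 1))) (p.2.2.2.2 (Fin.last k).castSucc) :=
        (S.measurable_px_comp (by fun_prop) (by fun_prop) (by fun_prop)).mul
          (S.measurable_py_comp (by fun_prop) (by fun_prop))
      refine Measurable.div (Measurable.mul (Measurable.mul h1 ?_) ?_) ?_
      · exact hb.val (by fun_prop) (by fun_prop)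
      · exact ha.prob _ (by fun_prop) (by fun_prop) (by fun_prop)
      · exact (S.measurable_retainDensity ha hb).comp (by fun_prop : Measurable
          fun p : Vec nx × Memory nx × Θ × Vec nx × (Fin (k + 2) → Vec ny) => (p.1, p.2.2.1))
    · have h : Measurable fun p : Memory nx × Unit × Θ × Vec nx × (Fin (k + 2) → Vec ny) =>
          S.update (b p.2.2.1) (a p.2.2.1) (Sum.inr p.2.1) (p.2.2.2.1, p.1, p.2.2.2.2) := by
        refine measurable_of_sigma_prod fun r => ?_
        rcases r with _ | r
        · exact measurable_const
        · have hm : Measurable fun p : (Fin (r + 1) → Vec nx) × Unit × Θ × Vec nx ×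
              (Fin (k + 2) → Vec ny) => (⟨r, Fin.init p.1⟩ : Memory nx) :=
            (measurableEmbedding_sigmaMk (α := fun r => Fin r → Vec nx) r).measurable.comp
              (by fun_prop)
          have h1 : Measurable fun p : (Fin (r + 1) → Vec nx) × Unit × Θ × Vec nx ×
              (Fin (k + 2) → Vec ny) =>
              (S.px p.2.2.2.1 (p.1 (Fin.last r)) (p.2.2.2.2 (Fin.last k).castSucc) : ℝ≥0∞)
                * S.py (p.2.2.2.2 (Fin.last (k + 1))) (p.2.2.2.2 (Fin.last k).castSucc) :=
            (S.measurable_px_comp (by fun_prop) (by fun_prop) (by fun_prop)).mul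
              (S.measurable_py_comp (by fun_prop) (by fun_prop))
          refine Measurable.div (Measurable.mul (Measurable.mul h1 ?_) ?_) ?_
          · exact hb.val (by fun_prop) (by fun_prop)
          · exact ha.prob _ (by fun_prop) (by fun_prop) (by fun_prop)
          · exact (S.measurable_discardProb ha hb).comp (by fun_prop)
      exact h.comp (by fun_prop : Measurable fun p : Unit × Memory nx × Θ × Vec nx ×
        (Fin (k + 2) → Vec ny) => (p.2.1, p.1, p.2.2))
  exact this.comp (by fun_prop : Measurable fun p : (Θ × Output nx) × BState nx ny (k + 1) =>
    (p.1.2, p.2.2.1, p.1.1, p.2.1, p.2.2.2))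

end Measurability

end PrivateSystem

end BeliefFunctionals

/-! ### Independence of the choice of versions of densities and collections -/

section Congruence

open Set

variable {nx ny k : ℕ}

namespace PrivateSystem

variable (S : PrivateSystem nx ny)

lemma measurePreserving_regroup :
    MeasurePreserving (fun p : (Vec nx × (Fin (k + 1) → Vec ny)) × Memory nx => ((p.1.1, p.2, p.1.2) : BState nx ny k))
      ((S.refX.prod (S.refInputs k)).prod S.refMemory) (S.refState k) :=
  ((MeasurePreserving.id S.refX).prod (Measure.measurePreserving_swap (μ := S.refInputs k) (ν := S.refMemory))).comp
    (measurePreserving_prodAssoc S.refX (S.refInputs k) S.refMemory)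

lemma measurePreserving_regroup_symm :
    MeasurePreserving (fun w : BState nx ny k => ((w.1, w.2.2), w.2.1))
      (S.refState k) ((S.refX.prod (S.refInputs k)).prod S.refMemory) :=
  (measurePreserving_prodAssoc S.refX (S.refInputs k) S.refMemory).symm.comp
    ((MeasurePreserving.id S.refX).prod (Measure.measurePreserving_swap (μ := S.refMemory) (ν := S.refInputs k)))

lemma measurePreserving_inputs_first :
    MeasurePreserving (fun p : (Fin (k + 1) → Vec ny) × Vec nx × Memory nx =>
        ((p.2.1, p.2.2, p.1) : BState nx ny k))
      ((S.refInputs k).prod (S.refX.prod S.refMemory)) (S.refState k) :=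
  (measurePreserving_prodAssoc S.refX S.refMemory (S.refInputs k)).comp
    Measure.measurePreserving_swap

variable {S}

lemma ae_refState_of_ae_prod {P : Vec nx × (Fin (k + 1) → Vec ny) → Prop}
    (h : ∀ᵐ p ∂S.refX.prod (S.refInputs k), P p) : ∀ᵐ w ∂S.refState k, P (w.1, w.2.2) := by
  have h1 : ∀ᵐ p ∂(S.refX.prod (S.refInputs k)).prod S.refMemory, P p.1 :=
    Measure.quasiMeasurePreserving_fst.ae h
  exact S.measurePreserving_regroup_symm.quasiMeasurePreserving.ae h1

lemma ae_refState_of_ae_inputs {P : (Fin (k + 1) → Vec ny) → Prop}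
    (h : ∀ᵐ y ∂S.refInputs k, P y) : ∀ᵐ w ∂S.refState k, P w.2.2 :=
  ae_refState_of_ae_prod (P := fun p => P p.2) (Measure.quasiMeasurePreserving_snd.ae h)

lemma ae_refState_of_ae_state {P : Vec nx → Prop}
    (h : ∀ᵐ x ∂S.refX, P x) : ∀ᵐ w ∂S.refState k, P w.1 :=
  Measure.quasiMeasurePreserving_fst.ae h

lemma ae_ae_memory {P : BState nx ny k → Prop} (h : ∀ᵐ w ∂S.refState k, P w) :
    ∀ᵐ p ∂S.refX.prod (S.refInputs k), ∀ᵐ m ∂S.refMemory, P (p.1, m, p.2) :=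
  Measure.ae_ae_of_ae_prod (S.measurePreserving_regroup.quasiMeasurePreserving.ae h)

lemma ae_ae_inputs {P : BState nx ny k → Prop} (h : ∀ᵐ w ∂S.refState k, P w) :
    ∀ᵐ y ∂S.refInputs k, ∀ᵐ q ∂S.refX.prod S.refMemory, P (q.1, q.2, y) :=
  Measure.ae_ae_of_ae_prod (S.measurePreserving_inputs_first.quasiMeasurePreserving.ae h)

lemma ae_ae_state {P : BState nx ny k → Prop} (h : ∀ᵐ w ∂S.refState k, P w) :
    ∀ᵐ x ∂S.refX, ∀ᵐ q ∂S.refMemory.prod (S.refInputs k), P (x, q.1, q.2) :=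
  Measure.ae_ae_of_ae_prod h

variable (S)

/-- Two pairs of a collection and a belief agree almost everywhere. -/
def AgreeAE (a a' : Collection nx) (b b' : Belief nx ny k) : Prop :=
  ∀ᵐ w ∂S.refState k, b w = b' w ∧ ∀ n, a.prob n w.1 w.2.1 = a'.prob n w.1 w.2.1

variable {S} {a a' : Collection nx} {b b' : Belief nx ny k}

lemma AgreeAE.of_ae_eq (h : b =ᵐ[S.refState k] b') : S.AgreeAE a a b b' := by
  filter_upwards [h] with w hw using ⟨hw, fun _ => rfl⟩

lemma AgreeAE.of_coll (h : ∀ n, ∀ᵐ p ∂S.refX.prod S.refMemory, a.prob n p.1 p.2 = a'.prob n p.1 p.2) :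
    S.AgreeAE a a' b b := by
  have h1 : ∀ n, ∀ᵐ w ∂S.refState k, a.prob n w.1 w.2.1 = a'.prob n w.1 w.2.1 := fun n => by
    have h2 : ∀ᵐ p ∂(S.refX.prod S.refMemory).prod (S.refInputs k),
        a.prob n p.1.1 p.1.2 = a'.prob n p.1.1 p.1.2 := Measure.quasiMeasurePreserving_fst.ae (h n)
    exact (measurePreserving_prodAssoc S.refX S.refMemory (S.refInputs k)).symm.quasiMeasurePreserving.ae h2
  filter_upwards [ae_all_iff.2 h1] with w hw using ⟨rfl, hw⟩

lemma AgreeAE.discardProb (h : S.AgreeAE a a' b b') : S.discardProb a b = S.discardProb a' b' := by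
  refine lintegral_congr_ae ?_
  filter_upwards [h] with w hw
  rw [hw.1, hw.2]

/-- A null set of triples has null sections only above almost every state, hence the exceptional
retained samples here and in the results that follow. -/
lemma AgreeAE.retainDensity (h : S.AgreeAE a a' b b') :
    ∀ᵐ x ∂S.refX, S.retainDensity a b x = S.retainDensity a' b' x := by
  filter_upwards [ae_ae_state h] with x hx
  refine lintegral_congr_ae ?_
  filter_upwards [hx] with q hq
  rw [hq.1, hq.2]

lemma AgreeAE.update_inr (h : S.AgreeAE a a' b b') :
    S.update b a (Sum.inr ()) =ᵐ[S.refState (k + 1)] S.update b' a' (Sum.inr ()) := by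
  refine S.ae_refState_discard k (fun _ _ => rfl) ?_
  filter_upwards [h] with w hw x' y'
  simp only [update, Memory.discard, Fin.snoc_last, Fin.init_snoc, h.discardProb]
  rw [hw.1, hw.2]

lemma AgreeAE.update_inl (h : S.AgreeAE a a' b b') : ∀ᵐ x ∂S.refX,
    S.update b a (Sum.inl x) =ᵐ[S.refState (k + 1)] S.update b' a' (Sum.inl x) := by
  filter_upwards [ae_ae_state h, h.retainDensity] with x hx hR
  refine S.ae_refState_retain k ?_
  filter_upwards [hx] with q hq x' y'
  simp only [update, Fin.init_snoc, hR]
  rw [hq.1, hq.2]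

lemma AgreeAE.distortionLoss (h : S.AgreeAE a a' b b') (lD : Vec nx → Vec nx → ℝ≥0) (xt : Vec nx) :
    S.distortionLoss lD a b xt = S.distortionLoss lD a' b' xt := by
  refine lintegral_congr_ae ?_
  filter_upwards [h] with w hw
  rw [hw.1, hw.2]

lemma AgreeAE.priorInputs (h : S.AgreeAE a a' b b') :
    ∀ᵐ y ∂S.refInputs k, S.priorInputs b y = S.priorInputs b' y := by
  filter_upwards [ae_ae_inputs h] with y hy
  refine lintegral_congr_ae ?_
  filter_upwards [hy] with q hq using hq.1

lemma AgreeAE.posteriorInputs_inr (h : S.AgreeAE a a' b b') :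
    ∀ᵐ y ∂S.refInputs k,
      S.posteriorInputs a b (Sum.inr ()) y = S.posteriorInputs a' b' (Sum.inr ()) y := by
  filter_upwards [ae_ae_inputs h] with y hy
  simp only [posteriorInputs, h.discardProb]
  congr 1
  refine lintegral_congr_ae ?_
  filter_upwards [hy] with q hq
  rw [hq.1, hq.2]

lemma AgreeAE.posteriorInputs_inl (h : S.AgreeAE a a' b b') :
    ∀ᵐ p ∂S.refX.prod (S.refInputs k),
      S.posteriorInputs a b (Sum.inl p.1) p.2 = S.posteriorInputs a' b' (Sum.inl p.1) p.2 := by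
  filter_upwards [ae_ae_memory h, Measure.quasiMeasurePreserving_fst.ae h.retainDensity] with p hp hR
  simp only [posteriorInputs, hR]
  congr 1
  refine lintegral_congr_ae ?_
  filter_upwards [hp] with q hq
  rw [hq.1, hq.2]

lemma AgreeAE.stepExp (h : S.AgreeAE a a' b b') {f f' : Output nx → BState nx ny k → ℝ≥0∞}
    (h0 : ∀ᵐ w ∂S.refState k, f (Sum.inr ()) w = f' (Sum.inr ()) w)
    (h1 : ∀ᵐ w ∂S.refState k, f (Sum.inl w.1) w = f' (Sum.inl w.1) w) :
    S.stepExp a b f = S.stepExp a' b' f' := by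
  refine lintegral_congr_ae ?_
  filter_upwards [h, h0, h1] with w hw hw0 hw1
  rw [hw.1, hw.2, hw.2, hw0, hw1]

lemma AgreeAE.infoLoss (h : S.AgreeAE a a' b b') : S.infoLoss a b = S.infoLoss a' b' := by
  have h0 := ae_refState_of_ae_inputs h.posteriorInputs_inr
  have h1 := ae_refState_of_ae_prod h.posteriorInputs_inl
  have hp := ae_refState_of_ae_inputs h.priorInputs
  unfold PrivateSystem.infoLoss
  congr 1 <;>
  · refine h.stepExp ?_ ?_
    · filter_upwards [h0, hp] with w hw hw'
      rw [hw, hw']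
    · filter_upwards [h1, hp] with w hw hw'
      rw [hw, hw']

/-- Updates after a retained sample agree for almost every sample, which is all the one-step
expectation sees, provided `V` itself ignores null sets. -/
lemma AgreeAE.bellmanValue (h : S.AgreeAE a a' b b') (lD : Vec nx → Vec nx → ℝ≥0) (lam : ℝ≥0)
    {V : Belief nx ny (k + 1) → ℝ≥0∞}
    (hV : ∀ b b' : Belief nx ny (k + 1), b =ᵐ[S.refState (k + 1)] b' → V b = V b') :
    S.bellmanValue lD lam V a b = S.bellmanValue lD lam V a' b' := by
  unfold PrivateSystem.bellmanValue
  congr 1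
  · rw [h.infoLoss]
    simp only [h.distortionLoss lD]
  · refine h.stepExp (Filter.Eventually.of_forall fun _ => hV _ _ h.update_inr)
      (ae_refState_of_ae_state (P := fun x => V (S.update b a (Sum.inl x)) = V (S.update b' a' (Sum.inl x))) ?_)
    filter_upwards [h.update_inl] with x hx using hV _ _ hx

variable (S)

/-- The value functions: `valueIter lD lam j k` is the optimal cost of `j` steps from time `k`. -/
def valueIter (lD : Vec nx → Vec nx → ℝ≥0) (lam : ℝ≥0) :
    (j k : ℕ) → Belief nx ny k → ℝ≥0∞
  | 0, _, _ => 0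
  | j + 1, k, b => ⨅ a : Collection nx, S.bellmanValue lD lam (valueIter lD lam j (k + 1)) a b

/-- Conditional densities are determined only up to null sets, while the value functions are
evaluated at actual functions; this makes the choice of version irrelevant. -/
lemma valueIter_congr (lD : Vec nx → Vec nx → ℝ≥0) (lam : ℝ≥0) (j : ℕ) :
    ∀ {k : ℕ} (b b' : Belief nx ny k), b =ᵐ[S.refState k] b' →
      S.valueIter lD lam j k b = S.valueIter lD lam j k b' := by
  induction j with
  | zero => intros; rfl
  | succ j ih =>
    intro k b b' h
    exact iInf_congr fun a => (AgreeAE.of_ae_eq h).bellmanValue lD lam ih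

/-! ### Integration against the updated belief -/

lemma ae_mem_stateSet : ∀ᵐ x ∂S.refX, x ∈ S.stateSet := ae_restrict_mem S.measurableSet_stateSet

lemma ae_mem_inputSet (k : ℕ) : ∀ᵐ y ∂S.refInputs k, y (Fin.last k) ∈ S.inputSet :=
  (Measure.quasiMeasurePreserving_eval (fun _ => S.refY) (Fin.last k)).ae (ae_restrict_mem S.measurableSet_inputSet)

/-- The density of the transition to the next state and private input. -/
def transDensity (x : Vec nx) (y : Vec ny) (p : Vec nx × Vec ny) : ℝ≥0∞ :=
  S.px p.1 x y * S.py p.2 y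

lemma measurable_transDensity {β : Type*} [MeasurableSpace β] {f : β → Vec nx} {g : β → Vec ny}
    {h : β → Vec nx × Vec ny} (hf : Measurable f) (hg : Measurable g) (hh : Measurable h) :
    Measurable fun p => S.transDensity (f p) (g p) (h p) :=
  (S.measurable_px_comp (by fun_prop) hf hg).mul (S.measurable_py_comp (by fun_prop) hg)

lemma lintegral_transDensity {x : Vec nx} {y : Vec ny} (hx : x ∈ S.stateSet) (hy : y ∈ S.inputSet) :
    ∫⁻ p, S.transDensity x y p ∂S.refX.prod S.refY = 1 := by
  unfold transDensity
  rw [lintegral_prod_mul (f := fun x' => (S.px x' x y : ℝ≥0∞)) (g := fun y' => (S.py y' y : ℝ≥0∞))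
    (S.measurable_px_comp (by fun_prop) (by fun_prop) (by fun_prop)).aemeasurable
    (S.measurable_py_comp (by fun_prop) (by fun_prop)).aemeasurable]
  change (∫⁻ x' in S.stateSet, _) * (∫⁻ y' in S.inputSet, _) = 1
  rw [S.lintegral_px x hx y hy, S.lintegral_py y hy, one_mul]


end PrivateSystem
end Congruence

/-! ### Lower semianalyticity of the value functions -/

section ValueFunction

open Set

variable {nx ny k : ℕ}

namespace PrivateSystem

variable (S : PrivateSystem nx ny) (a : Collection nx) {b : Belief nx ny k}

lemma measurable_prob_coe (n : Bool) {β : Type*} [MeasurableSpace β] {g : β → Vec nx}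
    {h : β → Memory nx} (hg : Measurable g) (hh : Measurable h) :
    Measurable fun p => (a.prob n (g p) (h p) : ℝ≥0∞) :=
  ((a.measurable_prob n).comp (hg.prodMk hh)).coe_nnreal_ennreal

lemma measurable_prob_mul (hb : Measurable b) (n : Bool) :
    Measurable fun w : BState nx ny k => a.prob n w.1 w.2.1 * b w :=
  (measurable_prob_coe a n (by fun_prop) (by fun_prop)).mul hb

lemma lintegral_retainDensity_mul (hb : Measurable b) {g : Vec nx → ℝ≥0∞}
    (hg : AEMeasurable g S.refX) :
    ∫⁻ w, a.prob true w.1 w.2.1 * b w * g w.1 ∂S.refState k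
      = ∫⁻ x, S.retainDensity a b x * g x ∂S.refX := by
  have hg' : AEMeasurable (fun w : BState nx ny k => g w.1) (S.refState k) :=
    hg.comp_quasiMeasurePreserving Measure.quasiMeasurePreserving_fst
  have hF : AEMeasurable (fun w : BState nx ny k => a.prob true w.1 w.2.1 * b w * g w.1)
      (S.refState k) := (measurable_prob_mul a hb true).aemeasurable.mul hg'
  refine (lintegral_prod _ hF).trans ?_
  refine lintegral_congr fun x => ?_
  have hm : Measurable fun q : Memory nx × (Fin (k + 1) → Vec ny) =>
      a.prob true x q.1 * b (x, q.1, q.2) :=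
    (measurable_prob_mul a hb true).comp (by fun_prop : Measurable
      fun q : Memory nx × (Fin (k + 1) → Vec ny) => ((x, q.1, q.2) : BState nx ny k))
  exact lintegral_mul_const (g x) hm

/-- Brings the expected next value into the form of a density times a function, integrated against a
fixed measure, to which `LowerSemianalytic.lintegral_right` applies. Almost everywhere measurability
of `g` is all that value functions provide. -/
lemma stepExp_output (hb : Measurable b) {g : Output nx → ℝ≥0∞}
    (hg : AEMeasurable (fun x => g (Sum.inl x)) S.refX) :
    S.stepExp a b (fun z _ => g z) = ∫⁻ z, S.outputDensity a b z * g z ∂S.refOutput := by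
  unfold stepExp
  rw [lintegral_add_left ((measurable_prob_mul a hb false).mul_const _),
    S.lintegral_retainDensity_mul a hb hg, lintegral_mul_const _ (measurable_prob_mul a hb false),
    lintegral_refOutput, add_comm]
  rfl

lemma lintegral_outputDensity (hb : Measurable b) :
    ∫⁻ z, S.outputDensity a b z ∂S.refOutput = ∫⁻ w, b w ∂S.refState k := by
  have h := S.stepExp_output a hb (g := fun _ => 1) (by fun_prop)
  simp only [mul_one] at h
  rw [← h]
  refine lintegral_congr fun w => ?_
  rw [mul_one, mul_one, ← add_mul, Collection.prob_add, one_mul]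

lemma measurable_update (hb : Measurable b) (z : Output nx) : Measurable (S.update b a z) :=
  (S.measurableBelief_update (measurableColl_const (Θ := Unit) a) (measurableBelief_const hb)).val
    measurable_const measurable_id (f := fun _ => ((), z))

/-- Multiplication by the normalizing constant undoes the division in the update; this fails in
[0,∞] when the constant is 0 or ∞. The change of variables for a discard does the rest. -/
lemma discardProb_mul_lintegral_update (hb : Measurable b) (h0 : S.discardProb a b ≠ 0)
    (h1 : S.discardProb a b ≠ ∞) {f : BState nx ny (k + 1) → ℝ≥0∞} (hf : Measurable f) :
    S.discardProb a b * ∫⁻ w, S.update b a (Sum.inr ()) w * f w ∂S.refState (k + 1)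
      = ∫⁻ w, a.prob false w.1 w.2.1 * b w * ∫⁻ p, S.transDensity w.1 (w.2.2 (Fin.last k)) p
          * f (p.1, w.2.1.discard w.1, Fin.snoc (α := fun _ => Vec ny) w.2.2 p.2)
          ∂S.refX.prod S.refY ∂S.refState k := by
  have hu := S.measurable_update a hb (Sum.inr ())
  have huf : Measurable fun w => S.update b a (Sum.inr ()) w * f w := hu.mul hf
  rw [S.lintegral_refState_discard k huf (fun _ _ => by
    change 0 * f _ = 0
    rw [zero_mul]), ← lintegral_const_mul' _ _ h1]
  refine lintegral_congr fun w => ?_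
  rw [← lintegral_const_mul' _ _ h1, ← lintegral_const_mul _ ?_]
  · refine lintegral_congr fun p => ?_
    simp only [update, Memory.discard, Fin.snoc_last, Fin.init_snoc, Fin.snoc_castSucc, transDensity]
    rw [← mul_assoc, ENNReal.mul_div_cancel h0 h1]
    change _ * _ * b w * (a.prob false w.1 w.2.1 : ℝ≥0∞) * _ = _
    ring
  · refine (S.measurable_transDensity (by fun_prop) (by fun_prop) (by fun_prop)).mul ?_
    exact hf.comp (by fun_prop : Measurable fun p : Vec nx × Vec ny => ((p.1, w.2.1.discard w.1,
      Fin.snoc (α := fun _ => Vec ny) w.2.2 p.2) : BState nx ny (k + 1)))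

lemma retainDensity_mul_lintegral_update (hb : Measurable b) {x : Vec nx}
    (h0 : S.retainDensity a b x ≠ 0)
    (h1 : S.retainDensity a b x ≠ ∞) {f : BState nx ny (k + 1) → ℝ≥0∞} (hf : Measurable f) :
    S.retainDensity a b x * ∫⁻ w, S.update b a (Sum.inl x) w * f w ∂S.refState (k + 1)
      = ∫⁻ q, a.prob true x q.1 * b (x, q.1, q.2) * ∫⁻ p, S.transDensity x (q.2 (Fin.last k)) p
          * f (p.1, q.1, Fin.snoc (α := fun _ => Vec ny) q.2 p.2)
          ∂S.refX.prod S.refY ∂S.refMemory.prod (S.refInputs k) := by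
  have hu := S.measurable_update a hb (Sum.inl x)
  have huf : Measurable fun w => S.update b a (Sum.inl x) w * f w := hu.mul hf
  rw [S.lintegral_refState_retain k huf, ← lintegral_const_mul' _ _ h1]
  refine lintegral_congr fun q => ?_
  rw [← lintegral_const_mul' _ _ h1, ← lintegral_const_mul _ ?_]
  · refine lintegral_congr fun p => ?_
    simp only [update, Fin.snoc_last, Fin.init_snoc, Fin.snoc_castSucc, transDensity]
    rw [← mul_assoc, ENNReal.mul_div_cancel h0 h1]
    ring
  · refine (S.measurable_transDensity (by fun_prop) (by fun_prop) (by fun_prop)).mul ?_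
    exact hf.comp (by fun_prop : Measurable fun p : Vec nx × Vec ny => ((p.1, q.1,
      Fin.snoc (α := fun _ => Vec ny) q.2 p.2) : BState nx ny (k + 1)))

/-- The test function 1 leaves the total mass of the transition densities, which is 1 since almost
every state and input lie in the sets where these are normalized. -/
lemma lintegral_update_inr (hb : Measurable b) (h0 : S.discardProb a b ≠ 0)
    (h1 : S.discardProb a b ≠ ∞) :
    ∫⁻ w, S.update b a (Sum.inr ()) w ∂S.refState (k + 1) = 1 := by
  have h := S.discardProb_mul_lintegral_update a hb h0 h1 (f := fun _ => 1) measurable_const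
  simp only [mul_one] at h
  refine (ENNReal.mul_right_inj h0 h1).1 ?_
  rw [h, mul_one]
  refine lintegral_congr_ae ?_
  filter_upwards [ae_refState_of_ae_state S.ae_mem_stateSet,
    ae_refState_of_ae_inputs (S.ae_mem_inputSet k)] with w hw1 hw2
  rw [S.lintegral_transDensity hw1 hw2, mul_one]

lemma lintegral_update_inl (hb : Measurable b) {x : Vec nx} (hx : x ∈ S.stateSet)
    (h0 : S.retainDensity a b x ≠ 0) (h1 : S.retainDensity a b x ≠ ∞) :
    ∫⁻ w, S.update b a (Sum.inl x) w ∂S.refState (k + 1) = 1 := by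
  have h := S.retainDensity_mul_lintegral_update a hb h0 h1 (f := fun _ => 1) measurable_const
  simp only [mul_one] at h
  refine (ENNReal.mul_right_inj h0 h1).1 ?_
  rw [h, mul_one]
  refine lintegral_congr_ae ?_
  have hy : ∀ᵐ q ∂S.refMemory.prod (S.refInputs k), q.2 (Fin.last k) ∈ S.inputSet :=
    Measure.quasiMeasurePreserving_snd.ae (S.ae_mem_inputSet k)
  filter_upwards [hy] with q hq
  rw [S.lintegral_transDensity hx hq, mul_one]

/-- Almost every belief update is a probability density. -/
lemma ae_lintegral_update (hb : Measurable b) (hb1 : ∫⁻ w, b w ∂S.refState k ≠ ∞) :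
    ∀ᵐ z ∂S.refOutput, S.outputDensity a b z ≠ ∞ ∧ (S.outputDensity a b z ≠ 0 →
      ∫⁻ w, S.update b a z w ∂S.refState (k + 1) = 1) := by
  have hm : Measurable (S.outputDensity a b) :=
    (S.measurable_outputDensity (measurableColl_const (Θ := Unit) a) (measurableBelief_const hb)).comp
      (by fun_prop : Measurable fun z : Output nx => (z, ()))
  have hfin : ∀ᵐ z ∂S.refOutput, S.outputDensity a b z < ∞ :=
    ae_lt_top hm (by rwa [lintegral_outputDensity S a hb])
  -- The transition densities are only normalized on the state space, so a retained sample must lie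
  -- in it.
  have hset : ∀ᵐ z ∂S.refOutput, ∀ x, z = Sum.inl x → x ∈ S.stateSet := by
    rw [ae_refOutput_iff]
    refine ⟨?_, by simp⟩
    filter_upwards [S.ae_mem_stateSet] with x hx x' hxx'
    rw [← Sum.inl.inj hxx']; exact hx
  filter_upwards [hfin, hset] with z hz hzx
  refine ⟨hz.ne, fun h0 => ?_⟩
  rcases z with x | u
  · exact S.lintegral_update_inl a hb (hzx x rfl) h0 hz.ne
  · exact S.lintegral_update_inr a hb h0 hz.ne

/-- Up to null sets, all policy collections belong to one measurable family with parameter in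
the Baire space. -/
lemma exists_collection_code : ∃ c : (ℕ → ℕ) → Collection nx, MeasurableColl c ∧
    ∀ a : Collection nx, ∃ i, ∀ n, ∀ᵐ p ∂S.refX.prod S.refMemory,
      a.prob n p.1 p.2 = (c i).prob n p.1 p.2 := by
  obtain ⟨e, he, hcode⟩ := exists_measurable_code (T := ℝ) (S.refX.prod S.refMemory)
  -- Clipping to [0,1] turns every code into a collection and does not alter the probabilities of a
  -- genuine one.
  let f : (ℕ → ℕ) → Vec nx → Memory nx → ℝ≥0 := fun i x m => min 1 (e (i, (x, m))).toNNReal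
  have hf : Measurable fun p : (ℕ → ℕ) × Vec nx × Memory nx => f p.1 p.2.1 p.2.2 :=
    measurable_const.min he.real_toNNReal
  let c : (ℕ → ℕ) → Collection nx := fun i =>
    { prob := fun n x m => if n then 1 - f i x m else f i x m
      measurable_prob := by
        have h : Measurable fun q : Vec nx × Memory nx => f i q.1 q.2 :=
          hf.comp (by fun_prop : Measurable fun q : Vec nx × Memory nx => (i, q))
        rintro (_ | _)
        · simpa using h
        · simpa [Pi.sub_def] using (measurable_const (a := (1 : ℝ≥0))).sub h
      sum_prob := fun x m => by simp [f] }
  refine ⟨c, ?_, ?_⟩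
  · rintro (_ | _)
    · simpa [c] using hf
    · simpa [c, Pi.sub_def] using (measurable_const (a := (1 : ℝ≥0))).sub hf
  · intro a
    obtain ⟨i, hi⟩ := hcode (fun p => (a.prob false p.1 p.2 : ℝ)) (by
      exact (a.measurable_prob false).coe_nnreal_real)
    refine ⟨i, fun n => ?_⟩
    filter_upwards [hi] with p hp
    have h1 : a.prob false p.1 p.2 = f i p.1 p.2 := by
      have : a.prob false p.1 p.2 ≤ 1 := by rw [← a.sum_prob p.1 p.2]; exact le_self_add
      simp only [f]
      rw [hp, Real.toNNReal_coe, min_eq_right this]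
    rcases n with _ | _
    · simpa [c] using h1
    · simp only [c, if_true, ← h1]
      rw [← a.sum_prob p.1 p.2, add_tsub_cancel_left]

lemma measurable_retainDensity_const (hb : Measurable b) : Measurable (S.retainDensity a b) :=
  (S.measurable_retainDensity (measurableColl_const (Θ := Unit) a) (measurableBelief_const hb)).comp
    (by fun_prop : Measurable fun x : Vec nx => (x, ()))

lemma ae_prob_mul_eq_zero (hb : Measurable b) :
    ∀ᵐ w ∂S.refState k, S.retainDensity a b w.1 = 0 → a.prob true w.1 w.2.1 * b w = 0 := by
  have hR := S.measurable_retainDensity_const a hb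
  -- Testing against the set of samples of zero density shows that the joint weight vanishes almost
  -- everywhere above that set.
  let g : Vec nx → ℝ≥0∞ := fun x => if S.retainDensity a b x = 0 then 1 else 0
  have hg : Measurable g :=
    Measurable.ite (hR (measurableSet_singleton 0)) measurable_const measurable_const
  have h := S.lintegral_retainDensity_mul a hb hg.aemeasurable
  have h0 : ∀ x, S.retainDensity a b x * g x = 0 := by
    intro x
    by_cases hx : S.retainDensity a b x = 0 <;> simp [g, hx]
  simp only [h0, lintegral_zero] at h
  have hF : Measurable fun w : BState nx ny k => a.prob true w.1 w.2.1 * b w * g w.1 :=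
    (measurable_prob_mul a hb true).mul (hg.comp measurable_fst)
  rw [lintegral_eq_zero_iff hF] at h
  filter_upwards [h] with w hw h0
  have : (a.prob true w.1 w.2.1 : ℝ≥0∞) * b w * g w.1 = 0 := hw
  simpa [g, h0] using this

lemma ae_prob_false_mul_eq_zero (hb : Measurable b) (h : S.discardProb a b = 0) :
    ∀ᵐ w ∂S.refState k, a.prob false w.1 w.2.1 * b w = 0 := by
  have h' : ∫⁻ w, a.prob false w.1 w.2.1 * b w ∂S.refState k = 0 := h
  rw [lintegral_eq_zero_iff (measurable_prob_mul a hb false)] at h'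
  exact h'

/-- The expectation of a function of the output depends only on its values where the density of
the output does not vanish. -/
lemma stepExp_output_of_ae (hb : Measurable b) {g g' : Output nx → ℝ≥0∞}
    (hg' : AEMeasurable (fun x => g' (Sum.inl x)) S.refX)
    (hgg' : ∀ᵐ z ∂S.refOutput, S.outputDensity a b z ≠ 0 → g z = g' z) :
    S.stepExp a b (fun z _ => g z) = ∫⁻ z, S.outputDensity a b z * g' z ∂S.refOutput := by
  rw [← S.stepExp_output a hb hg']
  have hae := S.ae_refOutput_iff.1 hgg'
  refine lintegral_congr_ae ?_
  have h0 : ∀ᵐ w ∂S.refState k, a.prob false w.1 w.2.1 * b w * g (Sum.inr ())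
      = a.prob false w.1 w.2.1 * b w * g' (Sum.inr ()) := by
    by_cases h0 : S.discardProb a b = 0
    · filter_upwards [S.ae_prob_false_mul_eq_zero a hb h0] with w hw
      rw [hw, zero_mul, zero_mul]
    · rw [hae.2 h0]
      exact Filter.Eventually.of_forall fun _ => rfl
  filter_upwards [h0, S.ae_prob_mul_eq_zero a hb, ae_refState_of_ae_state hae.1] with w hw0 hw1 hw2
  rw [hw0]
  congr 1
  by_cases h0 : S.retainDensity a b w.1 = 0
  · rw [hw1 h0, zero_mul, zero_mul]
  · rw [hw2 h0]

/-- The functional `V` of the belief state is lower semianalytic along measurable families. -/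
def LowerSemianalyticBelief (V : Belief nx ny k → ℝ≥0∞) : Prop :=
  ∀ {Θ : Type} [MeasurableSpace Θ] {b : Θ → Belief nx ny k},
      MeasurableBelief b → (∀ θ, ∫⁻ w, b θ w ∂S.refState k ≤ 1) → LowerSemianalytic fun θ => V (b θ)

/-- The integrand is a finite density times a value function of the updated belief. For fixed
parameter the update has mass 1 only for almost every output of positive density, whereas `ih` asks
for mass at most 1 everywhere. The belief is therefore replaced by 0 off the good set and the
density by 0 where it is infinite, neither of which affects the integral. -/
lemma lowerSemianalytic_stepExp_update {V : Belief nx ny (k + 1) → ℝ≥0∞}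
    (ih : S.LowerSemianalyticBelief V) {Θ : Type} [MeasurableSpace Θ] {a : Θ → Collection nx}
    {b : Θ → Belief nx ny k} (ha : MeasurableColl a) (hb : MeasurableBelief b)
    (hb1 : ∀ θ, ∫⁻ w, b θ w ∂S.refState k ≤ 1) :
    LowerSemianalytic fun θ => S.stepExp (a θ) (b θ) (fun z _ => V (S.update (b θ) (a θ) z)) := by
  classical
  have hu := S.measurableBelief_update ha hb
  have hmass : Measurable fun q : Θ × Output nx =>
      ∫⁻ w, S.update (b q.1) (a q.1) q.2 w ∂S.refState (k + 1) :=
    Measurable.lintegral_prod_right' (f := fun p : (Θ × Output nx) × BState nx ny (k + 1) =>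
      S.update (b p.1.1) (a p.1.1) p.1.2 p.2) hu
  let good : Set (Θ × Output nx) :=
    {q | ∫⁻ w, S.update (b q.1) (a q.1) q.2 w ∂S.refState (k + 1) ≤ 1}
  have hgood : MeasurableSet good := measurableSet_le hmass measurable_const
  let B : Θ × Output nx → Belief nx ny (k + 1) := fun q w =>
    if q ∈ good then S.update (b q.1) (a q.1) q.2 w else 0
  have hB : MeasurableBelief B :=
    Measurable.ite (measurable_fst hgood) hu measurable_const
  have hB1 : ∀ q, ∫⁻ w, B q w ∂S.refState (k + 1) ≤ 1 := by
    intro q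
    by_cases hq : q ∈ good
    · simp only [B, if_pos hq]; exact hq
    · simp [B, hq]
  have hW := ih hB hB1
  let D : Θ × Output nx → ℝ≥0∞ := fun q =>
    if S.outputDensity (a q.1) (b q.1) q.2 = ∞ then 0
    else S.outputDensity (a q.1) (b q.1) q.2
  have hod : Measurable fun q : Θ × Output nx =>
      S.outputDensity (a q.1) (b q.1) q.2 :=
    (S.measurable_outputDensity ha hb).comp measurable_swap
  have hD : Measurable D :=
    Measurable.ite (hod (measurableSet_singleton ∞)) measurable_const hod
  have hD1 : ∀ q, D q ≠ ∞ := by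
    intro q
    by_cases hq : S.outputDensity (a q.1) (b q.1) q.2 = ∞ <;> simp [D, hq]
  have hfinal := (LowerSemianalytic.mul_of_ne_top hD hD1 hW).lintegral_right S.refOutput
  convert hfinal using 1
  funext p
  have hbp : Measurable (b p) := hb.val measurable_const measurable_id (f := fun _ => p)
  have hae := S.ae_lintegral_update (a p) hbp ((hb1 p).trans_lt ENNReal.one_lt_top).ne
  have hWp : LowerSemianalytic fun x => V (B (p, Sum.inl x)) :=
    hW.comp (measurable_const.prodMk measurable_inl)
  rw [S.stepExp_output_of_ae (a p) hbp (g' := fun z => V (B (p, z)))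
    (hWp.aemeasurable _)]
  · refine lintegral_congr_ae ?_
    filter_upwards [hae] with z hz
    simp [D, hz.1]
  · filter_upwards [hae] with z hz h0
    have hz' : (p, z) ∈ good := (hz.2 h0).le
    congr 1
    funext w
    simp [B, hz']

lemma lowerSemianalytic_bellmanValue {lD : Vec nx → Vec nx → ℝ≥0}
    (hlD : Measurable fun q : Vec nx × Vec nx => lD q.1 q.2) (lam : ℝ≥0)
    {V : Belief nx ny (k + 1) → ℝ≥0∞}
    (ih : S.LowerSemianalyticBelief V) {Θ : Type} [MeasurableSpace Θ] {a : Θ → Collection nx}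
    {b : Θ → Belief nx ny k} (ha : MeasurableColl a) (hb : MeasurableBelief b)
    (hb1 : ∀ θ, ∫⁻ w, b θ w ∂S.refState k ≤ 1) :
    LowerSemianalytic fun θ => S.bellmanValue lD lam V (a θ) (b θ) := by
  refine LowerSemianalytic.add (LowerSemianalytic.add ?_ ?_)
    (S.lowerSemianalytic_stepExp_update ih ha hb hb1)
  · exact LowerSemianalytic.of_iInf_measurable (T := Vec nx)
      (S.measurable_distortionLoss hlD ha hb) fun _ => rfl
  · exact LowerSemianalytic.of_measurable ((S.measurable_infoLoss ha hb).const_mul _)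

/-- Collections equal almost everywhere have equal Bellman values, so the infimum may run over
codes, which form a standard Borel space. -/
lemma valueIter_succ_eq_iInf_code {c : (ℕ → ℕ) → Collection nx}
    (hcode : ∀ a : Collection nx, ∃ i, ∀ n, ∀ᵐ p ∂S.refX.prod S.refMemory,
      a.prob n p.1 p.2 = (c i).prob n p.1 p.2) (lD : Vec nx → Vec nx → ℝ≥0) (lam : ℝ≥0) (j : ℕ)
    (b : Belief nx ny k) : S.valueIter lD lam (j + 1) k b
        = ⨅ i, S.bellmanValue lD lam (S.valueIter lD lam j (k + 1)) (c i) b := by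
  refine le_antisymm (le_iInf fun i => iInf_le _ _) (le_iInf fun a => ?_)
  obtain ⟨i, hi⟩ := hcode a
  rw [(AgreeAE.of_coll hi).bellmanValue lD lam fun b b' => S.valueIter_congr lD lam j b b']
  exact iInf_le _ _

/-- **Lower semianalyticity of the value functions** along measurable families of beliefs. -/
theorem lowerSemianalytic_valueIter {lD : Vec nx → Vec nx → ℝ≥0}
    (hlD : Measurable fun q : Vec nx × Vec nx => lD q.1 q.2) (lam : ℝ≥0) (j : ℕ) :
    ∀ {k : ℕ}, S.LowerSemianalyticBelief (S.valueIter lD lam j k : Belief nx ny k → ℝ≥0∞) := by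
  induction j with
  | zero => intros _ _ _ _ _ _; exact LowerSemianalytic.of_measurable measurable_const
  | succ j ih =>
    intro k Θ _ b hb hb1
    obtain ⟨c, hc, hcode⟩ := S.exists_collection_code
    simp only [S.valueIter_succ_eq_iInf_code hcode]
    exact LowerSemianalytic.iInf_param (T := ℕ → ℕ) (g := fun p =>
      S.bellmanValue lD lam (S.valueIter lD lam j (k + 1)) (c p.2) (b p.1))
      (S.lowerSemianalytic_bellmanValue hlD lam ih (hc.comp measurable_snd) (hb.comp measurable_fst)
        fun p => hb1 p.1)

end PrivateSystem
end ValueFunction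

/-! ### Gibbs' inequality for the one-step information loss -/

section Information

open Set

/-- Pointwise Gibbs inequalities. -/
lemma mul_ofReal_neg_log_add_le {J w p : ℝ≥0∞} (hJ : J ≠ ∞) (hw : w ≠ ∞) (hp : p ≠ ∞)
    (hwJ : w = 0 → J = 0) (hpJ : p = 0 → J = 0) :
    J * ENNReal.ofReal (-Real.log (J / w / p).toReal) + J
      ≤ J * ENNReal.ofReal (Real.log (J / w / p).toReal) + w * p ∧
    J * ENNReal.ofReal (-Real.log (J / w / p).toReal) ≤ w * p := by
  rcases eq_or_ne J 0 with rfl | hJ0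
  · simp
  have hw0 : w ≠ 0 := fun h => hJ0 (hwJ h)
  have hp0 : p ≠ 0 := fun h => hJ0 (hpJ h)
  lift J to ℝ≥0 using hJ
  lift w to ℝ≥0 using hw
  lift p to ℝ≥0 using hp
  have hJ' : (0 : ℝ) < J := by simpa [pos_iff_ne_zero] using hJ0
  have hw' : (0 : ℝ) < w := by simpa [pos_iff_ne_zero] using hw0
  have hp' : (0 : ℝ) < p := by simpa [pos_iff_ne_zero] using hp0
  set r : ℝ := ((J : ℝ≥0∞) / w / p).toReal with hr
  have hr1 : r = (J : ℝ) / w / p := by simp [hr, ENNReal.toReal_div]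
  have hr0 : 0 < r := by rw [hr1]; positivity
  have hJr : (J : ℝ) = r * (w * p) := by rw [hr1]; field_simp
  -- The inequality log t ≤ t − 1 at t = 1/r, multiplied by J = r w p, yields J(−log r) + J ≤ w p,
  -- from which both claims follow according to the sign of log r.
  have hlog : Real.log r⁻¹ ≤ r⁻¹ - 1 := Real.log_le_sub_one_of_pos (inv_pos.2 hr0)
  rw [Real.log_inv] at hlog
  have hmul : (J : ℝ) * r⁻¹ = w * p := by rw [hJr]; field_simp
  have hkey : (J : ℝ) * (-Real.log r) + J ≤ w * p := by nlinarith [mul_le_mul_of_nonneg_left hlog hJ'.le]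
  have e1 : (J : ℝ≥0∞) = ENNReal.ofReal J := by simp
  have e2 : (w : ℝ≥0∞) * p = ENNReal.ofReal (w * p) := by
    rw [ENNReal.ofReal_mul hw'.le]; simp
  rw [e2, e1, ← ENNReal.ofReal_mul hJ'.le, ← ENNReal.ofReal_mul hJ'.le]
  constructor
  · rcases le_total 0 (Real.log r) with h | h
    · have h1 : (J : ℝ) * -Real.log r ≤ 0 := by nlinarith
      rw [ENNReal.ofReal_of_nonpos h1, zero_add, ← ENNReal.ofReal_add (by positivity) (by positivity)]
      exact ENNReal.ofReal_le_ofReal (by linarith)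
    · have h1 : (J : ℝ) * Real.log r ≤ 0 := by nlinarith
      rw [ENNReal.ofReal_of_nonpos h1, zero_add, ← ENNReal.ofReal_add (by nlinarith) hJ'.le]
      exact ENNReal.ofReal_le_ofReal hkey
  · exact ENNReal.ofReal_le_ofReal (by linarith)

variable {nx ny k : ℕ}

namespace PrivateSystem

variable (S : PrivateSystem nx ny) (a : Collection nx) {b : Belief nx ny k}

lemma lintegral_refState_regroup {f : BState nx ny k → ℝ≥0∞} (hf : Measurable f) :
    ∫⁻ w, f w ∂S.refState k
      = ∫⁻ p, ∫⁻ m, f (p.1, m, p.2) ∂S.refMemory ∂S.refX.prod (S.refInputs k) :=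
  (S.measurePreserving_regroup.lintegral_comp hf).symm.trans
    (lintegral_prod _ (hf.comp S.measurePreserving_regroup.measurable).aemeasurable)

lemma lintegral_refState_inputs {f : BState nx ny k → ℝ≥0∞} (hf : Measurable f) :
    ∫⁻ w, f w ∂S.refState k
      = ∫⁻ y, ∫⁻ q, f (q.1, q.2, y) ∂S.refX.prod S.refMemory ∂S.refInputs k :=
  (S.measurePreserving_inputs_first.lintegral_comp hf).symm.trans
    (lintegral_prod _ (hf.comp S.measurePreserving_inputs_first.measurable).aemeasurable)

lemma measurable_jointDensity_const (hb : Measurable b) :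
    Measurable fun p : Output nx × (Fin (k + 1) → Vec ny) => S.jointDensity a b p.1 p.2 :=
  (S.measurable_jointDensity (measurableColl_const (Θ := Unit) a) (measurableBelief_const hb)).comp
    (measurable_fst.prodMk (measurable_const.prodMk measurable_snd) : Measurable
      fun p : Output nx × (Fin (k + 1) → Vec ny) => (p.1, (), p.2))

lemma measurable_logRatio_const (hb : Measurable b) :
    Measurable fun p : Output nx × (Fin (k + 1) → Vec ny) => S.logRatio a b p.1 p.2 :=
  (S.measurable_logRatio (measurableColl_const (Θ := Unit) a) (measurableBelief_const hb)).comp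
    (measurable_fst.prodMk (measurable_const.prodMk measurable_snd) : Measurable
      fun p : Output nx × (Fin (k + 1) → Vec ny) => (p.1, (), p.2))

lemma measurable_outputDensity_const (hb : Measurable b) : Measurable (S.outputDensity a b) :=
  (S.measurable_outputDensity (measurableColl_const (Θ := Unit) a) (measurableBelief_const hb)).comp
    (measurable_id.prodMk measurable_const : Measurable fun z : Output nx => (z, ()))

lemma measurable_priorInputs_const (hb : Measurable b) : Measurable (S.priorInputs b) :=
  (S.measurable_priorInputs (measurableBelief_const (Θ := Unit) hb)).comp
    (measurable_const.prodMk measurable_id : Measurable fun y : Fin (k + 1) → Vec ny => ((), y))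

lemma stepExp_output_inputs (hb : Measurable b)
    {f : Output nx → (Fin (k + 1) → Vec ny) → ℝ≥0∞} (hf : Measurable fun p : Output nx × _ => f p.1 p.2) :
    S.stepExp a b (fun z w => f z w.2.2)
      = ∫⁻ z, ∫⁻ y, S.jointDensity a b z y * f z y ∂S.refInputs k ∂S.refOutput := by
  have hf0 : Measurable fun y => f (Sum.inr ()) y := hf.comp (measurable_const.prodMk measurable_id)
  have hf1 : Measurable fun p : Vec nx × _ => f (Sum.inl p.1) p.2 :=
    hf.comp (measurable_inl.prodMap measurable_id)
  have m0 : Measurable fun w : BState nx ny k => a.prob false w.1 w.2.1 * b w * f (Sum.inr ()) w.2.2 :=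
    (measurable_prob_mul a hb false).mul (hf0.comp (measurable_snd.comp measurable_snd))
  have m1 : Measurable fun w : BState nx ny k => a.prob true w.1 w.2.1 * b w * f (Sum.inl w.1) w.2.2 :=
    (measurable_prob_mul a hb true).mul
      (hf1.comp (measurable_fst.prodMk (measurable_snd.comp measurable_snd)))
  have hJ := S.measurable_jointDensity_const a hb
  unfold stepExp
  rw [lintegral_add_left m0, lintegral_refOutput, add_comm]
  congr 1
  · rw [S.lintegral_refState_regroup m1]
    have h1 : ∀ p : Vec nx × (Fin (k + 1) → Vec ny),
        ∫⁻ m, a.prob true p.1 m * b (p.1, m, p.2) * f (Sum.inl p.1) p.2 ∂S.refMemory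
          = S.jointDensity a b (Sum.inl p.1) p.2 * f (Sum.inl p.1) p.2 := by
      intro p
      have hm : Measurable fun m : Memory nx => a.prob true p.1 m * b (p.1, m, p.2) :=
        (measurable_prob_mul a hb true).comp (measurable_const.prodMk (measurable_id.prodMk measurable_const))
      exact lintegral_mul_const _ hm
    simp only [h1]
    refine lintegral_prod _ (Measurable.aemeasurable ?_)
    exact (hJ.comp (measurable_inl.prodMap measurable_id)).mul hf1
  · rw [S.lintegral_refState_inputs m0]
    refine lintegral_congr fun y => ?_
    have hm : Measurable fun q : Vec nx × Memory nx => a.prob false q.1 q.2 * b (q.1, q.2, y) :=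
      (measurable_prob_mul a hb false).comp
        (measurable_fst.prodMk (measurable_snd.prodMk measurable_const))
    exact lintegral_mul_const (f (Sum.inr ()) y) hm

lemma lintegral_jointDensity (hb : Measurable b) (z : Output nx) :
    ∫⁻ y, S.jointDensity a b z y ∂S.refInputs k = S.outputDensity a b z := by
  rcases z with x | u
  · have hm : Measurable fun q : Memory nx × (Fin (k + 1) → Vec ny) =>
        a.prob true x q.1 * b (x, q.1, q.2) :=
      (measurable_prob_mul a hb true).comp (measurable_const.prodMk measurable_id)
    exact (lintegral_prod_symm' _ hm).symm
  · have m0 := measurable_prob_mul a hb false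
    change _ = ∫⁻ w, a.prob false w.1 w.2.1 * b w ∂S.refState k
    rw [S.lintegral_refState_inputs m0]
    rfl

lemma lintegral_jointDensity_output (hb : Measurable b) (y : Fin (k + 1) → Vec ny) :
    ∫⁻ z, S.jointDensity a b z y ∂S.refOutput = S.priorInputs b y := by
  have hm : ∀ n, Measurable fun q : Vec nx × Memory nx => a.prob n q.1 q.2 * b (q.1, q.2, y) :=
    fun n => (measurable_prob_mul a hb n).comp
      (measurable_fst.prodMk (measurable_snd.prodMk measurable_const))
  have h1 : ∫⁻ x, S.jointDensity a b (Sum.inl x) y ∂S.refX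
      = ∫⁻ q, a.prob true q.1 q.2 * b (q.1, q.2, y) ∂S.refX.prod S.refMemory :=
    (lintegral_prod _ (hm true).aemeasurable).symm
  rw [lintegral_refOutput, h1]
  change _ + ∫⁻ q, a.prob false q.1 q.2 * b (q.1, q.2, y) ∂S.refX.prod S.refMemory = _
  rw [← lintegral_add_left (hm true)]
  refine lintegral_congr fun q => ?_
  rw [← add_mul, add_comm (a.prob true q.1 q.2 : ℝ≥0∞), Collection.prob_add, one_mul]

lemma lintegral_priorInputs (hb : Measurable b) :
    ∫⁻ y, S.priorInputs b y ∂S.refInputs k = ∫⁻ w, b w ∂S.refState k := by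
  rw [S.lintegral_refState_inputs hb]
  rfl

/-- The degenerate values of the joint density and of its marginals are negligible. -/
lemma ae_jointDensity (hb : Measurable b) (hb1 : ∫⁻ w, b w ∂S.refState k ≠ ∞) :
    ∀ᵐ z ∂S.refOutput, ∀ᵐ y ∂S.refInputs k,
      S.jointDensity a b z y ≠ ∞ ∧ S.outputDensity a b z ≠ ∞ ∧ S.priorInputs b y ≠ ∞ ∧
      (S.outputDensity a b z = 0 → S.jointDensity a b z y = 0) ∧
      (S.priorInputs b y = 0 → S.jointDensity a b z y = 0) := by
  have hJ := S.measurable_jointDensity_const a hb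
  have hp := S.measurable_priorInputs_const hb
  have hJz : ∀ z, Measurable fun y => S.jointDensity a b z y := fun z =>
    hJ.comp (measurable_const.prodMk measurable_id)
  have hJy : ∀ y, Measurable fun z => S.jointDensity a b z y := fun y =>
    hJ.comp (measurable_id.prodMk measurable_const)
  have h1 : ∀ᵐ z ∂S.refOutput, S.outputDensity a b z < ∞ :=
    ae_lt_top (S.measurable_outputDensity_const a hb) (by rwa [lintegral_outputDensity S a hb])
  have h2 : ∀ᵐ y ∂S.refInputs k, S.priorInputs b y < ∞ :=
    ae_lt_top hp (by rwa [lintegral_priorInputs S hb])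
  -- Where the prior vanishes, so does the joint density for almost every output, because the prior
  -- is its integral over outputs. Fubini exchanges the two quantifiers.
  have h3 : ∀ᵐ z ∂S.refOutput, ∀ᵐ y ∂S.refInputs k, S.priorInputs b y = 0 → S.jointDensity a b z y = 0 := by
    refine (Measure.ae_ae_comm (p := fun z y => S.priorInputs b y = 0 → S.jointDensity a b z y = 0) ?_).2 ?_
    · exact MeasurableSet.imp ((hp.comp measurable_snd) (measurableSet_singleton 0))
        (hJ (measurableSet_singleton 0))
    · refine Filter.Eventually.of_forall fun y => ?_
      by_cases h0 : S.priorInputs b y = 0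
      · rw [← S.lintegral_jointDensity_output a hb y, lintegral_eq_zero_iff (hJy y)] at h0
        filter_upwards [h0] with z hz _ using hz
      · exact Filter.Eventually.of_forall fun z h => absurd h h0
  filter_upwards [h1, h3] with z hz1 hz3
  have h4 : ∀ᵐ y ∂S.refInputs k, S.jointDensity a b z y < ∞ :=
    ae_lt_top (hJz z) (by rw [S.lintegral_jointDensity a hb]; exact hz1.ne)
  have h5 : ∀ᵐ y ∂S.refInputs k, S.outputDensity a b z = 0 → S.jointDensity a b z y = 0 := by
    by_cases h0 : S.outputDensity a b z = 0
    · rw [← S.lintegral_jointDensity a hb, lintegral_eq_zero_iff (hJz z)] at h0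
      filter_upwards [h0] with y hy _ using hy
    · exact Filter.Eventually.of_forall fun z h => absurd h h0
  filter_upwards [h2, hz3, h4, h5] with y hy2 hy3 hy4 hy5
  exact ⟨hy4.ne, hz1.ne, hy2.ne, hy5, hy3⟩

/-- **Gibbs' inequality** for the information loss. -/
lemma stepExp_neg_logRatio_le (hb : Measurable b) (hb1 : ∫⁻ w, b w ∂S.refState k = 1) :
    S.stepExp a b (fun z w => ENNReal.ofReal (-S.logRatio a b z w.2.2))
        ≤ S.stepExp a b (fun z w => ENNReal.ofReal (S.logRatio a b z w.2.2)) ∧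
      S.stepExp a b (fun z w => ENNReal.ofReal (-S.logRatio a b z w.2.2)) ≤ 1 := by
  have hJ := S.measurable_jointDensity_const a hb
  have hp := S.measurable_priorInputs_const hb
  have hw := S.measurable_outputDensity_const a hb
  have hL := S.measurable_logRatio_const a hb
  have hae := S.ae_jointDensity a hb (by rw [hb1]; exact ENNReal.one_ne_top)
  have hpos : Measurable fun p : Output nx × (Fin (k + 1) → Vec ny) => ENNReal.ofReal (S.logRatio a b p.1 p.2) :=
    hL.ennreal_ofReal
  have hneg : Measurable fun p : Output nx × (Fin (k + 1) → Vec ny) => ENNReal.ofReal (-S.logRatio a b p.1 p.2) :=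
    hL.neg.ennreal_ofReal
  rw [S.stepExp_output_inputs a hb (f := fun z y => ENNReal.ofReal (-S.logRatio a b z y)) hneg,
    S.stepExp_output_inputs a hb (f := fun z y => ENNReal.ofReal (S.logRatio a b z y)) hpos]
  -- The joint density and the product of its marginals both have mass 1, so these masses cancel
  -- when the pointwise inequality is integrated.
  have hQ : ∫⁻ z, ∫⁻ y, S.outputDensity a b z * S.priorInputs b y ∂S.refInputs k ∂S.refOutput = 1 := by
    simp only [lintegral_const_mul _ hp]
    rw [lintegral_mul_const _ hw, lintegral_priorInputs S hb, lintegral_outputDensity S a hb, hb1, one_mul]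
  have hJ1 : ∫⁻ z, ∫⁻ y, S.jointDensity a b z y ∂S.refInputs k ∂S.refOutput = 1 := by
    simp only [S.lintegral_jointDensity a hb]
    rw [lintegral_outputDensity S a hb, hb1]
  have key : ∀ᵐ z ∂S.refOutput, ∀ᵐ y ∂S.refInputs k,
      S.jointDensity a b z y * ENNReal.ofReal (-S.logRatio a b z y) + S.jointDensity a b z y
        ≤ S.jointDensity a b z y * ENNReal.ofReal (S.logRatio a b z y)
          + S.outputDensity a b z * S.priorInputs b y ∧
      S.jointDensity a b z y * ENNReal.ofReal (-S.logRatio a b z y)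
        ≤ S.outputDensity a b z * S.priorInputs b y := by
    filter_upwards [hae] with z hz
    filter_upwards [hz] with y hy
    simp only [logRatio, posteriorInputs_eq]
    exact mul_ofReal_neg_log_add_le hy.1 hy.2.1 hy.2.2.1 hy.2.2.2.1 hy.2.2.2.2
  constructor
  · have hzm : ∀ (z : Output nx) {F : Output nx × (Fin (k + 1) → Vec ny) → ℝ≥0∞}, Measurable F →
        Measurable fun y => F (z, y) := fun z F hF => hF.comp (measurable_const.prodMk measurable_id)
    have h : (∫⁻ z, ∫⁻ y, (S.jointDensity a b z y * ENNReal.ofReal (-S.logRatio a b z y)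
          + S.jointDensity a b z y) ∂S.refInputs k ∂S.refOutput)
        ≤ ∫⁻ z, ∫⁻ y, (S.jointDensity a b z y * ENNReal.ofReal (S.logRatio a b z y)
          + S.outputDensity a b z * S.priorInputs b y) ∂S.refInputs k ∂S.refOutput := by
      refine lintegral_mono_ae ?_
      filter_upwards [key] with z hz
      refine lintegral_mono_ae ?_
      filter_upwards [hz] with y hy using hy.1
    have m1 := hJ.mul hneg
    have m2 := hJ.mul hpos
    have e1 : ∀ z, ∫⁻ y, (S.jointDensity a b z y * ENNReal.ofReal (-S.logRatio a b z y)
          + S.jointDensity a b z y) ∂S.refInputs k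
        = (∫⁻ y, S.jointDensity a b z y * ENNReal.ofReal (-S.logRatio a b z y) ∂S.refInputs k)
          + ∫⁻ y, S.jointDensity a b z y ∂S.refInputs k := fun z => lintegral_add_left (hzm z m1) _
    have e2 : ∀ z, ∫⁻ y, (S.jointDensity a b z y * ENNReal.ofReal (S.logRatio a b z y)
          + S.outputDensity a b z * S.priorInputs b y) ∂S.refInputs k
        = (∫⁻ y, S.jointDensity a b z y * ENNReal.ofReal (S.logRatio a b z y) ∂S.refInputs k)
          + ∫⁻ y, S.outputDensity a b z * S.priorInputs b y ∂S.refInputs k :=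
      fun z => lintegral_add_left (hzm z m2) _
    simp only [e1, e2] at h
    have m1' : Measurable fun z => ∫⁻ y, S.jointDensity a b z y * ENNReal.ofReal (-S.logRatio a b z y) ∂S.refInputs k :=
      Measurable.lintegral_prod_right' m1
    have m2' : Measurable fun z => ∫⁻ y, S.jointDensity a b z y * ENNReal.ofReal (S.logRatio a b z y) ∂S.refInputs k :=
      Measurable.lintegral_prod_right' m2
    rw [lintegral_add_left m1', lintegral_add_left m2', hQ, hJ1] at h
    exact (ENNReal.add_le_add_iff_right ENNReal.one_ne_top).1 h
  · rw [← hQ]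
    refine lintegral_mono_ae ?_
    filter_upwards [key] with z hz
    refine lintegral_mono_ae ?_
    filter_upwards [hz] with y hy using hy.2

end PrivateSystem
end Information

/-! ### Extension and restriction of trajectories -/

section Trajectories

open Set

variable {nx ny : ℕ}

namespace Traj

variable {K : ℕ}

/-- Extension of a trajectory by one step. -/
def extend (ω : Traj nx ny K) (p : Vec nx × Vec ny) (n : Bool) : Traj nx ny (K + 1) :=
  (Fin.snoc (α := fun _ => Vec nx) ω.1 p.1, Fin.snoc (α := fun _ => Vec ny) ω.2.1 p.2,
    Fin.snoc (α := fun _ => Bool) ω.2.2 n)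

/-- The part of a trajectory up to time `k`. -/
def upTo (k : ℕ) (ω : Traj nx ny K) : Traj nx ny k :=
  (fun j => ω.x j, fun j => ω.y j, fun j => ω.n j)

/-- Times are read through `Fin.ofNat`, which reduces modulo the number of times; the bounds on the
time exclude a wrap-around, here and below. -/
lemma ofNat_castSucc {j : ℕ} (h : j ≤ K) :
    (Fin.ofNat (K + 2) j) = (Fin.ofNat (K + 1) j).castSucc := by
  ext
  simp [Fin.ofNat, Nat.mod_eq_of_lt (show j < K + 2 by omega), Nat.mod_eq_of_lt (show j < K + 1 by omega)]

lemma ofNat_last : Fin.ofNat (K + 1) K = Fin.last K := by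
  ext; simp [Fin.ofNat]

lemma ofNat_val (j : Fin (K + 1)) : Fin.ofNat (K + 1) (j : ℕ) = j := by
  ext; simp [Fin.ofNat, Nat.mod_eq_of_lt j.2]

section extend

variable (ω : Traj nx ny K) (p : Vec nx × Vec ny) (n : Bool)

lemma extend_x {j : ℕ} (h : j ≤ K) : (ω.extend p n).x j = ω.x j := by
  simp only [x, extend, ofNat_castSucc h, Fin.snoc_castSucc]

lemma extend_y {j : ℕ} (h : j ≤ K) : (ω.extend p n).y j = ω.y j := by
  simp only [y, extend, ofNat_castSucc h, Fin.snoc_castSucc]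

lemma extend_n {j : ℕ} (h : j ≤ K) : (ω.extend p n).n j = ω.n j := by
  simp only [Traj.n, extend, ofNat_castSucc h, Fin.snoc_castSucc]

lemma extend_x_last : (ω.extend p n).x (K + 1) = p.1 := by
  simp only [x, extend, ofNat_last, Fin.snoc_last]

lemma extend_y_last : (ω.extend p n).y (K + 1) = p.2 := by
  simp only [y, extend, ofNat_last, Fin.snoc_last]

lemma extend_n_last : (ω.extend p n).n (K + 1) = n := by
  simp only [Traj.n, extend, ofNat_last, Fin.snoc_last]

lemma extend_z {j : ℕ} (h : j ≤ K) : (ω.extend p n).z j = ω.z j := by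
  simp only [z, extend_x _ _ _ h, extend_n _ _ _ h]

/-- Outputs and memory at time `k` involve only times before `k`, which is why `k = K + 1` is still
allowed. -/
lemma extend_outputs {k : ℕ} (h : k ≤ K + 1) : outputs k (ω.extend p n) = outputs k ω := by
  funext j
  exact extend_z _ _ _ (by omega)

lemma extend_memory {k : ℕ} (h : k ≤ K + 1) : (ω.extend p n).memory k = ω.memory k := by
  induction k with
  | zero => rfl
  | succ k ih =>
    simp only [memory, extend_x _ _ _ (show k ≤ K by omega), extend_n _ _ _ (show k ≤ K by omega),
      ih (by omega)]

lemma extend_inputs_last :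
    inputs (K + 1) (ω.extend p n) = Fin.snoc (α := fun _ => Vec ny) (inputs K ω) p.2 := by
  funext j
  refine Fin.lastCases ?_ (fun j => ?_) j
  · simp only [inputs, Fin.snoc_last, Fin.val_last, extend_y_last]
  · simp only [inputs, Fin.snoc_castSucc, Fin.val_castSucc]
    exact extend_y _ _ _ (by omega)

lemma extend_bstate_last :
    bstate (K + 1) (ω.extend p n)
      = (p.1, ω.memory (K + 1), Fin.snoc (α := fun _ => Vec ny) (inputs K ω) p.2) := by
  simp only [bstate, extend_x_last, extend_memory _ _ _ le_rfl, extend_inputs_last]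

end extend

lemma outputs_succ (k : ℕ) (ω : Traj nx ny K) :
    outputs (k + 1) ω = Fin.snoc (α := fun _ => Output nx) (outputs k ω) (ω.z k) := by
  funext j
  refine Fin.lastCases ?_ (fun j => ?_) j
  · simp [outputs]
  · simp [outputs]

section upTo

variable {k : ℕ} (ω : Traj nx ny K)

lemma upTo_x {j : ℕ} (h : j ≤ k) : (upTo k ω).x j = ω.x j := by
  simp [x, upTo, Fin.ofNat, Nat.mod_eq_of_lt (show j < k + 1 by omega)]

lemma upTo_y {j : ℕ} (h : j ≤ k) : (upTo k ω).y j = ω.y j := by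
  simp [y, upTo, Fin.ofNat, Nat.mod_eq_of_lt (show j < k + 1 by omega)]

lemma upTo_n {j : ℕ} (h : j ≤ k) : (upTo k ω).n j = ω.n j := by
  simp [n, upTo, Fin.ofNat, Nat.mod_eq_of_lt (show j < k + 1 by omega)]

lemma upTo_z {j : ℕ} (h : j ≤ k) : (upTo k ω).z j = ω.z j := by
  simp only [z, upTo_x _ h, upTo_n _ h]

lemma upTo_outputs {i : ℕ} (h : i ≤ k + 1) : outputs i (upTo k ω) = outputs i ω := by
  funext j
  exact upTo_z _ (by omega)

lemma upTo_inputs {i : ℕ} (h : i ≤ k) : inputs i (upTo k ω) = inputs i ω := by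
  funext j
  exact upTo_y _ (by omega)

lemma upTo_memory {i : ℕ} (h : i ≤ k + 1) : (upTo k ω).memory i = ω.memory i := by
  induction i with
  | zero => rfl
  | succ i ih =>
    simp only [memory, upTo_x _ (show i ≤ k by omega), upTo_n _ (show i ≤ k by omega), ih (by omega)]

lemma upTo_bstate : bstate k (upTo k ω) = bstate k ω := by
  simp only [bstate, upTo_x _ le_rfl, upTo_memory _ (Nat.le_succ k), upTo_inputs _ le_rfl]

lemma upTo_self : upTo K ω = ω := by
  refine Prod.ext ?_ (Prod.ext ?_ ?_)
  · funext j; simp only [upTo, x, ofNat_val]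
  · funext j; simp only [upTo, y, ofNat_val]
  · funext j; simp only [upTo, n, ofNat_val]

lemma upTo_extend (p : Vec nx × Vec ny) (n : Bool) (h : k ≤ K) :
    upTo k (ω.extend p n) = upTo k ω := by
  refine Prod.ext ?_ (Prod.ext ?_ ?_)
  · funext j; exact extend_x ω p n (by omega)
  · funext j; exact extend_y ω p n (by omega)
  · funext j; exact extend_n ω p n (by omega)

end upTo

section measurability

lemma measurable_x (k : ℕ) : Measurable fun ω : Traj nx ny K => ω.x k :=
  (measurable_pi_apply _).comp measurable_fst

lemma measurable_y (k : ℕ) : Measurable fun ω : Traj nx ny K => ω.y k :=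
  (measurable_pi_apply _).comp (measurable_fst.comp measurable_snd)

lemma measurable_n (k : ℕ) : Measurable fun ω : Traj nx ny K => ω.n k :=
  (measurable_pi_apply _).comp (measurable_snd.comp measurable_snd)

lemma measurableSet_n (k : ℕ) : MeasurableSet {ω : Traj nx ny K | ω.n k = true} :=
  measurable_n k (measurableSet_singleton true)

lemma measurable_z (k : ℕ) : Measurable fun ω : Traj nx ny K => ω.z k :=
  Measurable.ite (measurableSet_n k) (measurable_inl.comp (measurable_x k)) measurable_const

lemma measurable_outputs (k : ℕ) : Measurable (outputs k : Traj nx ny K → _) :=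
  measurable_pi_lambda _ fun _ => measurable_z _

lemma measurable_inputs (k : ℕ) : Measurable (inputs k : Traj nx ny K → _) :=
  measurable_pi_lambda _ fun _ => measurable_y _

lemma measurable_memory (k : ℕ) : Measurable fun ω : Traj nx ny K => ω.memory k := by
  induction k with
  | zero => exact measurable_const
  | succ k ih =>
    exact Measurable.ite (measurableSet_n k) ih (ih.memory_discard (measurable_x k))

lemma measurable_bstate (k : ℕ) : Measurable (bstate k : Traj nx ny K → _) :=
  (measurable_x k).prodMk ((measurable_memory k).prodMk (measurable_inputs k))

lemma measurable_upTo (k : ℕ) : Measurable (upTo k : Traj nx ny K → Traj nx ny k) :=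
  (measurable_pi_lambda _ fun _ => measurable_x _).prodMk
    ((measurable_pi_lambda _ fun _ => measurable_y _).prodMk
      (measurable_pi_lambda _ fun _ => measurable_n _))

lemma measurable_extend (n : Bool) :
    Measurable fun q : Traj nx ny K × Vec nx × Vec ny => q.1.extend q.2 n := by
  unfold extend
  fun_prop

end measurability

end Traj

namespace PrivateSystem

variable (S : PrivateSystem nx ny)

/-- The reference measure on trajectories. -/
def refTraj (K : ℕ) : Measure (Traj nx ny K) :=
  (Measure.pi fun _ : Fin (K + 1) => S.refX).prod
    ((Measure.pi fun _ : Fin (K + 1) => S.refY).prod Measure.count)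

/-- The density of the law of the trajectory. -/
def trajDensity (K : ℕ) (A : SamplingPolicy nx) (ω : Traj nx ny K) : ℝ≥0∞ :=
  S.p0 (ω.x 0) (ω.y 0)
    * (∏ k ∈ Finset.range K,
        (S.px (ω.x (k + 1)) (ω.x k) (ω.y k) * S.py (ω.y (k + 1)) (ω.y k) : ℝ≥0∞))
    * ∏ k ∈ Finset.range (K + 1),
        ((A.coll k (Traj.outputs k ω)).prob (ω.n k) (ω.x k) (ω.memory k) : ℝ≥0∞)

lemma lintegral_count_snoc (n : ℕ) (f : (Fin (n + 1) → Bool) → ℝ≥0∞) :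
    ∫⁻ v, f v ∂Measure.count
      = ∫⁻ v, (f (Fin.snoc (α := fun _ => Bool) v false) + f (Fin.snoc (α := fun _ => Bool) v true))
        ∂(Measure.count : Measure (Fin n → Bool)) := by
  rw [lintegral_count, lintegral_count, tsum_fintype, tsum_fintype,
    ← (Fin.snocEquiv fun _ : Fin (n + 1) => Bool).sum_comp, Fintype.sum_prod_type,
    Finset.sum_comm]
  refine Finset.sum_congr rfl fun v _ => ?_
  rw [Fintype.sum_bool, add_comm]
  rfl

/-- The reference measure groups all states, all inputs and all decisions, while one step of time
adds one coordinate to each group. Repeated use of Tonelli brings the three new coordinates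
together. -/
lemma lintegral_refTraj_succ (K : ℕ) {f : Traj nx ny (K + 1) → ℝ≥0∞} (hf : Measurable f) :
    ∫⁻ ω, f ω ∂S.refTraj (K + 1)
      = ∫⁻ ω, ∫⁻ p, (f (ω.extend p false) + f (ω.extend p true)) ∂S.refX.prod S.refY ∂S.refTraj K := by
  have hg : Measurable fun q : Traj nx ny K × Vec nx × Vec ny =>
      f (q.1.extend q.2 false) + f (q.1.extend q.2 true) :=
    (hf.comp (Traj.measurable_extend false)).add (hf.comp (Traj.measurable_extend true))
  have hR : ∫⁻ ω, ∫⁻ p, (f (ω.extend p false) + f (ω.extend p true)) ∂S.refX.prod S.refY ∂S.refTraj K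
      = ∫⁻ u, ∫⁻ v, ∫⁻ n, ∫⁻ p, (f (Traj.extend (u, v, n) p false) + f (Traj.extend (u, v, n) p true))
        ∂S.refX.prod S.refY ∂Measure.count ∂(Measure.pi fun _ => S.refY)
        ∂(Measure.pi fun _ => S.refX) := by
    have h1 : Measurable fun ω : Traj nx ny K => ∫⁻ p, (f (ω.extend p false) + f (ω.extend p true)) ∂S.refX.prod S.refY :=
      Measurable.lintegral_prod_right' hg
    refine (lintegral_prod _ h1.aemeasurable).trans (lintegral_congr fun u => ?_)
    exact lintegral_prod _ (h1.comp (measurable_const.prodMk measurable_id)).aemeasurable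
  rw [hR]
  have hN : Measurable fun q : (Fin (K + 2) → Vec nx) × (Fin (K + 2) → Vec ny) =>
      ∫⁻ n, f (q.1, q.2, n) ∂Measure.count :=
    Measurable.lintegral_prod_right' (f := fun r : ((Fin (K + 2) → Vec nx) × (Fin (K + 2) → Vec ny)) ×
      (Fin (K + 2) → Bool) => f (r.1.1, r.1.2, r.2)) (by fun_prop)
  have hV : Measurable fun u : Fin (K + 2) → Vec nx =>
      ∫⁻ v, ∫⁻ n, f (u, v, n) ∂Measure.count ∂(Measure.pi fun _ => S.refY) :=
    Measurable.lintegral_prod_right' hN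
  have hL : ∫⁻ ω, f ω ∂S.refTraj (K + 1)
      = ∫⁻ u, ∫⁻ v, ∫⁻ n, f (u, v, n) ∂Measure.count ∂(Measure.pi fun _ => S.refY)
        ∂(Measure.pi fun _ => S.refX) := by
    refine (lintegral_prod _ hf.aemeasurable).trans (lintegral_congr fun u => ?_)
    exact lintegral_prod _ (hf.comp (measurable_const.prodMk measurable_id)).aemeasurable
  rw [hL, lintegral_pi_snoc _ _ hV]
  refine lintegral_congr fun u => ?_
  have h1 : ∀ x : Vec nx, ∫⁻ v, ∫⁻ n, f (Fin.snoc (α := fun _ => Vec nx) u x, v, n) ∂Measure.count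
        ∂(Measure.pi fun _ : Fin (K + 2) => S.refY)
      = ∫⁻ v, ∫⁻ y, ∫⁻ n, (f (Traj.extend (u, v, n) (x, y) false) + f (Traj.extend (u, v, n) (x, y) true))
          ∂Measure.count ∂S.refY ∂(Measure.pi fun _ : Fin (K + 1) => S.refY) := fun x => by
    refine (lintegral_pi_snoc _ _ (hN.comp (measurable_const.prodMk measurable_id))).trans ?_
    refine lintegral_congr fun v => lintegral_congr fun y => ?_
    exact lintegral_count_snoc _ _
  simp only [h1]
  have hH : Measurable fun r : (((Vec nx × (Fin (K + 1) → Vec ny)) × Vec ny) × (Fin (K + 1) → Bool)) =>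
      (f (Traj.extend (u, r.1.1.2, r.2) (r.1.1.1, r.1.2) false)
        + f (Traj.extend (u, r.1.1.2, r.2) (r.1.1.1, r.1.2) true)) :=
    hg.comp (g := fun q : Traj nx ny K × Vec nx × Vec ny => _)
      (f := fun r : (((Vec nx × (Fin (K + 1) → Vec ny)) × Vec ny) × (Fin (K + 1) → Bool)) =>
        (((u, r.1.1.2, r.2), (r.1.1.1, r.1.2)) : Traj nx ny K × Vec nx × Vec ny)) (by fun_prop)
  have hH1 := Measurable.lintegral_prod_right' (ν := Measure.count) hH
  rw [lintegral_lintegral_swap (Measurable.lintegral_prod_right' hH1).aemeasurable]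
  refine lintegral_congr fun v => ?_
  have hG : Measurable fun r : (Fin (K + 1) → Bool) × Vec nx × Vec ny =>
      (f (Traj.extend (u, v, r.1) r.2 false) + f (Traj.extend (u, v, r.1) r.2 true)) :=
    hg.comp (f := fun r : (Fin (K + 1) → Bool) × Vec nx × Vec ny =>
        (((u, v, r.1), r.2) : Traj nx ny K × Vec nx × Vec ny)) (by fun_prop)
  have hG' : ∫⁻ n, ∫⁻ p, (f (Traj.extend (u, v, n) p false) + f (Traj.extend (u, v, n) p true))
        ∂S.refX.prod S.refY ∂Measure.count
      = ∫⁻ p, ∫⁻ n, (f (Traj.extend (u, v, n) p false) + f (Traj.extend (u, v, n) p true))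
        ∂Measure.count ∂S.refX.prod S.refY := lintegral_lintegral_swap hG.aemeasurable
  rw [hG']
  exact (lintegral_prod _ (Measurable.lintegral_prod_left' hG).aemeasurable).symm

end PrivateSystem

end Trajectories

/-! ### The law of the trajectory as a Markov recursion -/

section Law

open Set

variable {nx ny : ℕ}

namespace PrivateSystem

variable (S : PrivateSystem nx ny) (A : SamplingPolicy nx)

lemma measurable_trajDensity (K : ℕ) : Measurable (S.trajDensity K A) := by
  unfold trajDensity
  have h0 : Measurable fun ω : Traj nx ny K => (S.p0 (ω.x 0) (ω.y 0) : ℝ≥0∞) :=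
    (S.measurable_p0.comp ((Traj.measurable_x 0).prodMk (Traj.measurable_y 0))).coe_nnreal_ennreal
  refine (h0.mul (Finset.measurable_fun_prod _ fun k _ => ?_)).mul
    (Finset.measurable_fun_prod _ fun k _ => ?_)
  · exact (S.measurable_px_comp (Traj.measurable_x _) (Traj.measurable_x _) (Traj.measurable_y _)).mul
      (S.measurable_py_comp (Traj.measurable_y _) (Traj.measurable_y _))
  · have h : ∀ n, Measurable fun ω : Traj nx ny K =>
        ((A.coll k (Traj.outputs k ω)).prob n (ω.x k) (ω.memory k) : ℝ≥0∞) := fun n =>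
      ((A.measurable_coll k n).comp ((Traj.measurable_outputs k).prodMk
        ((Traj.measurable_x k).prodMk (Traj.measurable_memory k)))).coe_nnreal_ennreal
    have : (fun ω : Traj nx ny K =>
        ((A.coll k (Traj.outputs k ω)).prob (ω.n k) (ω.x k) (ω.memory k) : ℝ≥0∞))
      = fun ω => if ω.n k = true then
          ((A.coll k (Traj.outputs k ω)).prob true (ω.x k) (ω.memory k) : ℝ≥0∞)
          else ((A.coll k (Traj.outputs k ω)).prob false (ω.x k) (ω.memory k) : ℝ≥0∞) := by
      funext ω
      rcases h : ω.n k <;> simp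
    rw [this]
    exact Measurable.ite (Traj.measurableSet_n k) (h true) (h false)

lemma trajDensity_extend (K : ℕ) (ω : Traj nx ny K) (p : Vec nx × Vec ny) (n : Bool) :
    S.trajDensity (K + 1) A (ω.extend p n)
      = S.trajDensity K A ω * (S.transDensity (ω.x K) (ω.y K) p
        * ((A.coll (K + 1) (Traj.outputs (K + 1) ω)).prob n p.1 (ω.memory (K + 1)) : ℝ≥0∞)) := by
  have h1 : ∀ k ∈ Finset.range K,
      (S.px ((ω.extend p n).x (k + 1)) ((ω.extend p n).x k) ((ω.extend p n).y k)
          * S.py ((ω.extend p n).y (k + 1)) ((ω.extend p n).y k) : ℝ≥0∞)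
        = S.px (ω.x (k + 1)) (ω.x k) (ω.y k) * S.py (ω.y (k + 1)) (ω.y k) := fun k hk => by
    have hk := Finset.mem_range.1 hk
    rw [Traj.extend_x _ _ _ (by omega), Traj.extend_x _ _ _ (by omega),
      Traj.extend_y _ _ _ (by omega), Traj.extend_y _ _ _ (by omega)]
  have h2 : ∀ k ∈ Finset.range (K + 1),
      ((A.coll k (Traj.outputs k (ω.extend p n))).prob ((ω.extend p n).n k) ((ω.extend p n).x k)
          ((ω.extend p n).memory k) : ℝ≥0∞)
        = (A.coll k (Traj.outputs k ω)).prob (ω.n k) (ω.x k) (ω.memory k) := fun k hk => by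
    have hk := Finset.mem_range.1 hk
    rw [Traj.extend_n _ _ _ (by omega), Traj.extend_x _ _ _ (by omega),
      Traj.extend_outputs _ _ _ (by omega), Traj.extend_memory _ _ _ (by omega)]
  unfold trajDensity
  rw [Finset.prod_range_succ _ K, Finset.prod_range_succ _ (K + 1), Finset.prod_congr rfl h1,
    Finset.prod_congr rfl h2, Traj.extend_x _ _ _ (Nat.zero_le K), Traj.extend_y _ _ _ (Nat.zero_le K),
    Traj.extend_x_last, Traj.extend_y_last, Traj.extend_n_last,
    Traj.extend_outputs _ _ _ le_rfl, Traj.extend_memory _ _ _ le_rfl,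
    Traj.extend_x _ _ _ le_rfl, Traj.extend_y _ _ _ le_rfl]
  unfold transDensity
  ring

lemma lintegral_law (K : ℕ) {F : Traj nx ny K → ℝ≥0∞} (hF : Measurable F) :
    ∫⁻ ω, F ω ∂S.law K A = ∫⁻ ω, S.trajDensity K A ω * F ω ∂S.refTraj K :=
  lintegral_withDensity_eq_lintegral_mul _ (S.measurable_trajDensity A K) hF

lemma ae_law_of_ae_refTraj {K : ℕ} {P : Traj nx ny K → Prop} (h : ∀ᵐ ω ∂S.refTraj K, P ω) :
    ∀ᵐ ω ∂S.law K A, P ω :=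
  (withDensity_absolutelyContinuous _ _).ae_le h

lemma measurable_collProb {β : Type*} [MeasurableSpace β] (k : ℕ) (n : Bool)
    {f : β → Fin k → Output nx} {g : β → Vec nx} {h : β → Memory nx}
    (hf : Measurable f) (hg : Measurable g) (hh : Measurable h) :
    Measurable fun p => ((A.coll k (f p)).prob n (g p) (h p) : ℝ≥0∞) :=
  MeasurableColl.prob (A.measurable_coll k) n hf hg hh

/-- The trajectory density is its restriction to the earlier times multiplied by one transition and
one decision probability, so the last step integrates out first. -/
lemma lintegral_law_succ (K : ℕ) {F : Traj nx ny (K + 1) → ℝ≥0∞} (hF : Measurable F) :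
    ∫⁻ ω, F ω ∂S.law (K + 1) A
      = ∫⁻ ω, ∫⁻ p, S.transDensity (ω.x K) (ω.y K) p
          * ((A.coll (K + 1) (Traj.outputs (K + 1) ω)).prob false p.1 (ω.memory (K + 1))
              * F (ω.extend p false)
            + (A.coll (K + 1) (Traj.outputs (K + 1) ω)).prob true p.1 (ω.memory (K + 1))
              * F (ω.extend p true)) ∂S.refX.prod S.refY ∂S.law K A := by
  have hm : Measurable fun q : Traj nx ny K × Vec nx × Vec ny =>
      S.transDensity (q.1.x K) (q.1.y K) q.2
          * ((A.coll (K + 1) (Traj.outputs (K + 1) q.1)).prob false q.2.1 (q.1.memory (K + 1))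
              * F (q.1.extend q.2 false)
            + (A.coll (K + 1) (Traj.outputs (K + 1) q.1)).prob true q.2.1 (q.1.memory (K + 1))
              * F (q.1.extend q.2 true)) := by
    have hp : ∀ n, Measurable fun q : Traj nx ny K × Vec nx × Vec ny =>
        ((A.coll (K + 1) (Traj.outputs (K + 1) q.1)).prob n q.2.1 (q.1.memory (K + 1)) : ℝ≥0∞) :=
      fun n => measurable_collProb A (K + 1) n ((Traj.measurable_outputs _).comp measurable_fst)
        (measurable_fst.comp measurable_snd) ((Traj.measurable_memory (K + 1)).comp measurable_fst)
    exact (S.measurable_transDensity ((Traj.measurable_x K).comp measurable_fst)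
        ((Traj.measurable_y K).comp measurable_fst) measurable_snd).mul
      (((hp false).mul (hF.comp (Traj.measurable_extend false))).add
        ((hp true).mul (hF.comp (Traj.measurable_extend true))))
  have hm' : Measurable fun ω => S.trajDensity (K + 1) A ω * F ω :=
    (S.measurable_trajDensity A _).mul hF
  rw [S.lintegral_law A _ hF, S.lintegral_refTraj_succ K hm',
    S.lintegral_law A _ (Measurable.lintegral_prod_right' hm)]
  refine lintegral_congr fun ω => ?_
  refine Eq.trans (lintegral_congr fun p => ?_)
    (lintegral_const_mul (S.trajDensity K A ω) (hm.comp (measurable_const.prodMk measurable_id)))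
  rw [trajDensity_extend, trajDensity_extend]
  ring

lemma ae_refTraj_x (K j : ℕ) : ∀ᵐ ω ∂S.refTraj K, ω.x j ∈ S.stateSet := by
  have h : ∀ᵐ u ∂(Measure.pi fun _ : Fin (K + 1) => S.refX), u (Fin.ofNat (K + 1) j) ∈ S.stateSet :=
    (Measure.quasiMeasurePreserving_eval (fun _ => S.refX) _).ae S.ae_mem_stateSet
  exact Measure.quasiMeasurePreserving_fst.ae h

lemma ae_refTraj_y (K j : ℕ) : ∀ᵐ ω ∂S.refTraj K, ω.y j ∈ S.inputSet := by
  have h : ∀ᵐ u ∂(Measure.pi fun _ : Fin (K + 1) => S.refY), u (Fin.ofNat (K + 1) j) ∈ S.inputSet :=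
    (Measure.quasiMeasurePreserving_eval (fun _ => S.refY) _).ae
      (ae_restrict_mem S.measurableSet_inputSet)
  exact Measure.quasiMeasurePreserving_snd.ae (Measure.quasiMeasurePreserving_fst.ae h)

/-- Decision probabilities sum to 1 and transition densities integrate to 1 at almost every
trajectory, so the later times disappear one by one and the law of the past does not depend on the
horizon. -/
lemma lintegral_law_upTo {k K : ℕ} (h : k ≤ K) {F : Traj nx ny k → ℝ≥0∞} (hF : Measurable F) :
    ∫⁻ ω, F (Traj.upTo k ω) ∂S.law K A = ∫⁻ ω, F ω ∂S.law k A := by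
  induction K, h using Nat.le_induction with
  | base => exact lintegral_congr fun ω => by rw [Traj.upTo_self]
  | succ K h ih =>
    rw [← ih]
    refine (S.lintegral_law_succ A K (hF.comp (Traj.measurable_upTo k))).trans
      (lintegral_congr_ae ?_)
    filter_upwards [S.ae_law_of_ae_refTraj A (S.ae_refTraj_x K K),
      S.ae_law_of_ae_refTraj A (S.ae_refTraj_y K K)] with ω hx hy
    rw [← one_mul (F _), ← S.lintegral_transDensity hx hy]
    refine Eq.trans (lintegral_congr fun p => ?_) (lintegral_mul_const _
      (S.measurable_transDensity measurable_const measurable_const measurable_id))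
    simp only [Function.comp_def, Traj.upTo_extend _ _ _ h]
    rw [← add_mul, Collection.prob_add, one_mul]

/-- The explicit belief state, obtained by iterating the update. -/
def iterBelief : (k : ℕ) → (Fin k → Output nx) → Belief nx ny k
  | 0, _ => S.initialBelief
  | k + 1, z => S.update (iterBelief k (Fin.init z)) (A.coll k (Fin.init z)) (z (Fin.last k))

lemma measurable_initialBelief : Measurable S.initialBelief := by
  have h : Measurable fun q : Memory nx × Vec nx × (Fin 1 → Vec ny) =>
      S.initialBelief (q.2.1, q.1, q.2.2) := by
    refine measurable_of_sigma_prod fun r => ?_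
    cases r with
    | zero =>
      have := S.measurable_p0
      exact ((this.comp (f := fun p : (Fin 0 → Vec nx) × Vec nx × (Fin 1 → Vec ny) => (p.2.1, p.2.2 0))
        (by fun_prop))).coe_nnreal_ennreal
    | succ r => exact measurable_const
  exact h.comp (f := fun w : BState nx ny 0 => (w.2.1, w.1, w.2.2)) (by fun_prop)

lemma measurableBelief_iterBelief (k : ℕ) : MeasurableBelief (S.iterBelief A k) := by
  induction k with
  | zero => exact measurableBelief_const S.measurable_initialBelief
  | succ k ih =>
    have h := S.measurableBelief_update (A.measurable_coll k) ih
    exact h.comp (f := fun z : Fin (k + 1) → Output nx => (Fin.init z, z (Fin.last k))) (by fun_prop)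

/-- The law of the outputs `Z^{k-1}`. -/
def outLaw (k : ℕ) : Measure (Fin k → Output nx) := (S.law k A).map (Traj.outputs k)

lemma map_outputs_law {k j K : ℕ} (h : j ≤ K) (h' : k ≤ j + 1) :
    (S.law K A).map (Traj.outputs k) = (S.law j A).map (Traj.outputs k) := by
  refine Measure.ext_of_lintegral _ fun f hf => ?_
  rw [lintegral_map hf (Traj.measurable_outputs k), lintegral_map hf (Traj.measurable_outputs k)]
  refine Eq.trans (lintegral_congr fun ω => ?_)
    (S.lintegral_law_upTo A h (hf.comp (Traj.measurable_outputs k)))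
  simp only [Traj.upTo_outputs _ h']

lemma map_outputs_eq_outLaw {k K : ℕ} (h : k ≤ K + 1) :
    (S.law K A).map (Traj.outputs k) = S.outLaw A k := by
  rcases Nat.lt_or_ge K k with h1 | h1
  · have : k = K + 1 := by omega
    subst this
    exact (S.map_outputs_law A (Nat.le_succ K) le_rfl).symm
  · exact S.map_outputs_law A h1 (Nat.le_succ k)

/-- One step of the system, averaged by the belief. -/
lemma lintegral_step (a : Collection nx) {k : ℕ} {b : Belief nx ny k} (hb : Measurable b)
    (hb1 : ∫⁻ w, b w ∂S.refState k ≠ ∞) {G : Output nx × BState nx ny (k + 1) → ℝ≥0∞}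
    (hG : Measurable G) :
    ∫⁻ w, b w * (a.prob false w.1 w.2.1 * (∫⁻ p, S.transDensity w.1 (w.2.2 (Fin.last k)) p
          * G (Sum.inr (), p.1, w.2.1.discard w.1, Fin.snoc (α := fun _ => Vec ny) w.2.2 p.2)
            ∂S.refX.prod S.refY)
        + a.prob true w.1 w.2.1 * ∫⁻ p, S.transDensity w.1 (w.2.2 (Fin.last k)) p
          * G (Sum.inl w.1, p.1, w.2.1, Fin.snoc (α := fun _ => Vec ny) w.2.2 p.2)
            ∂S.refX.prod S.refY) ∂S.refState k
      = ∫⁻ z, S.outputDensity a b z * ∫⁻ w, S.update b a z w * G (z, w) ∂S.refState (k + 1)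
          ∂S.refOutput := by
  have hp : ∀ n, Measurable fun w : BState nx ny k => (a.prob n w.1 w.2.1 : ℝ≥0∞) := fun n =>
    measurable_prob_coe a n measurable_fst (measurable_fst.comp measurable_snd)
  have ht : Measurable fun q : BState nx ny k × Vec nx × Vec ny =>
      S.transDensity q.1.1 (q.1.2.2 (Fin.last k)) q.2 :=
    S.measurable_transDensity (by fun_prop) (by fun_prop) (by fun_prop)
  have h0 : Measurable fun w : BState nx ny k =>
      ∫⁻ p, S.transDensity w.1 (w.2.2 (Fin.last k)) p
          * G (Sum.inr (), p.1, w.2.1.discard w.1, Fin.snoc (α := fun _ => Vec ny) w.2.2 p.2)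
            ∂S.refX.prod S.refY :=
    Measurable.lintegral_prod_right' (f := fun q : BState nx ny k × Vec nx × Vec ny =>
      S.transDensity q.1.1 (q.1.2.2 (Fin.last k)) q.2 * G (Sum.inr (), q.2.1,
        q.1.2.1.discard q.1.1, Fin.snoc (α := fun _ => Vec ny) q.1.2.2 q.2.2))
      (ht.mul (hG.comp (by fun_prop)))
  have h1 : Measurable fun w : BState nx ny k =>
      ∫⁻ p, S.transDensity w.1 (w.2.2 (Fin.last k)) p
          * G (Sum.inl w.1, p.1, w.2.1, Fin.snoc (α := fun _ => Vec ny) w.2.2 p.2)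
            ∂S.refX.prod S.refY :=
    Measurable.lintegral_prod_right' (f := fun q : BState nx ny k × Vec nx × Vec ny =>
      S.transDensity q.1.1 (q.1.2.2 (Fin.last k)) q.2 * G (Sum.inl q.1.1, q.2.1,
        q.1.2.1, Fin.snoc (α := fun _ => Vec ny) q.1.2.2 q.2.2))
      (ht.mul (hG.comp ((measurable_inl.comp (by fun_prop)).prodMk (by fun_prop))))
  have hb0 : S.discardProb a b ≠ ∞ ∧ ∀ᵐ x ∂S.refX, S.retainDensity a b x ≠ ∞ := by
    have := S.ae_lintegral_update a hb hb1
    rw [ae_refOutput_iff] at this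
    exact ⟨this.2.1, this.1.mono fun x hx => hx.1⟩
  rw [lintegral_refOutput, add_comm (lintegral _ _)]
  simp_rw [mul_add, ← mul_assoc, mul_comm (b _)]
  have hm1 : Measurable fun w : BState nx ny k => a.prob true w.1 w.2.1 * b w * ∫⁻ p, S.transDensity w.1 (w.2.2 (Fin.last k)) p
          * G (Sum.inl w.1, p.1, w.2.1, Fin.snoc (α := fun _ => Vec ny) w.2.2 p.2)
            ∂S.refX.prod S.refY := ((hp true).mul hb).mul h1
  have hm0 : Measurable fun w : BState nx ny k => a.prob false w.1 w.2.1 * b w * ∫⁻ p, S.transDensity w.1 (w.2.2 (Fin.last k)) p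
          * G (Sum.inr (), p.1, w.2.1.discard w.1, Fin.snoc (α := fun _ => Vec ny) w.2.2 p.2)
            ∂S.refX.prod S.refY := ((hp false).mul hb).mul h0
  rw [lintegral_add_left hm0]
  congr 1
  · change _ = S.discardProb a b * _
    -- At density zero the division in the update is degenerate, but then both sides vanish.
    rcases eq_or_ne (S.discardProb a b) 0 with h | h
    · rw [h, zero_mul]
      refine (lintegral_congr_ae ?_).trans lintegral_zero
      filter_upwards [S.ae_prob_false_mul_eq_zero a hb h] with w hw
      rw [hw, zero_mul]
    · exact (S.discardProb_mul_lintegral_update a hb h hb0.1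
        (hG.comp (measurable_const.prodMk measurable_id))).symm
  · rw [S.lintegral_refState hm1]
    refine lintegral_congr_ae ?_
    filter_upwards [hb0.2] with x hx
    change _ = S.retainDensity a b x * _
    rcases eq_or_ne (S.retainDensity a b x) 0 with h | h
    · rw [h, zero_mul]
      have hq : ∀ᵐ q ∂S.refMemory.prod (S.refInputs k), a.prob true x q.1 * b (x, q.1, q.2) = 0 := by
        have hm : Measurable fun q : Memory nx × (Fin (k + 1) → Vec ny) =>
            a.prob true x q.1 * b (x, q.1, q.2) :=
          ((hp true).mul hb).comp (measurable_const.prodMk measurable_id)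
        exact (lintegral_eq_zero_iff hm).1 h
      refine (lintegral_congr_ae ?_).trans lintegral_zero
      filter_upwards [hq] with q hq
      rw [hq, zero_mul]
    · exact (S.retainDensity_mul_lintegral_update a hb h hx
        (hG.comp (measurable_const.prodMk measurable_id))).symm

end PrivateSystem

end Law

/-! ### The explicit belief determines the joint law of outputs and hidden variables -/

section BeliefLaw

open Set

variable {nx ny : ℕ}

namespace Traj

variable {K : ℕ}

lemma memory_succ_of_true {ω : Traj nx ny K} {k : ℕ} (h : ω.n k = true) :
    ω.memory (k + 1) = ω.memory k := by
  simp [memory, h]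

lemma memory_succ_of_false {ω : Traj nx ny K} {k : ℕ} (h : ω.n k = false) :
    ω.memory (k + 1) = (ω.memory k).discard (ω.x k) := by
  simp [memory, h]

lemma z_of_true {ω : Traj nx ny K} {k : ℕ} (h : ω.n k = true) : ω.z k = Sum.inl (ω.x k) := by
  simp [z, h]

lemma z_of_false {ω : Traj nx ny K} {k : ℕ} (h : ω.n k = false) : ω.z k = Sum.inr () := by
  simp [z, h]

end Traj

namespace PrivateSystem

variable (S : PrivateSystem nx ny) (A : SamplingPolicy nx)

lemma lintegral_pi_one {α : Type*} [MeasurableSpace α] (μ : Measure α) [SigmaFinite μ]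
    {f : (Fin 1 → α) → ℝ≥0∞} (hf : Measurable f) :
    ∫⁻ v, f v ∂(Measure.pi fun _ => μ) = ∫⁻ x, f (fun _ => x) ∂μ := by
  rw [lintegral_pi_snoc μ 0 hf, lintegral_unique]
  simp only [Measure.pi_empty_univ, mul_one]
  refine lintegral_congr fun x => congrArg f (funext fun j => ?_)
  rw [Fin.fin_one_eq_zero j]
  exact Fin.snoc_last (α := fun _ => α) x _

lemma lintegral_initialBelief {F : BState nx ny 0 → ℝ≥0∞} (hF : Measurable F) :
    ∫⁻ w, S.initialBelief w * F w ∂S.refState 0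
      = ∫⁻ x, ∫⁻ y, S.p0 x y * F (x, Memory.empty nx, fun _ => y) ∂S.refY ∂S.refX := by
  have hm : Measurable fun w => S.initialBelief w * F w := S.measurable_initialBelief.mul hF
  rw [S.lintegral_refState hm]
  refine lintegral_congr fun x => ?_
  have hx : Measurable fun q : Memory nx × (Fin 1 → Vec ny) =>
      S.initialBelief (x, q.1, q.2) * F (x, q.1, q.2) := hm.comp (measurable_const.prodMk measurable_id)
  rw [lintegral_prod _ hx.aemeasurable, lintegral_refMemory, tsum_eq_single 0]
  · rw [lintegral_unique]
    simp only [Measure.pi_empty_univ, mul_one]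
    refine (lintegral_pi_one _ (hx.comp (measurable_const.prodMk measurable_id))).trans
      (lintegral_congr fun y => ?_)
    exact congrArg (fun v : Fin 0 → Vec nx => (S.p0 x y : ℝ≥0∞) * F (x, ⟨0, v⟩, fun _ => y))
      (Subsingleton.elim _ _)
  · intro r hr
    obtain ⟨r, rfl⟩ := Nat.exists_eq_succ_of_ne_zero hr
    refine (lintegral_congr fun v => ?_).trans lintegral_zero
    exact (lintegral_congr fun v => by simp [initialBelief]).trans lintegral_zero

lemma lintegral_refTraj_zero {f : Traj nx ny 0 → ℝ≥0∞} (hf : Measurable f) :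
    ∫⁻ ω, f ω ∂S.refTraj 0
      = ∫⁻ x, ∫⁻ y, (f (fun _ => x, fun _ => y, fun _ => false)
          + f (fun _ => x, fun _ => y, fun _ => true)) ∂S.refY ∂S.refX := by
  have hN : Measurable fun q : (Fin 1 → Vec nx) × (Fin 1 → Vec ny) =>
      ∫⁻ n, f (q.1, q.2, n) ∂Measure.count :=
    Measurable.lintegral_prod_right' (f := fun r : ((Fin 1 → Vec nx) × (Fin 1 → Vec ny)) ×
      (Fin 1 → Bool) => f (r.1.1, r.1.2, r.2)) (by fun_prop)
  have h1 : ∀ u : Fin 1 → Vec nx, ∫⁻ r, f (u, r) ∂((Measure.pi fun _ : Fin 1 => S.refY).prod Measure.count)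
      = ∫⁻ y, ∫⁻ n, f (u, (fun _ => y), n) ∂Measure.count ∂S.refY := fun u =>
    (lintegral_prod _ (hf.comp (measurable_const.prodMk measurable_id)).aemeasurable).trans
      (lintegral_pi_one _ (hN.comp (measurable_const.prodMk measurable_id)))
  have h2 : ∀ (n : Bool) (v : Fin 0 → Bool), Fin.snoc (α := fun _ => Bool) v n = fun _ => n := by
    intro n v
    funext j
    rw [Fin.fin_one_eq_zero j]
    exact Fin.snoc_last (α := fun _ => Bool) n v
  refine (lintegral_prod _ hf.aemeasurable).trans ?_
  simp only [h1]
  have hV : Measurable fun u : Fin 1 → Vec nx =>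
      ∫⁻ y, ∫⁻ n, f (u, (fun _ => y), n) ∂Measure.count ∂S.refY :=
    Measurable.lintegral_prod_right' (f := fun q : (Fin 1 → Vec nx) × Vec ny =>
      ∫⁻ n, f (q.1, (fun _ => q.2), n) ∂Measure.count)
      (hN.comp (measurable_fst.prodMk (by fun_prop)))
  refine (lintegral_pi_one _ hV).trans (lintegral_congr fun x => lintegral_congr fun y => ?_)
  rw [lintegral_count_snoc, lintegral_count, tsum_fintype, Fintype.sum_unique]
  simp only [h2]

/-- The joint law of the outputs `Z^{k-1}`, the triple `(X_k, M_k, Y^k)` and the decision `N_k` is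
determined by the explicit belief state. -/
def HasBeliefLaw (k : ℕ) : Prop :=
  ∀ G : (Fin k → Output nx) × BState nx ny k × Bool → ℝ≥0∞, Measurable G →
    ∫⁻ ω, G (Traj.outputs k ω, Traj.bstate k ω, ω.n k) ∂S.law k A
      = ∫⁻ z, ∫⁻ w, S.iterBelief A k z w
          * ((A.coll k z).prob false w.1 w.2.1 * G (z, w, false)
            + (A.coll k z).prob true w.1 w.2.1 * G (z, w, true)) ∂S.refState k ∂S.outLaw A k

lemma trajDensity_zero (x : Vec nx) (y : Vec ny) (n : Bool) :
    S.trajDensity 0 A (fun _ => x, fun _ => y, fun _ => n)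
      = S.p0 x y * (A.coll 0 default).prob n x (Memory.empty nx) := by
  simp only [trajDensity, Finset.range_zero, Finset.prod_empty, mul_one, zero_add,
    Finset.prod_range_one]
  rw [Subsingleton.elim (Traj.outputs 0 _) default]
  rfl

lemma lintegral_law_zero {F : Traj nx ny 0 → ℝ≥0∞} (hF : Measurable F) :
    ∫⁻ ω, F ω ∂S.law 0 A
      = ∫⁻ x, ∫⁻ y, S.p0 x y * ((A.coll 0 default).prob false x (Memory.empty nx)
            * F (fun _ => x, fun _ => y, fun _ => false)
          + (A.coll 0 default).prob true x (Memory.empty nx)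
            * F (fun _ => x, fun _ => y, fun _ => true)) ∂S.refY ∂S.refX := by
  have hm : Measurable fun ω => S.trajDensity 0 A ω * F ω := (S.measurable_trajDensity A 0).mul hF
  rw [S.lintegral_law A 0 hF, S.lintegral_refTraj_zero hm]
  refine lintegral_congr fun x => lintegral_congr fun y => ?_
  rw [trajDensity_zero, trajDensity_zero]
  ring

instance instIsProbabilityMeasureLaw (K : ℕ) : IsProbabilityMeasure (S.law K A) := by
  have h : ∫⁻ _, 1 ∂S.law K A = 1 := by
    rw [S.lintegral_law_upTo A (Nat.zero_le K) (F := fun _ => 1) measurable_const,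
      S.lintegral_law_zero A measurable_const]
    refine Eq.trans ?_ S.lintegral_p0
    refine lintegral_congr fun x => lintegral_congr fun y => ?_
    rw [mul_one, mul_one, Collection.prob_add, mul_one]
  exact ⟨by simpa using h⟩

instance (k : ℕ) : IsProbabilityMeasure (S.outLaw A k) :=
  Measure.isProbabilityMeasure_map (Traj.measurable_outputs k).aemeasurable

lemma outLaw_zero : S.outLaw A 0 = Measure.dirac default := by
  refine Measure.ext_of_lintegral _ fun f hf => ?_
  rw [lintegral_unique, lintegral_unique]
  simp

lemma measurable_collProb_mul {k : ℕ} {G : (Fin k → Output nx) × BState nx ny k × Bool → ℝ≥0∞}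
    (hG : Measurable G) : Measurable fun q : (Fin k → Output nx) × BState nx ny k =>
      ((A.coll k q.1).prob false q.2.1 q.2.2.1 * G (q.1, q.2, false)
            + (A.coll k q.1).prob true q.2.1 q.2.2.1 * G (q.1, q.2, true)) := by
  have h : ∀ n, Measurable fun q : (Fin k → Output nx) × BState nx ny k =>
      ((A.coll k q.1).prob n q.2.1 q.2.2.1 : ℝ≥0∞) := fun n =>
    measurable_collProb A k n (by fun_prop) (by fun_prop) (by fun_prop)
  exact ((h false).mul (hG.comp (by fun_prop))).add ((h true).mul (hG.comp (by fun_prop)))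

lemma hasBeliefLaw_zero : S.HasBeliefLaw A 0 := by
  intro G hG
  have hF : Measurable fun ω : Traj nx ny 0 => G (Traj.outputs 0 ω, Traj.bstate 0 ω, ω.n 0) :=
    hG.comp ((Traj.measurable_outputs 0).prodMk ((Traj.measurable_bstate 0).prodMk (Traj.measurable_n 0)))
  rw [S.lintegral_law_zero A hF, outLaw_zero, lintegral_dirac]
  refine Eq.trans ?_ (S.lintegral_initialBelief
    ((measurable_collProb_mul A hG).comp (measurable_const.prodMk measurable_id))).symm
  refine lintegral_congr fun x => lintegral_congr fun y => ?_
  have h0 : ∀ ω : Traj nx ny 0, Traj.outputs 0 ω = default := fun ω => Subsingleton.elim _ _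
  simp only [h0, Function.comp_def, id]
  rfl

lemma lintegral_iterBelief_initial : ∫⁻ w, S.initialBelief w ∂S.refState 0 = 1 := by
  have h := S.lintegral_initialBelief (F := fun _ => 1) measurable_const
  simp only [mul_one] at h
  rw [h]
  exact S.lintegral_p0

/-- The law of `Z^k` in terms of that of `Z^{k-1}`. -/
lemma HasBeliefLaw.lintegral_outLaw_succ {k : ℕ} (h : S.HasBeliefLaw A k)
    {g : (Fin (k + 1) → Output nx) → ℝ≥0∞} (hg : Measurable g) :
    ∫⁻ z, g z ∂S.outLaw A (k + 1)
      = ∫⁻ z, ∫⁻ z', S.outputDensity (A.coll k z) (S.iterBelief A k z) z'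
          * g (Fin.snoc (α := fun _ => Output nx) z z') ∂S.refOutput ∂S.outLaw A k := by
  rw [outLaw, S.map_outputs_law A (Nat.le_succ k) le_rfl, lintegral_map hg (Traj.measurable_outputs _)]
  have hG : Measurable fun q : (Fin k → Output nx) × BState nx ny k × Bool =>
      g (Fin.snoc (α := fun _ => Output nx) q.1 (if q.2.2 = true then Sum.inl q.2.1.1 else Sum.inr ())) := by
    refine hg.comp (measurable_fst.fin_snoc (Measurable.ite ?_ (measurable_inl.comp (by fun_prop)) measurable_const))
    exact (measurable_snd.comp measurable_snd) (measurableSet_singleton true)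
  have h1 := h _ hG
  refine Eq.trans ?_ (h1.trans (lintegral_congr fun z => ?_))
  · refine lintegral_congr fun ω => ?_
    rw [Traj.outputs_succ]
    rfl
  · have hb := (S.measurableBelief_iterBelief A k).val (measurable_const (a := z)) measurable_id
    have h2 := S.stepExp_output (A.coll k z) (b := S.iterBelief A k z) hb
      (g := fun z' => g (Fin.snoc (α := fun _ => Output nx) z z'))
      (hg.comp (measurable_const.fin_snoc measurable_inl)).aemeasurable
    rw [← h2]
    refine lintegral_congr fun w => ?_
    simp only [Bool.false_eq_true, if_false, if_true]
    ring

/-- Given the history, the next output has density `outputDensity`, so outputs of zero density may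
be ignored. This is what lets statements about the update be proved away from the degenerate
divisions. -/
lemma HasBeliefLaw.ae_outLaw_succ {k : ℕ} (h : S.HasBeliefLaw A k)
    {P : (Fin (k + 1) → Output nx) → Prop} (hP : MeasurableSet {z | P z})
    (h1 : ∀ᵐ z ∂S.outLaw A k, ∀ᵐ z' ∂S.refOutput,
      S.outputDensity (A.coll k z) (S.iterBelief A k z) z' ≠ 0 → P (Fin.snoc (α := fun _ => Output nx) z z')) :
    ∀ᵐ z ∂S.outLaw A (k + 1), P z := by
  have hm : Measurable ({z | ¬ P z}.indicator (1 : (Fin (k + 1) → Output nx) → ℝ≥0∞)) :=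
    measurable_one.indicator hP.compl
  rw [ae_iff, ← lintegral_indicator_one (show MeasurableSet {z | ¬ P z} from hP.compl)]
  refine (HasBeliefLaw.lintegral_outLaw_succ S A h hm).trans ?_
  refine (lintegral_congr_ae ?_).trans lintegral_zero
  filter_upwards [h1] with z hz
  refine (lintegral_congr_ae ?_).trans lintegral_zero
  filter_upwards [hz] with z' hz'
  by_cases h0 : S.outputDensity (A.coll k z) (S.iterBelief A k z) z' = 0
  · rw [h0, zero_mul]
  · rw [indicator_of_notMem, mul_zero]
    exact fun h => h (hz' h0)

lemma measurableSet_lintegral_iterBelief (k : ℕ) :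
    MeasurableSet {z | ∫⁻ w, S.iterBelief A k z w ∂S.refState k = 1} :=
  (Measurable.lintegral_prod_right' (S.measurableBelief_iterBelief A k)) (measurableSet_singleton 1)

/-- Induction on time. One step of the trajectory law, averaged by the current belief, is the output
density times an integral against the updated belief (`lintegral_step`), and the output density is
the conditional law of the next output. Normalization is proved along the way because it guarantees
that the output densities are finite, as `lintegral_step` needs. -/
theorem hasBeliefLaw (k : ℕ) : S.HasBeliefLaw A k ∧
    ∀ᵐ z ∂S.outLaw A k, ∫⁻ w, S.iterBelief A k z w ∂S.refState k = 1 := by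
  induction k with
  | zero =>
    exact ⟨S.hasBeliefLaw_zero A, .of_forall fun z => S.lintegral_iterBelief_initial⟩
  | succ k ih =>
    have hb : ∀ z, Measurable (S.iterBelief A k z) := fun z =>
      (S.measurableBelief_iterBelief A k).val (measurable_const (a := z)) measurable_id
    refine ⟨fun G hG => ?_, ?_⟩
    · have hF : Measurable fun ω : Traj nx ny (k + 1) =>
          G (Traj.outputs (k + 1) ω, Traj.bstate (k + 1) ω, ω.n (k + 1)) :=
        hG.comp ((Traj.measurable_outputs _).prodMk ((Traj.measurable_bstate _).prodMk (Traj.measurable_n _)))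
      have hG' := measurable_collProb_mul A hG
      set G' : (Fin (k + 1) → Output nx) × BState nx ny (k + 1) → ℝ≥0∞ := fun q =>
        ((A.coll (k + 1) q.1).prob false q.2.1 q.2.2.1 * G (q.1, q.2, false)
            + (A.coll (k + 1) q.1).prob true q.2.1 q.2.2.1 * G (q.1, q.2, true)) with hG'def
      -- The expectation of `G` one step later, given the history, the triple and the decision at
      -- time `k`. The decision fixes both the output and the next memory.
      let H : (Fin k → Output nx) × BState nx ny k × Bool → ℝ≥0∞ := fun q =>
        if q.2.2 = true then ∫⁻ p, S.transDensity q.2.1.1 (q.2.1.2.2 (Fin.last k)) p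
            * G' (Fin.snoc (α := fun _ => Output nx) q.1 (Sum.inl q.2.1.1), p.1, q.2.1.2.1,
              Fin.snoc (α := fun _ => Vec ny) q.2.1.2.2 p.2) ∂S.refX.prod S.refY
        else ∫⁻ p, S.transDensity q.2.1.1 (q.2.1.2.2 (Fin.last k)) p
            * G' (Fin.snoc (α := fun _ => Output nx) q.1 (Sum.inr ()), p.1, q.2.1.2.1.discard q.2.1.1,
              Fin.snoc (α := fun _ => Vec ny) q.2.1.2.2 p.2) ∂S.refX.prod S.refY
      have ht : Measurable fun r : ((Fin k → Output nx) × BState nx ny k × Bool) × Vec nx × Vec ny =>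
          S.transDensity r.1.2.1.1 (r.1.2.1.2.2 (Fin.last k)) r.2 :=
        S.measurable_transDensity (by fun_prop) (by fun_prop) (by fun_prop)
      have hH : Measurable H := by
        refine Measurable.ite ((measurable_snd.comp measurable_snd) (measurableSet_singleton true)) ?_ ?_
        · exact Measurable.lintegral_prod_right' (f := fun r : ((Fin k → Output nx) × BState nx ny k × Bool)
            × Vec nx × Vec ny => S.transDensity r.1.2.1.1 (r.1.2.1.2.2 (Fin.last k)) r.2
              * G' (Fin.snoc (α := fun _ => Output nx) r.1.1 (Sum.inl r.1.2.1.1), r.2.1, r.1.2.1.2.1,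
                Fin.snoc (α := fun _ => Vec ny) r.1.2.1.2.2 r.2.2))
            (ht.mul (hG'.comp (((by fun_prop : Measurable _).fin_snoc (measurable_inl.comp (by fun_prop))).prodMk
              (by fun_prop))))
        · exact Measurable.lintegral_prod_right' (f := fun r : ((Fin k → Output nx) × BState nx ny k × Bool)
            × Vec nx × Vec ny => S.transDensity r.1.2.1.1 (r.1.2.1.2.2 (Fin.last k)) r.2
              * G' (Fin.snoc (α := fun _ => Output nx) r.1.1 (Sum.inr ()), r.2.1, r.1.2.1.2.1.discard r.1.2.1.1,
                Fin.snoc (α := fun _ => Vec ny) r.1.2.1.2.2 r.2.2))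
            (ht.mul (hG'.comp (((by fun_prop : Measurable _).fin_snoc measurable_const).prodMk
              (by fun_prop))))
      have h1 : ∫⁻ ω, G (Traj.outputs (k + 1) ω, Traj.bstate (k + 1) ω, ω.n (k + 1)) ∂S.law (k + 1) A
          = ∫⁻ ω, H (Traj.outputs k ω, Traj.bstate k ω, ω.n k) ∂S.law k A := by
        refine (S.lintegral_law_succ A k hF).trans (lintegral_congr fun ω => ?_)
        have h2 : ∀ p n, G (Traj.outputs (k + 1) (ω.extend p n), Traj.bstate (k + 1) (ω.extend p n),
            (ω.extend p n).n (k + 1)) = G (Traj.outputs (k + 1) ω, (p.1, ω.memory (k + 1),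
              Fin.snoc (α := fun _ => Vec ny) (Traj.inputs k ω) p.2), n) := fun p n => by
          rw [Traj.extend_outputs _ _ _ le_rfl, Traj.extend_bstate_last, Traj.extend_n_last]
        simp only [h2]
        have h3 : ω.y k = Traj.inputs k ω (Fin.last k) := by simp [Traj.inputs]
        rcases hn : ω.n k
        · rw [Traj.memory_succ_of_false hn, Traj.outputs_succ, Traj.z_of_false hn, h3]
          rfl
        · rw [Traj.memory_succ_of_true hn, Traj.outputs_succ, Traj.z_of_true hn, h3]
          rfl
      have hΨ : Measurable fun z : Fin (k + 1) → Output nx =>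
          ∫⁻ w, S.iterBelief A (k + 1) z w * G' (z, w) ∂S.refState (k + 1) :=
        Measurable.lintegral_prod_right' (f := fun q : (Fin (k + 1) → Output nx) × BState nx ny (k + 1) =>
          S.iterBelief A (k + 1) q.1 q.2 * G' (q.1, q.2))
          (Measurable.mul (S.measurableBelief_iterBelief A (k + 1)) (hG'.comp (by fun_prop)))
      rw [h1, ih.1 H hH, HasBeliefLaw.lintegral_outLaw_succ S A ih.1 hΨ]
      refine lintegral_congr_ae ?_
      filter_upwards [ih.2] with z hz
      have h4 := S.lintegral_step (A.coll k z) (hb z) (by rw [hz]; exact ENNReal.one_ne_top)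
        (G := fun q => G' (Fin.snoc (α := fun _ => Output nx) z q.1, q.2))
        (hG'.comp ((measurable_const.fin_snoc measurable_fst).prodMk measurable_snd))
      refine Eq.trans ?_ (h4.trans ?_)
      · rfl
      · refine lintegral_congr fun z' => ?_
        simp only [iterBelief, Fin.init_snoc, Fin.snoc_last]
    · refine HasBeliefLaw.ae_outLaw_succ S A ih.1 (S.measurableSet_lintegral_iterBelief A (k + 1)) ?_
      filter_upwards [ih.2] with z hz
      filter_upwards [S.ae_lintegral_update (A.coll k z) (hb z) (by rw [hz]; exact ENNReal.one_ne_top)]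
        with z' hz' h0
      simp only [iterBelief, Fin.init_snoc, Fin.snoc_last]
      exact hz'.2 h0

end PrivateSystem

end BeliefLaw

/-! ### Conditional expectations and conditional densities given the outputs -/

section Conditioning

open Set

variable {nx ny : ℕ}

namespace PrivateSystem

variable (S : PrivateSystem nx ny) (A : SamplingPolicy nx)

lemma measurable_iterBelief (k : ℕ) (z : Fin k → Output nx) : Measurable (S.iterBelief A k z) :=
  (S.measurableBelief_iterBelief A k).val measurable_const measurable_id

/-- The conditional expectation given the outputs `Z^{k-1} = z` of a function of `z`, of the
triple `(X_k, M_k, Y^k)` and of the decision `N_k`. -/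
def condStep (k : ℕ) (G : (Fin k → Output nx) × BState nx ny k × Bool → ℝ≥0∞)
    (z : Fin k → Output nx) : ℝ≥0∞ :=
  ∫⁻ w, S.iterBelief A k z w
    * ((A.coll k z).prob false w.1 w.2.1 * G (z, w, false)
      + (A.coll k z).prob true w.1 w.2.1 * G (z, w, true)) ∂S.refState k

variable {k K : ℕ}

lemma measurable_condStep {G : (Fin k → Output nx) × BState nx ny k × Bool → ℝ≥0∞}
    (hG : Measurable G) : Measurable (S.condStep A k G) :=
  Measurable.lintegral_prod_right' (f := fun q : (Fin k → Output nx) × BState nx ny k =>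
    S.iterBelief A k q.1 q.2 * ((A.coll k q.1).prob false q.2.1 q.2.2.1 * G (q.1, q.2, false)
      + (A.coll k q.1).prob true q.2.1 q.2.2.1 * G (q.1, q.2, true)))
    (Measurable.mul (S.measurableBelief_iterBelief A k) (measurable_collProb_mul A hG))

lemma lintegral_law_condStep (hk : k ≤ K) {G : (Fin k → Output nx) × BState nx ny k × Bool → ℝ≥0∞}
    (hG : Measurable G) :
    ∫⁻ ω, G (Traj.outputs k ω, Traj.bstate k ω, ω.n k) ∂S.law K A
      = ∫⁻ z, S.condStep A k G z ∂S.outLaw A k := by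
  have h := (S.hasBeliefLaw A k).1 G hG
  have hF : Measurable fun ω : Traj nx ny k => G (Traj.outputs k ω, Traj.bstate k ω, ω.n k) :=
    hG.comp ((Traj.measurable_outputs _).prodMk ((Traj.measurable_bstate _).prodMk (Traj.measurable_n _)))
  refine Eq.trans (lintegral_congr fun ω => ?_) ((S.lintegral_law_upTo A hk hF).trans h)
  simp only [Traj.upTo_outputs _ (Nat.le_succ k), Traj.upTo_bstate, Traj.upTo_n _ le_rfl]

lemma lintegral_law_outputs (hk : k ≤ K + 1) {g : (Fin k → Output nx) → ℝ≥0∞}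
    (hg : AEMeasurable g (S.outLaw A k)) :
    ∫⁻ ω, g (Traj.outputs k ω) ∂S.law K A = ∫⁻ z, g z ∂S.outLaw A k := by
  rw [← S.map_outputs_eq_outLaw A hk] at hg ⊢
  exact (lintegral_map' hg (Traj.measurable_outputs k).aemeasurable).symm

lemma ae_law_of_ae_outLaw (hk : k ≤ K + 1) {P : (Fin k → Output nx) → Prop}
    (h : ∀ᵐ z ∂S.outLaw A k, P z) : ∀ᵐ ω ∂S.law K A, P (Traj.outputs k ω) := by
  rw [← S.map_outputs_eq_outLaw A hk] at h
  exact ae_of_ae_map (Traj.measurable_outputs k).aemeasurable h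

lemma ae_outLaw_of_ae_law (hk : k ≤ K + 1) {f g : (Fin k → Output nx) → ℝ≥0∞}
    (hf : Measurable f) (hg : Measurable g)
    (h : ∀ᵐ ω ∂S.law K A, f (Traj.outputs k ω) ≤ g (Traj.outputs k ω)) :
    f ≤ᵐ[S.outLaw A k] g := by
  rw [← S.map_outputs_eq_outLaw A hk]
  exact (ae_map_iff (Traj.measurable_outputs k).aemeasurable (measurableSet_le hf hg)).2 h

/-- The σ-algebra generated by the outputs. -/
abbrev outSigma (nx ny K k : ℕ) : MeasurableSpace (Traj nx ny K) :=
  MeasurableSpace.comap (Traj.outputs k) inferInstance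

lemma outSigma_le : outSigma nx ny K k ≤ (inferInstance : MeasurableSpace (Traj nx ny K)) :=
  (Traj.measurable_outputs k).comap_le

lemma outSigma_mono {j : ℕ} (h : k ≤ j) : outSigma nx ny K k ≤ outSigma nx ny K j := by
  have h1 : Traj.outputs k = (fun z : Fin j → Output nx => fun i : Fin k => z (Fin.castLE h i))
      ∘ (Traj.outputs j : Traj nx ny K → _) := rfl
  rw [outSigma, h1, ← MeasurableSpace.comap_comp]
  exact MeasurableSpace.comap_mono ((measurable_pi_lambda _ fun _ => measurable_pi_apply _).comap_le)

/-- Events of the σ-algebra of the outputs are preimages of sets of histories, so testing against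
indicators of histories characterizes the conditional expectation. -/
lemma condExpOutputs_eq_of_forall {f : Traj nx ny K → ℝ≥0∞} {g : (Fin k → Output nx) → ℝ≥0∞}
    (hg : Measurable g)
    (h : ∀ s : Set (Fin k → Output nx), MeasurableSet s →
      ∫⁻ ω, s.indicator 1 (Traj.outputs k ω) * f ω ∂S.law K A
        = ∫⁻ ω, s.indicator 1 (Traj.outputs k ω) * g (Traj.outputs k ω) ∂S.law K A) :
    S.condExpOutputs K A k f =ᵐ[S.law K A] fun ω => g (Traj.outputs k ω) := by
  refine (ae_eq_condLExp (outSigma_le (nx := nx) (ny := ny) (K := K) (k := k)) _ f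
    (hg.comp (comap_measurable _)) fun s hs => ?_).symm
  obtain ⟨t, ht, rfl⟩ := hs
  have h1 : ∀ F : Traj nx ny K → ℝ≥0∞, ∫⁻ ω in Traj.outputs k ⁻¹' t, F ω ∂S.law K A
      = ∫⁻ ω, t.indicator 1 (Traj.outputs k ω) * F ω ∂S.law K A := fun F => by
    rw [← lintegral_indicator (Traj.measurable_outputs k ht)]
    refine lintegral_congr fun ω => ?_
    by_cases hω : Traj.outputs k ω ∈ t
    · rw [indicator_of_mem hω, indicator_of_mem (show ω ∈ Traj.outputs k ⁻¹' t from hω), Pi.one_apply, one_mul]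
    · rw [indicator_of_notMem hω, indicator_of_notMem (show ω ∉ Traj.outputs k ⁻¹' t from hω), zero_mul]
  rw [h1, h1]
  exact (h t ht).symm

lemma condExpOutputs_congr {f g : Traj nx ny K → ℝ≥0∞} (h : f =ᵐ[S.law K A] g) :
    S.condExpOutputs K A k f =ᵐ[S.law K A] S.condExpOutputs K A k g :=
  condLExp_congr_ae h

/-- An indicator of the history is absorbed into `G` and factors out of the integral against the
belief, so the belief law gives all the required test identities. -/
lemma condExpOutputs_step (hk : k ≤ K) {G : (Fin k → Output nx) × BState nx ny k × Bool → ℝ≥0∞}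
    (hG : Measurable G) :
    S.condExpOutputs K A k (fun ω => G (Traj.outputs k ω, Traj.bstate k ω, ω.n k))
      =ᵐ[S.law K A] fun ω => S.condStep A k G (Traj.outputs k ω) := by
  refine S.condExpOutputs_eq_of_forall A (S.measurable_condStep A hG) fun s hs => ?_
  have h1 : Measurable (s.indicator (1 : (Fin k → Output nx) → ℝ≥0∞)) := measurable_one.indicator hs
  have hG' : Measurable fun q : (Fin k → Output nx) × BState nx ny k × Bool =>
    s.indicator (1 : (Fin k → Output nx) → ℝ≥0∞) q.1 * G q := (h1.comp measurable_fst).mul hG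
  refine (S.lintegral_law_condStep A hk hG').trans ?_
  refine Eq.trans (lintegral_congr fun z => ?_) (S.lintegral_law_outputs A (Nat.le_succ_of_le hk)
    (h1.mul (S.measurable_condStep A hG)).aemeasurable).symm
  have hm : Measurable fun w : BState nx ny k => S.iterBelief A k z w
      * ((A.coll k z).prob false w.1 w.2.1 * G (z, w, false)
        + (A.coll k z).prob true w.1 w.2.1 * G (z, w, true)) :=
    (S.measurable_iterBelief A k z).mul ((measurable_collProb_mul A hG).comp (measurable_const.prodMk measurable_id))
  refine Eq.trans (lintegral_congr fun w => ?_) (lintegral_const_mul _ hm)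
  simp only
  ring

lemma stepExp_iterBelief (f : Output nx → BState nx ny k → ℝ≥0∞) (z : Fin k → Output nx) :
    S.stepExp (A.coll k z) (S.iterBelief A k z) f
      = ∫⁻ w, S.iterBelief A k z w * ((A.coll k z).prob false w.1 w.2.1 * f (Sum.inr ()) w
      + (A.coll k z).prob true w.1 w.2.1 * f (Sum.inl w.1) w) ∂S.refState k := by
  refine lintegral_congr fun w => ?_
  ring

/-- Conditional expectations of functions of `(Z^{k-1}, Z_k, X_k, M_k, Y^k)` given `Z^{k-1}`. -/
lemma condExpOutputs_stepExp (hk : k ≤ K) {f : (Fin k → Output nx) → Output nx → BState nx ny k → ℝ≥0∞}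
    (hf : Measurable fun q : (Fin k → Output nx) × Output nx × BState nx ny k => f q.1 q.2.1 q.2.2) :
    S.condExpOutputs K A k (fun ω => f (Traj.outputs k ω) (ω.z k) (Traj.bstate k ω))
      =ᵐ[S.law K A] fun ω => S.stepExp (A.coll k (Traj.outputs k ω))
        (S.iterBelief A k (Traj.outputs k ω)) (f (Traj.outputs k ω)) := by
  have hG : Measurable fun q : (Fin k → Output nx) × BState nx ny k × Bool =>
      f q.1 (if q.2.2 = true then Sum.inl q.2.1.1 else Sum.inr ()) q.2.1 := by
    refine hf.comp (measurable_fst.prodMk (Measurable.prodMk (Measurable.ite ?_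
      (measurable_inl.comp (by fun_prop)) measurable_const) (by fun_prop)))
    exact (measurable_snd.comp measurable_snd) (measurableSet_singleton true)
  refine (S.condExpOutputs_step A hk hG).trans (.of_forall fun ω => ?_)
  refine Eq.symm ((S.stepExp_iterBelief A _ _).trans ?_)
  simp only [condStep, Bool.false_eq_true, if_false, if_true]

lemma lintegral_law_stepExp (hk : k ≤ K) {f : (Fin k → Output nx) → Output nx → BState nx ny k → ℝ≥0∞}
    (hf : Measurable fun q : (Fin k → Output nx) × Output nx × BState nx ny k => f q.1 q.2.1 q.2.2) :
    ∫⁻ ω, f (Traj.outputs k ω) (ω.z k) (Traj.bstate k ω) ∂S.law K A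
      = ∫⁻ z, S.stepExp (A.coll k z) (S.iterBelief A k z) (f z) ∂S.outLaw A k := by
  have hm := S.measurable_stepExp (A.measurable_coll k) (S.measurableBelief_iterBelief A k) hf
  rw [← S.lintegral_law_outputs A (Nat.le_succ_of_le hk) hm.aemeasurable,
    ← lintegral_congr_ae (S.condExpOutputs_stepExp A hk hf)]
  exact (lintegral_condLExp outSigma_le _ _).symm

lemma ae_lintegral_iterBelief (hk : k ≤ K + 1) :
    ∀ᵐ ω ∂S.law K A, ∫⁻ w, S.iterBelief A k (Traj.outputs k ω) w ∂S.refState k = 1 :=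
  S.ae_law_of_ae_outLaw A hk (S.hasBeliefLaw A k).2

/-! ### Conditional densities -/

/-- By uniqueness of densities, any explicit formula that disintegrates the joint law is a version
of the conditional density. -/
lemma condDensity_ae_eq {Ω α β : Type*} [MeasurableSpace Ω] [MeasurableSpace α] [MeasurableSpace β]
    {P : Measure Ω} [IsFiniteMeasure P] {U : Ω → α} {T : Ω → β} {ref : Measure β} [SigmaFinite ref]
    {d : α × β → ℝ≥0∞} (hd : Measurable d)
    (h : P.map (fun ω => (U ω, T ω)) = ((P.map U).prod ref).withDensity d) :
    ∀ᵐ p ∂(P.map U).prod ref, condDensity P U T ref p.1 p.2 = d p := by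
  have : IsFiniteMeasure (P.map U) := Measure.isFiniteMeasure_map P U
  have h1 := Measure.rnDeriv_withDensity ((P.map U).prod ref) hd
  rw [← h] at h1
  exact h1

lemma map_outputs_bstate (hk : k ≤ K) :
    (S.law K A).map (fun ω => (Traj.outputs k ω, Traj.bstate k ω))
      = (((S.law K A).map (Traj.outputs k)).prod (S.refState k)).withDensity
          (fun q => S.iterBelief A k q.1 q.2) := by
  have hb : Measurable fun q : (Fin k → Output nx) × BState nx ny k => S.iterBelief A k q.1 q.2 :=
    S.measurableBelief_iterBelief A k
  refine Measure.ext_of_lintegral _ fun f hf => ?_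
  have hf' : Measurable fun q : (Fin k → Output nx) × Output nx × BState nx ny k => f (q.1, q.2.2) :=
    hf.comp (by fun_prop)
  have hbf : Measurable fun q : (Fin k → Output nx) × BState nx ny k => S.iterBelief A k q.1 q.2 * f q :=
    hb.mul hf
  rw [lintegral_map hf ((Traj.measurable_outputs k).prodMk (Traj.measurable_bstate k)),
    lintegral_withDensity_eq_lintegral_mul _ hb hf, S.map_outputs_eq_outLaw A (Nat.le_succ_of_le hk)]
  refine (S.lintegral_law_stepExp A hk (f := fun z _ w => f (z, w)) hf').trans ?_
  refine Eq.trans ?_ (lintegral_prod _ hbf.aemeasurable).symm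
  refine lintegral_congr fun z => lintegral_congr fun w => ?_
  simp only
  rw [← add_mul, ← add_mul, Collection.prob_add, one_mul]

lemma belief_ae_eq_iterBelief (hk : k ≤ K) :
    ∀ᵐ z ∂S.outLaw A k, S.belief K A k z =ᵐ[S.refState k] S.iterBelief A k z := by
  have h := condDensity_ae_eq (S.measurableBelief_iterBelief A k)
    (S.map_outputs_bstate A hk)
  rw [S.map_outputs_eq_outLaw A (Nat.le_succ_of_le hk)] at h
  have h' := Measure.ae_ae_of_ae_prod h
  filter_upwards [h'] with z hz
  exact hz

lemma map_outputs_bstate_belief (hk : k ≤ K) :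
    (S.law K A).map (fun ω => (Traj.outputs k ω, Traj.bstate k ω))
      = (((S.law K A).map (Traj.outputs k)).prod (S.refState k)).withDensity
          (fun q => S.belief K A k q.1 q.2) := by
  rw [S.map_outputs_bstate A hk]
  refine withDensity_congr_ae ?_
  filter_upwards [condDensity_ae_eq (S.measurableBelief_iterBelief A k)
    (S.map_outputs_bstate A hk)] with q hq
  exact hq.symm

/-- There is only one empty history and it carries full mass, so the almost sure statement holds
outright. -/
lemma belief_zero (z : Fin 0 → Output nx) : S.belief K A 0 z =ᵐ[S.refState 0] S.initialBelief := by
  have h := S.belief_ae_eq_iterBelief A (Nat.zero_le K)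
  obtain ⟨z', hz'⟩ := h.exists
  rw [Subsingleton.elim z z']
  exact hz'

lemma measurableBelief_belief (k : ℕ) : MeasurableBelief (S.belief K A k) :=
  Measure.measurable_rnDeriv _ _

end PrivateSystem

end Conditioning

/-! ### The information gain expressed through the belief -/

section InformationGain

open Set

variable {nx ny : ℕ}

namespace PrivateSystem

variable (S : PrivateSystem nx ny) (A : SamplingPolicy nx) {k K : ℕ}

lemma ae_law_of_ae_withDensity {Ω β : Type*} [MeasurableSpace Ω] [MeasurableSpace β] {P : Measure Ω}
    {T : Ω → β} (hT : Measurable T) {ν : Measure β} {d : β → ℝ≥0∞} (h : P.map T = ν.withDensity d)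
    {p : β → Prop} (hp : ∀ᵐ t ∂ν, p t) : ∀ᵐ ω ∂P, p (T ω) := by
  have : ∀ᵐ t ∂P.map T, p t := by
    rw [h]
    exact (withDensity_absolutelyContinuous _ _).ae_le hp
  exact ae_of_ae_map hT.aemeasurable this

lemma map_outputs_inputs (hk : k ≤ K) :
    (S.law K A).map (fun ω => (Traj.outputs k ω, Traj.inputs k ω))
      = (((S.law K A).map (Traj.outputs k)).prod (S.refInputs k)).withDensity
          (fun q => S.priorInputs (S.iterBelief A k q.1) q.2) := by
  have hd : Measurable fun q : (Fin k → Output nx) × (Fin (k + 1) → Vec ny) =>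
      S.priorInputs (S.iterBelief A k q.1) q.2 :=
    S.measurable_priorInputs (S.measurableBelief_iterBelief A k)
  refine Measure.ext_of_lintegral _ fun f hf => ?_
  have hf' : Measurable fun q : (Fin k → Output nx) × Output nx × BState nx ny k => f (q.1, q.2.2.2.2) :=
    hf.comp (by fun_prop)
  have hdf : Measurable fun q : (Fin k → Output nx) × (Fin (k + 1) → Vec ny) =>
    S.priorInputs (S.iterBelief A k q.1) q.2 * f q := hd.mul hf
  rw [lintegral_map hf ((Traj.measurable_outputs k).prodMk (Traj.measurable_inputs k)),
    lintegral_withDensity_eq_lintegral_mul _ hd hf, S.map_outputs_eq_outLaw A (Nat.le_succ_of_le hk)]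
  refine (S.lintegral_law_stepExp A hk (f := fun z _ w => f (z, w.2.2)) hf').trans ?_
  refine Eq.trans ?_ (lintegral_prod _ hdf.aemeasurable).symm
  refine lintegral_congr fun z => ?_
  have hfz : Measurable fun w : BState nx ny k => f (z, w.2.2) := hf.comp (by fun_prop)
  have hb : Measurable fun w : BState nx ny k => S.iterBelief A k z w * f (z, w.2.2) :=
    (S.measurable_iterBelief A k z).mul hfz
  have h1 : S.stepExp (A.coll k z) (S.iterBelief A k z) (fun _ w => f (z, w.2.2))
      = ∫⁻ w, S.iterBelief A k z w * f (z, w.2.2) ∂S.refState k := by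
    refine lintegral_congr fun w => ?_
    simp only
    rw [← add_mul, ← add_mul, Collection.prob_add, one_mul]
  rw [h1, S.lintegral_refState_inputs hb]
  refine lintegral_congr fun y => ?_
  exact lintegral_mul_const (f (z, y)) ((S.measurable_iterBelief A k z).comp
    (f := fun q : Vec nx × Memory nx => ((q.1, q.2, y) : BState nx ny k)) (by fun_prop))

/-- The conditional density of `Y^k` given `Z^k`, computed from the explicit belief state. -/
def iterPosterior (k : ℕ) (z : Fin (k + 1) → Output nx) (y : Fin (k + 1) → Vec ny) : ℝ≥0∞ :=
  S.posteriorInputs (A.coll k (Fin.init z)) (S.iterBelief A k (Fin.init z)) (z (Fin.last k)) y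

lemma measurable_iterPosterior (k : ℕ) :
    Measurable fun q : (Fin (k + 1) → Output nx) × (Fin (k + 1) → Vec ny) =>
      S.iterPosterior A k q.1 q.2 :=
  (S.measurable_posteriorInputs (A.measurable_coll k) (S.measurableBelief_iterBelief A k)).comp
    (f := fun q : (Fin (k + 1) → Output nx) × (Fin (k + 1) → Vec ny) =>
      (q.1 (Fin.last k), (Fin.init q.1 : Fin k → Output nx), q.2)) (by fun_prop)

/-- The posterior times the density of the last output is the joint density of that output and the
inputs. Where the output density is 0 the joint density vanishes too, and the value ∞ is negligible,
so the division is undone. -/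
lemma map_outputs_succ_inputs (hk : k ≤ K) :
    (S.law K A).map (fun ω => (Traj.outputs (k + 1) ω, Traj.inputs k ω))
      = (((S.law K A).map (Traj.outputs (k + 1))).prod (S.refInputs k)).withDensity
          (fun q => S.iterPosterior A k q.1 q.2) := by
  have hd := S.measurable_iterPosterior A k
  refine Measure.ext_of_lintegral _ fun f hf => ?_
  have hf' : Measurable fun q : (Fin k → Output nx) × Output nx × BState nx ny k =>
      f (Fin.snoc (α := fun _ => Output nx) q.1 q.2.1, q.2.2.2.2) :=
    hf.comp (by fun_prop)
  have hdf : Measurable fun q : (Fin (k + 1) → Output nx) × (Fin (k + 1) → Vec ny) =>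
    S.iterPosterior A k q.1 q.2 * f q := hd.mul hf
  rw [lintegral_map hf ((Traj.measurable_outputs _).prodMk (Traj.measurable_inputs k)),
    lintegral_withDensity_eq_lintegral_mul _ hd hf,
    S.map_outputs_eq_outLaw A (Nat.succ_le_succ hk)]
  simp only [Traj.outputs_succ]
  refine (S.lintegral_law_stepExp A hk
    (f := fun z z' w => f (Fin.snoc (α := fun _ => Output nx) z z', w.2.2)) hf').trans ?_
  refine Eq.trans ?_ (lintegral_prod _ hdf.aemeasurable).symm
  rw [HasBeliefLaw.lintegral_outLaw_succ S A (S.hasBeliefLaw A k).1 (Measurable.lintegral_prod_right' hdf)]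
  refine lintegral_congr_ae ?_
  filter_upwards [(S.hasBeliefLaw A k).2] with z hz
  have hb := S.measurable_iterBelief A k z
  have hfz : Measurable fun p : Output nx × (Fin (k + 1) → Vec ny) =>
      f (Fin.snoc (α := fun _ => Output nx) z p.1, p.2) := hf.comp (by fun_prop)
  refine (S.stepExp_output_inputs (A.coll k z) hb
    (f := fun z' y => f (Fin.snoc (α := fun _ => Output nx) z z', y)) hfz).trans ?_
  refine lintegral_congr_ae ?_
  filter_upwards [S.ae_jointDensity (A.coll k z) hb (by rw [hz]; exact ENNReal.one_ne_top)] with z' hz'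
  have hm : Measurable fun y : Fin (k + 1) → Vec ny =>
      S.iterPosterior A k (Fin.snoc (α := fun _ => Output nx) z z') y
        * f (Fin.snoc (α := fun _ => Output nx) z z', y) := hdf.comp (measurable_const.prodMk measurable_id)
  refine Eq.trans (lintegral_congr_ae ?_) (lintegral_const_mul _ hm)
  filter_upwards [hz'] with y hy
  rw [iterPosterior, Fin.init_snoc, Fin.snoc_last, posteriorInputs_eq, ← mul_assoc,
    ENNReal.mul_div_cancel' hy.2.2.2.1 (fun h => absurd h hy.2.1)]

lemma condDensity_inputs_ae (hk : k ≤ K) : ∀ᵐ ω ∂S.law K A,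
    condDensity (S.law K A) (Traj.outputs k) (Traj.inputs k) (S.refInputs k)
        (Traj.outputs k ω) (Traj.inputs k ω)
      = S.priorInputs (S.iterBelief A k (Traj.outputs k ω)) (Traj.inputs k ω) := by
  have hd : Measurable fun q : (Fin k → Output nx) × (Fin (k + 1) → Vec ny) =>
      S.priorInputs (S.iterBelief A k q.1) q.2 :=
    S.measurable_priorInputs (S.measurableBelief_iterBelief A k)
  exact ae_law_of_ae_withDensity ((Traj.measurable_outputs k).prodMk (Traj.measurable_inputs k))
    (S.map_outputs_inputs A hk) (condDensity_ae_eq hd (S.map_outputs_inputs A hk))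

lemma condDensity_inputs_succ_ae (hk : k ≤ K) : ∀ᵐ ω ∂S.law K A,
    condDensity (S.law K A) (Traj.outputs (k + 1)) (Traj.inputs k) (S.refInputs k)
        (Traj.outputs (k + 1) ω) (Traj.inputs k ω)
      = S.posteriorInputs (A.coll k (Traj.outputs k ω)) (S.iterBelief A k (Traj.outputs k ω))
          (ω.z k) (Traj.inputs k ω) := by
  filter_upwards [ae_law_of_ae_withDensity
    ((Traj.measurable_outputs _).prodMk (Traj.measurable_inputs k))
    (S.map_outputs_succ_inputs A hk) (condDensity_ae_eq (S.measurable_iterPosterior A k)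
      (S.map_outputs_succ_inputs A hk))] with ω hω
  refine hω.trans ?_
  rw [iterPosterior, Traj.outputs_succ, Fin.init_snoc, Fin.snoc_last]

/-- The information gain, computed from the explicit belief state. -/
def iterGain (k : ℕ) (z : Fin k → Output nx) (z' : Output nx) (w : BState nx ny k) : ℝ :=
  S.logRatio (A.coll k z) (S.iterBelief A k z) z' w.2.2

lemma measurable_iterGain (k : ℕ) :
    Measurable fun q : (Fin k → Output nx) × Output nx × BState nx ny k =>
      S.iterGain A k q.1 q.2.1 q.2.2 :=
  (S.measurable_logRatio (A.measurable_coll k) (S.measurableBelief_iterBelief A k)).comp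
    (f := fun q : (Fin k → Output nx) × Output nx × BState nx ny k => (q.2.1, q.1, q.2.2.2.2))
    (by fun_prop)

lemma infoGain_ae (hk : k ≤ K) : ∀ᵐ ω ∂S.law K A,
    S.infoGain K A k ω = S.iterGain A k (Traj.outputs k ω) (ω.z k) (Traj.bstate k ω) := by
  filter_upwards [S.condDensity_inputs_ae A hk, S.condDensity_inputs_succ_ae A hk] with ω h1 h2
  rw [infoGain, h1, h2]
  rfl

/-- The positive and the negative part of the information gain. -/
def gainPos (k : ℕ) (ω : Traj nx ny K) : ℝ≥0∞ :=
  ENNReal.ofReal (S.iterGain A k (Traj.outputs k ω) (ω.z k) (Traj.bstate k ω))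

/-- The negative part of the information gain. -/
def gainNeg (k : ℕ) (ω : Traj nx ny K) : ℝ≥0∞ :=
  ENNReal.ofReal (-S.iterGain A k (Traj.outputs k ω) (ω.z k) (Traj.bstate k ω))

lemma measurable_outputs_z_bstate (k : ℕ) :
    Measurable fun ω : Traj nx ny K => (Traj.outputs k ω, ω.z k, Traj.bstate k ω) :=
  (Traj.measurable_outputs k).prodMk ((Traj.measurable_z k).prodMk (Traj.measurable_bstate k))

lemma measurable_gainPos (k : ℕ) : Measurable (S.gainPos A k : Traj nx ny K → ℝ≥0∞) :=
  ENNReal.measurable_ofReal.comp ((S.measurable_iterGain A k).comp (measurable_outputs_z_bstate k))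

lemma measurable_gainNeg (k : ℕ) : Measurable (S.gainNeg A k : Traj nx ny K → ℝ≥0∞) :=
  ENNReal.measurable_ofReal.comp ((S.measurable_iterGain A k).comp (measurable_outputs_z_bstate k)).neg

lemma condInfoGain_ae {j : ℕ} (hj : j ≤ K) :
    S.condInfoGain K A j k =ᵐ[S.law K A] fun ω =>
      S.condExpOutputs K A k (S.gainPos A j) ω - S.condExpOutputs K A k (S.gainNeg A j) ω := by
  have h1 : S.condExpOutputs K A k (fun ω' => ENNReal.ofReal (S.infoGain K A j ω'))
      =ᵐ[S.law K A] S.condExpOutputs K A k (S.gainPos A j) := by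
    refine S.condExpOutputs_congr A ?_
    filter_upwards [S.infoGain_ae A hj] with ω hω
    rw [hω, gainPos]
  have h2 : S.condExpOutputs K A k (fun ω' => ENNReal.ofReal (-S.infoGain K A j ω'))
      =ᵐ[S.law K A] S.condExpOutputs K A k (S.gainNeg A j) := by
    refine S.condExpOutputs_congr A ?_
    filter_upwards [S.infoGain_ae A hj] with ω hω
    rw [hω, gainNeg]
  filter_upwards [h1, h2] with ω h1 h2
  rw [condInfoGain, h1, h2]

/-- At time `k`, the conditional expectations of both parts of the information gain, and the bounds
on the negative part. -/
lemma condExpOutputs_gain (hk : k ≤ K) : ∀ᵐ ω ∂S.law K A,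
    S.condExpOutputs K A k (S.gainPos A k) ω - S.condExpOutputs K A k (S.gainNeg A k) ω
      = S.infoLoss (A.coll k (Traj.outputs k ω)) (S.iterBelief A k (Traj.outputs k ω)) ∧
    S.condExpOutputs K A k (S.gainNeg A k) ω ≤ S.condExpOutputs K A k (S.gainPos A k) ω ∧
    S.condExpOutputs K A k (S.gainNeg A k) ω ≤ 1 := by
  have h1 := S.condExpOutputs_stepExp A hk (f := fun z z' w => ENNReal.ofReal (S.iterGain A k z z' w))
    (ENNReal.measurable_ofReal.comp (S.measurable_iterGain A k))
  have h2 := S.condExpOutputs_stepExp A hk (f := fun z z' w => ENNReal.ofReal (-S.iterGain A k z z' w))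
    (ENNReal.measurable_ofReal.comp (S.measurable_iterGain A k).neg)
  filter_upwards [h1, h2, S.ae_lintegral_iterBelief A (Nat.le_succ_of_le hk)] with ω h1 h2 h3
  have h4 := S.stepExp_neg_logRatio_le (A.coll k (Traj.outputs k ω))
    (S.measurable_iterBelief A k (Traj.outputs k ω)) h3
  unfold gainPos gainNeg
  rw [h1, h2]
  exact ⟨rfl, h4⟩

/-- The finite bound keeps every later subtraction in [0,∞] free of the form ∞ − ∞. -/
lemma lintegral_gainNeg_le (hk : k ≤ K) : ∫⁻ ω, S.gainNeg A k ω ∂S.law K A ≤ 1 := by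
  have h : ∫⁻ ω, S.condExpOutputs K A k (S.gainNeg A k) ω ∂S.law K A
      = ∫⁻ ω, S.gainNeg A k ω ∂S.law K A := lintegral_condLExp outSigma_le _ _
  rw [← h]
  refine (lintegral_mono_ae ?_).trans (lintegral_one.trans measure_univ).le
  filter_upwards [S.condExpOutputs_gain A hk] with ω hω using hω.2.2

end PrivateSystem

end InformationGain

/-! ### The one-step recursion for the cost-to-go -/

section CostToGo

open Set

variable {nx ny : ℕ}

namespace PrivateSystem

variable (S : PrivateSystem nx ny) (A : SamplingPolicy nx) {k K : ℕ}

lemma measurable_condExpOutputs (f : Traj nx ny K → ℝ≥0∞) :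
    Measurable (S.condExpOutputs K A k f) := measurable_condLExp' _ _ _

lemma condExpOutputs_tower {j : ℕ} (h : j ≤ k) (f : Traj nx ny K → ℝ≥0∞) :
    S.condExpOutputs K A j (S.condExpOutputs K A k f) =ᵐ[S.law K A] S.condExpOutputs K A j f := by
  refine ae_eq_condLExp (outSigma_le (nx := nx) (ny := ny) (K := K) (k := j)) _ f
    (measurable_condLExp _ _ _) fun s hs => ?_
  refine (setLIntegral_condLExp outSigma_le _ _ hs).trans ?_
  exact setLIntegral_condLExp outSigma_le _ _ (outSigma_mono h _ hs)

lemma condExpOutputs_mono {f g : Traj nx ny K → ℝ≥0∞} (h : f ≤ᵐ[S.law K A] g) :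
    S.condExpOutputs K A k f ≤ᵐ[S.law K A] S.condExpOutputs K A k g := condLExp_mono h

lemma condExpOutputs_add {f : Traj nx ny K → ℝ≥0∞} (hf : AEMeasurable f (S.law K A))
    (g : Traj nx ny K → ℝ≥0∞) :
    S.condExpOutputs K A k (fun ω => f ω + g ω)
      =ᵐ[S.law K A] fun ω => S.condExpOutputs K A k f ω + S.condExpOutputs K A k g ω :=
  condLExp_add_left g hf

lemma lintegral_condExpOutputs (f : Traj nx ny K → ℝ≥0∞) :
    ∫⁻ ω, S.condExpOutputs K A k f ω ∂S.law K A = ∫⁻ ω, f ω ∂S.law K A :=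
  lintegral_condLExp outSigma_le _ _

lemma condExpOutputs_const_mul (f : Traj nx ny K → ℝ≥0∞) (c : ℝ≥0) :
    S.condExpOutputs K A k (fun ω => c * f ω)
      =ᵐ[S.law K A] fun ω => c * S.condExpOutputs K A k f ω :=
  condLExp_smul' f ENNReal.coe_ne_top

/-- Truncated subtraction is not linear; the hypotheses allow `f` to be written as `(f - g) + g` and
the conditional expectation of `g`, almost surely finite, to be cancelled. -/
lemma condExpOutputs_sub {f g : Traj nx ny K → ℝ≥0∞} (hg : Measurable g) (hf : Measurable f)
    (hgf : g ≤ᵐ[S.law K A] f) (hg1 : ∫⁻ ω, g ω ∂S.law K A ≠ ∞) :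
    S.condExpOutputs K A k (fun ω => f ω - g ω)
      =ᵐ[S.law K A] fun ω => S.condExpOutputs K A k f ω - S.condExpOutputs K A k g ω := by
  have h1 : f =ᵐ[S.law K A] fun ω => (f ω - g ω) + g ω := by
    filter_upwards [hgf] with ω hω
    exact (tsub_add_cancel_of_le hω).symm
  filter_upwards [S.condExpOutputs_congr A (k := k) h1,
    S.condExpOutputs_add A (k := k) (f := fun ω => f ω - g ω) (hf.sub hg).aemeasurable g, condLExp_ne_top (mΩ := outSigma nx ny K k) hg1]
    with ω h2 h3 h4
  rw [h2, h3]
  exact (ENNReal.add_sub_cancel_right h4).symm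

/-- Gibbs' inequality at time `j`, conditioned down to time `k` by the tower property. -/
lemma condExpOutputs_gainNeg_le {j : ℕ} (hkj : k ≤ j) (hj : j ≤ K) :
    S.condExpOutputs K A k (S.gainNeg A j) ≤ᵐ[S.law K A] S.condExpOutputs K A k (S.gainPos A j) := by
  have h := S.condExpOutputs_mono A (k := k) (f := S.condExpOutputs K A j (S.gainNeg A j))
    (g := S.condExpOutputs K A j (S.gainPos A j))
    ((S.condExpOutputs_gain A hj).mono fun ω hω => hω.2.1)
  filter_upwards [h, S.condExpOutputs_tower A hkj (S.gainNeg A j),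
    S.condExpOutputs_tower A hkj (S.gainPos A j)] with ω h1 h2 h3
  rwa [← h2, ← h3]

lemma measurable_condInfoGain (j k : ℕ) : Measurable (S.condInfoGain K A j k) :=
  (S.measurable_condExpOutputs A _).sub (S.measurable_condExpOutputs A _)

/-- A tower property for a truncated difference, valid because the negative part is dominated by the
positive part and has finite expectation. -/
lemma condExpOutputs_condInfoGain {j : ℕ} (hkj : k ≤ j) (hj : j ≤ K) {i : ℕ} (hik : i ≤ k) :
    S.condExpOutputs K A i (S.condInfoGain K A j k) =ᵐ[S.law K A] S.condInfoGain K A j i := by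
  have h1 := S.condExpOutputs_congr A (k := i) (S.condInfoGain_ae A hj (k := k))
  have h2 := S.condExpOutputs_sub A (k := i) (S.measurable_condExpOutputs A (k := k) (S.gainNeg A j))
    (S.measurable_condExpOutputs A (k := k) (S.gainPos A j)) (S.condExpOutputs_gainNeg_le A hkj hj)
    (by
      rw [lintegral_condExpOutputs]
      exact ((S.lintegral_gainNeg_le A hj).trans_lt ENNReal.one_lt_top).ne)
  filter_upwards [h1, h2, S.condExpOutputs_tower A hik (S.gainNeg A j),
    S.condExpOutputs_tower A hik (S.gainPos A j), S.condInfoGain_ae A hj (k := i)] with ω h1 h2 h3 h4 h5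
  rw [h1, h2, h3, h4, h5]

lemma condInfoGain_self (hk : k ≤ K) : ∀ᵐ ω ∂S.law K A,
    S.condInfoGain K A k k ω
      = S.infoLoss (A.coll k (Traj.outputs k ω)) (S.iterBelief A k (Traj.outputs k ω)) := by
  filter_upwards [S.condInfoGain_ae A hk (k := k), S.condExpOutputs_gain A hk] with ω h1 h2
  rw [h1, h2.1]

/-- The expected distortion at time `k`, as a function of the past outputs. -/
lemma condExpOutputs_distortion (hk : k ≤ K) {lD : Vec nx → Vec nx → ℝ≥0}
    (hlD : Measurable fun q : Vec nx × Vec nx => lD q.1 q.2) (R : ReconstructionPolicy nx) :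
    S.condExpOutputs K A k (Traj.distortion lD R k) =ᵐ[S.law K A] fun ω =>
      S.stepExp (A.coll k (Traj.outputs k ω)) (S.iterBelief A k (Traj.outputs k ω))
        (fun z' w => lD w.1 (R.val k (Fin.snoc (α := fun _ => Output nx) (Traj.outputs k ω) z'))) := by
  have hf : Measurable fun q : (Fin k → Output nx) × Output nx × BState nx ny k =>
      (lD q.2.2.1 (R.val k (Fin.snoc (α := fun _ => Output nx) q.1 q.2.1)) : ℝ≥0∞) :=
    (hlD.comp (((by fun_prop : Measurable fun q : (Fin k → Output nx) × Output nx × BState nx ny k =>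
      q.2.2.1)).prodMk ((R.measurable_val k).comp (by fun_prop)))).coe_nnreal_ennreal
  have h := S.condExpOutputs_stepExp A hk
    (f := fun z z' w => (lD w.1 (R.val k (Fin.snoc (α := fun _ => Output nx) z z')) : ℝ≥0∞)) hf
  have h1 : (Traj.distortion lD R k : Traj nx ny K → ℝ≥0∞) = fun ω => (lD (Traj.bstate k ω).1
      (R.val k (Fin.snoc (α := fun _ => Output nx) (Traj.outputs k ω) (ω.z k))) : ℝ≥0∞) := by
    funext ω
    rw [Traj.distortion, Traj.outputs_succ]
    rfl
  rw [h1]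
  exact h

/-- The nonnegative contribution of retained samples is dropped; this suffices for the lower bound
on the cost. -/
lemma distortionLoss_le_stepExp (lD : Vec nx → Vec nx → ℝ≥0) (a : Collection nx)
    (b : Belief nx ny k) (r : Output nx → Vec nx) :
    S.distortionLoss lD a b (r (Sum.inr ())) ≤ S.stepExp a b (fun z w => lD w.1 (r z)) :=
  lintegral_mono fun _ => le_self_add

/-- Exact reconstruction of a retained sample costs nothing, so the lower bound is attained. -/
lemma distortionLoss_eq_stepExp {lD : Vec nx → Vec nx → ℝ≥0} (hlD0 : ∀ x, lD x x = 0) (a : Collection nx)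
    (b : Belief nx ny k) {r : Output nx → Vec nx} (hr : ∀ x, r (Sum.inl x) = x) :
    S.stepExp a b (fun z w => lD w.1 (r z)) = S.distortionLoss lD a b (r (Sum.inr ())) := by
  refine lintegral_congr fun w => ?_
  simp only [hr, hlD0, ENNReal.coe_zero, mul_zero, add_zero]

lemma costToGo_last {lD : Vec nx → Vec nx → ℝ≥0} {lam : ℝ≥0} (R : ReconstructionPolicy nx)
    (ω : Traj nx ny K) : S.costToGo K lD lam A R (K + 1) ω = 0 := by
  simp [costToGo]

/-- The terms at time `k` are split off, and the tower property is applied to each later distortion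
and information term. -/
lemma costToGo_eq_add {lD : Vec nx → Vec nx → ℝ≥0} {lam : ℝ≥0} (hk : k ≤ K) (R : ReconstructionPolicy nx) :
    S.costToGo K lD lam A R k =ᵐ[S.law K A] fun ω =>
      S.condExpOutputs K A k (Traj.distortion lD R k) ω
        + lam * S.infoLoss (A.coll k (Traj.outputs k ω)) (S.iterBelief A k (Traj.outputs k ω))
        + S.condExpOutputs K A k (S.costToGo K lD lam A R (k + 1)) ω := by
  have h1 : S.condExpOutputs K A k (S.costToGo K lD lam A R (k + 1)) =ᵐ[S.law K A] fun ω =>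
      ∑ j ∈ Finset.Icc (k + 1) K,
        (S.condExpOutputs K A k (Traj.distortion lD R j) ω + lam * S.condInfoGain K A j k ω) := by
    have h2 : S.condExpOutputs K A k (S.costToGo K lD lam A R (k + 1)) =ᵐ[S.law K A] fun ω =>
        ∑ j ∈ Finset.Icc (k + 1) K, S.condExpOutputs K A k (fun ω =>
          S.condExpOutputs K A (k + 1) (Traj.distortion lD R j) ω + lam * S.condInfoGain K A j (k + 1) ω) ω := by
      have := condLExp_finsetSum (P := S.law K A) (mΩ := outSigma nx ny K k) (Finset.Icc (k + 1) K)
        (X := fun j ω => S.condExpOutputs K A (k + 1) (Traj.distortion lD R j) ω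
          + lam * S.condInfoGain K A j (k + 1) ω) (fun j => ((S.measurable_condExpOutputs A _).add
            ((S.measurable_condInfoGain A j (k + 1)).const_mul _)).aemeasurable)
      refine Filter.EventuallyEq.trans (.of_eq ?_) (this.trans (.of_eq ?_))
      · unfold condExpOutputs
        congr 1
        funext ω
        rw [costToGo, Finset.sum_apply]
        rfl
      · funext ω
        rw [Finset.sum_apply]
        rfl
    have h3 : ∀ᵐ ω ∂S.law K A, ∀ j ∈ Finset.Icc (k + 1) K, S.condExpOutputs K A k (fun ω =>
          S.condExpOutputs K A (k + 1) (Traj.distortion lD R j) ω + lam * S.condInfoGain K A j (k + 1) ω) ω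
        = S.condExpOutputs K A k (Traj.distortion lD R j) ω + lam * S.condInfoGain K A j k ω := by
      refine (Filter.eventually_all_finset _).2 fun j hj => ?_
      rw [Finset.mem_Icc] at hj
      filter_upwards [S.condExpOutputs_add A (k := k) (S.measurable_condExpOutputs A (k := k + 1)
          (Traj.distortion lD R j)).aemeasurable (fun ω => lam * S.condInfoGain K A j (k + 1) ω),
        S.condExpOutputs_const_mul A (k := k) (S.condInfoGain K A j (k + 1)) lam,
        S.condExpOutputs_tower A (Nat.le_succ k) (Traj.distortion lD R j),
        S.condExpOutputs_condInfoGain A hj.1 hj.2 (Nat.le_succ k)] with ω h4 h5 h6 h7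
      rw [h4, h5, h6, h7]
    filter_upwards [h2, h3] with ω h2 h3
    rw [h2]
    exact Finset.sum_congr rfl h3
  filter_upwards [h1, S.condInfoGain_self A hk] with ω h1 h2
  rw [h1, ← h2, costToGo, ← Finset.insert_Icc_succ_left_eq_Icc hk, Finset.sum_insert (by simp)]
  rfl

end PrivateSystem

end CostToGo

/-! ### No policy has a cost-to-go below the value function -/

section LowerBound

open Set

variable {nx ny : ℕ}

namespace PrivateSystem

variable (S : PrivateSystem nx ny) (A : SamplingPolicy nx) {k K : ℕ}

/-- Lower semianalyticity is available for families with mass at most 1 everywhere, whereas the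
explicit belief is normalized only for almost every history. -/
lemma exists_measurableBelief_eq_iterBelief (k : ℕ) :
    ∃ B : (Fin k → Output nx) → Belief nx ny k, MeasurableBelief B ∧
      (∀ z, ∫⁻ w, B z w ∂S.refState k ≤ 1) ∧ ∀ᵐ z ∂S.outLaw A k, B z = S.iterBelief A k z := by
  classical
  let good : Set (Fin k → Output nx) := {z | ∫⁻ w, S.iterBelief A k z w ∂S.refState k = 1}
  have hgood : MeasurableSet good := S.measurableSet_lintegral_iterBelief A k
  refine ⟨fun z w => if z ∈ good then S.iterBelief A k z w else 0,
    Measurable.ite (measurable_fst hgood) (S.measurableBelief_iterBelief A k) measurable_const,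
    fun z => ?_, ?_⟩
  · by_cases hz : z ∈ good
    · simp only [if_pos hz]; exact le_of_eq hz
    · simp [hz]
  · filter_upwards [(S.hasBeliefLaw A k).2] with z hz
    funext w
    exact if_pos hz

lemma aemeasurable_comp_iterBelief {V : Belief nx ny k → ℝ≥0∞} (hV : S.LowerSemianalyticBelief V) :
    AEMeasurable (fun z => V (S.iterBelief A k z)) (S.outLaw A k) := by
  obtain ⟨B, hB, hB1, hBA⟩ := S.exists_measurableBelief_eq_iterBelief A k
  refine ((hV hB hB1).aemeasurable _).congr ?_
  filter_upwards [hBA] with z hz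
  rw [hz]

/-- The converse of `HasBeliefLaw.ae_outLaw_succ`, for properties that need not be measurable. It
allows a value function to be replaced by a measurable version inside a one-step integral. -/
lemma ae_snoc_of_ae_outLaw_succ {P : (Fin (k + 1) → Output nx) → Prop}
    (h : ∀ᵐ z ∂S.outLaw A (k + 1), P z) :
    ∀ᵐ z ∂S.outLaw A k, ∀ᵐ z' ∂S.refOutput,
      S.outputDensity (A.coll k z) (S.iterBelief A k z) z' ≠ 0 →
        P (Fin.snoc (α := fun _ => Output nx) z z') := by
  let N := toMeasurable (S.outLaw A (k + 1)) {z | ¬ P z}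
  have hN : MeasurableSet N := measurableSet_toMeasurable _ _
  have hN0 : S.outLaw A (k + 1) N = 0 := by rw [measure_toMeasurable]; exact h
  have hm : Measurable (N.indicator (1 : (Fin (k + 1) → Output nx) → ℝ≥0∞)) := measurable_one.indicator hN
  rw [← lintegral_indicator_one hN, HasBeliefLaw.lintegral_outLaw_succ S A (S.hasBeliefLaw A k).1 hm] at hN0
  have hod : Measurable fun q : (Fin k → Output nx) × Output nx =>
      S.outputDensity (A.coll k q.1) (S.iterBelief A k q.1) q.2 :=
    (S.measurable_outputDensity (A.measurable_coll k) (S.measurableBelief_iterBelief A k)).comp measurable_swap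
  have hd : Measurable fun q : (Fin k → Output nx) × Output nx =>
      S.outputDensity (A.coll k q.1) (S.iterBelief A k q.1) q.2
        * N.indicator (1 : (Fin (k + 1) → Output nx) → ℝ≥0∞) (Fin.snoc (α := fun _ => Output nx) q.1 q.2) :=
    hod.mul (hm.comp (measurable_fst.fin_snoc measurable_snd))
  have h1 := (lintegral_eq_zero_iff (Measurable.lintegral_prod_right' hd)).1 hN0
  filter_upwards [h1] with z hz
  have h2 := (lintegral_eq_zero_iff (hd.comp (measurable_const.prodMk measurable_id) :
    Measurable fun z' => S.outputDensity (A.coll k z) (S.iterBelief A k z) z'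
        * N.indicator (1 : (Fin (k + 1) → Output nx) → ℝ≥0∞) (Fin.snoc (α := fun _ => Output nx) z z'))).1 hz
  filter_upwards [h2] with z' hz' h0
  by_contra hP
  have : Fin.snoc (α := fun _ => Output nx) z z' ∈ N := subset_toMeasurable _ _ hP
  have hz'' : S.outputDensity (A.coll k z) (S.iterBelief A k z) z'
      * N.indicator (1 : (Fin (k + 1) → Output nx) → ℝ≥0∞) (Fin.snoc (α := fun _ => Output nx) z z') = 0 := hz'
  rw [indicator_of_mem this, Pi.one_apply, mul_one] at hz''
  exact h0 hz''

/-- The expected value of a function of the next belief state. -/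
lemma condExpOutputs_next (hk : k ≤ K) {V : Belief nx ny (k + 1) → ℝ≥0∞} (hV : S.LowerSemianalyticBelief V) :
    S.condExpOutputs K A k (fun ω => V (S.iterBelief A (k + 1) (Traj.outputs (k + 1) ω)))
      =ᵐ[S.law K A] fun ω => S.stepExp (A.coll k (Traj.outputs k ω)) (S.iterBelief A k (Traj.outputs k ω))
        (fun z' _ => V (S.update (S.iterBelief A k (Traj.outputs k ω)) (A.coll k (Traj.outputs k ω)) z')) := by
  -- The formula for one-step conditional expectations applies to measurable functions, so it is
  -- used for a measurable version `v` of the value of the next belief and then transferred back.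
  obtain ⟨v, hv, hVv⟩ := S.aemeasurable_comp_iterBelief A hV
  have hvs : Measurable fun q : (Fin k → Output nx) × Output nx =>
      v (Fin.snoc (α := fun _ => Output nx) q.1 q.2) := hv.comp (measurable_fst.fin_snoc measurable_snd)
  have h1 : S.condExpOutputs K A k (fun ω => V (S.iterBelief A (k + 1) (Traj.outputs (k + 1) ω)))
      =ᵐ[S.law K A] S.condExpOutputs K A k fun ω =>
        v (Fin.snoc (α := fun _ => Output nx) (Traj.outputs k ω) (ω.z k)) := by
    refine S.condExpOutputs_congr A ?_
    filter_upwards [S.ae_law_of_ae_outLaw A (Nat.succ_le_succ hk) hVv] with ω hω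
    rw [hω, Traj.outputs_succ]
  have h2 := S.condExpOutputs_stepExp A hk
    (f := fun z z' _ => v (Fin.snoc (α := fun _ => Output nx) z z')) (hvs.comp (by fun_prop :
      Measurable fun q : (Fin k → Output nx) × Output nx × BState nx ny k => (q.1, q.2.1)))
  have h3 := S.ae_law_of_ae_outLaw (K := K) A (Nat.le_succ_of_le hk) (S.ae_snoc_of_ae_outLaw_succ A hVv)
  filter_upwards [h1, h2, h3] with ω h1 h2 h3
  have hb := S.measurable_iterBelief A k (Traj.outputs k ω)
  have hm : Measurable fun z' => v (Fin.snoc (α := fun _ => Output nx) (Traj.outputs k ω) z') :=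
    hvs.comp (measurable_const.prodMk measurable_id)
  rw [h1, h2, S.stepExp_output (A.coll k (Traj.outputs k ω)) hb
      (g := fun z' => v (Fin.snoc (α := fun _ => Output nx) (Traj.outputs k ω) z'))
      (hm.comp measurable_inl).aemeasurable,
    S.stepExp_output_of_ae (A.coll k (Traj.outputs k ω)) hb
      (g' := fun z' => v (Fin.snoc (α := fun _ => Output nx) (Traj.outputs k ω) z'))
      (hm.comp measurable_inl).aemeasurable]
  filter_upwards [h3] with z' hz' h0
  rw [← hz' h0, iterBelief, Fin.init_snoc, Fin.snoc_last]

/-- The optimal cost-to-go functions with horizon `K`. -/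
def valueFn (K : ℕ) (lD : Vec nx → Vec nx → ℝ≥0) (lam : ℝ≥0) (k : ℕ) : Belief nx ny k → ℝ≥0∞ :=
  S.valueIter lD lam (K + 1 - k) k

variable {lD : Vec nx → Vec nx → ℝ≥0} {lam : ℝ≥0}

lemma valueFn_last (b : Belief nx ny (K + 1)) : S.valueFn K lD lam (K + 1) b = 0 := by
  rw [valueFn, Nat.sub_self]
  rfl

lemma valueFn_eq (hk : k ≤ K) :
    (S.valueFn K lD lam k : Belief nx ny k → ℝ≥0∞) = S.valueIter lD lam (K + 1 - (k + 1) + 1) k := by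
  rw [valueFn, show K + 1 - k = K + 1 - (k + 1) + 1 by omega]

lemma valueFn_eq_iInf (hk : k ≤ K) (b : Belief nx ny k) :
    S.valueFn K lD lam k b
      = ⨅ a : Collection nx, S.bellmanValue lD lam (S.valueFn K lD lam (k + 1)) a b := by
  rw [S.valueFn_eq hk]
  rfl

lemma valueFn_congr {b b' : Belief nx ny k} (h : b =ᵐ[S.refState k] b') :
    S.valueFn K lD lam k b = S.valueFn K lD lam k b' :=
  S.valueIter_congr lD lam _ b b' h

lemma lowerSemianalyticBelief_valueFn (hlD : Measurable fun q : Vec nx × Vec nx => lD q.1 q.2) :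
    S.LowerSemianalyticBelief (S.valueFn K lD lam k) :=
  S.lowerSemianalytic_valueIter hlD lam _

/-- If the cost-to-go at the next time is bounded below by the value function, then the cost-to-go
is bounded below by the Bellman expression. -/
lemma bellmanValue_le_costToGo_of_next (hlD : Measurable fun q : Vec nx × Vec nx => lD q.1 q.2) (hk : k ≤ K)
    (R : ReconstructionPolicy nx)
    (h : ∀ᵐ ω ∂S.law K A, S.valueFn K lD lam (k + 1) (S.iterBelief A (k + 1) (Traj.outputs (k + 1) ω))
      ≤ S.costToGo K lD lam A R (k + 1) ω) :
    ∀ᵐ ω ∂S.law K A, S.bellmanValue lD lam (S.valueFn K lD lam (k + 1)) (A.coll k (Traj.outputs k ω))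
      (S.iterBelief A k (Traj.outputs k ω)) ≤ S.costToGo K lD lam A R k ω := by
  filter_upwards [S.costToGo_eq_add A hk R (lD := lD) (lam := lam), S.condExpOutputs_distortion A hk hlD R,
    S.condExpOutputs_next A hk (S.lowerSemianalyticBelief_valueFn hlD (K := K) (lam := lam)),
    S.condExpOutputs_mono A (k := k) h] with ω h1 h2 h3 h4
  rw [h1, h2, bellmanValue]
  refine add_le_add (add_le_add_left ((iInf_le _ _).trans (S.distortionLoss_le_stepExp lD _ _
    (fun z' => R.val k (Fin.snoc (α := fun _ => Output nx) (Traj.outputs k ω) z')))) _) ?_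
  rw [h3] at h4
  exact h4

/-- Backward induction: if the bound holds at the next time, the policy pays at least the Bellman
expression at its own collection, hence at least the infimum. -/
lemma valueFn_le_costToGo (hlD : Measurable fun q : Vec nx × Vec nx => lD q.1 q.2)
    (R : ReconstructionPolicy nx) (hk : k ≤ K + 1) :
    ∀ᵐ ω ∂S.law K A, S.valueFn K lD lam k (S.iterBelief A k (Traj.outputs k ω))
      ≤ S.costToGo K lD lam A R k ω := by
  induction hk using Nat.decreasingInduction with
  | self => exact .of_forall fun ω => by rw [valueFn_last]; exact zero_le
  | of_succ k hk ih =>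
    have hk : k ≤ K := by omega
    filter_upwards [S.bellmanValue_le_costToGo_of_next A hlD hk R ih] with ω hω
    rw [S.valueFn_eq_iInf hk]
    exact (iInf_le _ _).trans hω

lemma bellmanValue_le_costToGo (hlD : Measurable fun q : Vec nx × Vec nx => lD q.1 q.2) (hk : k ≤ K)
    (R : ReconstructionPolicy nx) :
    ∀ᵐ ω ∂S.law K A, S.bellmanValue lD lam (S.valueFn K lD lam (k + 1)) (A.coll k (Traj.outputs k ω))
      (S.iterBelief A k (Traj.outputs k ω)) ≤ S.costToGo K lD lam A R k ω :=
  S.bellmanValue_le_costToGo_of_next A hlD hk R (S.valueFn_le_costToGo A hlD R (Nat.succ_le_succ hk))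

end PrivateSystem

end LowerBound

/-! ### Nearly optimal policies and the optimal cost-to-go -/

section OptimalPolicies

open Set

variable {nx ny : ℕ}

/-- The sampling policy that uses the collections `a` at time `k`, and those of `A` otherwise. -/
def SamplingPolicy.update (A : SamplingPolicy nx) (k : ℕ) (a : (Fin k → Output nx) → Collection nx)
    (ha : MeasurableColl a) : SamplingPolicy nx where
  coll := Function.update A.coll k a
  measurable_coll j n := by
    rcases eq_or_ne j k with rfl | h
    · rw [Function.update_self]
      exact ha n
    · rw [Function.update_of_ne h]
      exact A.measurable_coll j n

/-- The reconstruction policy that, at time `k`, reconstructs a retained sample exactly and a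
discarded sample by `g`, and follows `R` otherwise. -/
def ReconstructionPolicy.update (R : ReconstructionPolicy nx) (k : ℕ)
    (g : (Fin k → Output nx) → Vec nx) (hg : Measurable g) : ReconstructionPolicy nx where
  val := Function.update R.val k
    fun z => Sum.elim id (fun _ => g (Fin.init z)) (z (Fin.last k))
  measurable_val j := by
    rcases eq_or_ne j k with rfl | h
    · rw [Function.update_self]
      have : Measurable fun p : Output nx × (Fin j → Output nx) => Sum.elim id (fun _ => g p.2) p.1 :=
        measurable_of_sum_prod measurable_fst (hg.comp measurable_snd)
      exact this.comp (f := fun z : Fin (j + 1) → Output nx => (z (Fin.last j), (Fin.init z : Fin j → Output nx)))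
        (by fun_prop)
    · rw [Function.update_of_ne h]
      exact R.measurable_val j

lemma ReconstructionPolicy.update_snoc (R : ReconstructionPolicy nx) (k : ℕ)
    (g : (Fin k → Output nx) → Vec nx) (hg : Measurable g) (z : Fin k → Output nx) (z' : Output nx) :
    (R.update k g hg).val k (Fin.snoc (α := fun _ => Output nx) z z') = Sum.elim id (fun _ => g z) z' := by
  simp only [ReconstructionPolicy.update, Function.update_self, Fin.init_snoc, Fin.snoc_last]

lemma ReconstructionPolicy.update_of_ne (R : ReconstructionPolicy nx) {j k : ℕ} (h : j ≠ k)
    (g : (Fin k → Output nx) → Vec nx) (hg : Measurable g) : (R.update k g hg).val j = R.val j :=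
  Function.update_of_ne h _ _

instance : Nonempty (ReconstructionPolicy nx) := ⟨⟨fun _ _ => 0, fun _ => measurable_const⟩⟩

namespace PrivateSystem

variable (S : PrivateSystem nx ny) {A A' : SamplingPolicy nx} {k K : ℕ}

lemma iterBelief_congr (h : ∀ j < k, A'.coll j = A.coll j) : S.iterBelief A' k = S.iterBelief A k := by
  induction k with
  | zero => rfl
  | succ k ih =>
    funext z
    rw [iterBelief, iterBelief, ih fun j hj => h j (Nat.lt_succ_of_lt hj), h k (Nat.lt_succ_self k)]

/-- Policies with the same past give the past outputs the same law, so almost sure statements about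
histories, and essential infima, can be compared between them. -/
lemma outLaw_congr (h : ∀ j < k, A'.coll j = A.coll j) : S.outLaw A' k = S.outLaw A k := by
  induction k with
  | zero => rw [outLaw_zero, outLaw_zero]
  | succ k ih =>
    have h' : ∀ j < k, A'.coll j = A.coll j := fun j hj => h j (Nat.lt_succ_of_lt hj)
    refine Measure.ext_of_lintegral _ fun f hf => ?_
    rw [HasBeliefLaw.lintegral_outLaw_succ S A' (S.hasBeliefLaw A' k).1 hf,
      HasBeliefLaw.lintegral_outLaw_succ S A (S.hasBeliefLaw A k).1 hf, ih h', S.iterBelief_congr h',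
      h k (Nat.lt_succ_self k)]

variable {lD : Vec nx → Vec nx → ℝ≥0} {lam : ℝ≥0}

lemma costToGo_congr {R R' : ReconstructionPolicy nx} (h : ∀ j, k ≤ j → R'.val j = R.val j) :
    S.costToGo K lD lam A R' k = S.costToGo K lD lam A R k := by
  funext ω
  refine Finset.sum_congr rfl fun j hj => ?_
  have : (Traj.distortion lD R' j : Traj nx ny K → ℝ≥0∞) = Traj.distortion lD R j := by
    funext ω
    rw [Traj.distortion, Traj.distortion, h j (Finset.mem_Icc.1 hj).1]
  rw [this]

variable (A) in
/-- Measurable selection of nearly optimal collections. -/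
lemma exists_collection_bellmanValue_le (hlD : Measurable fun q : Vec nx × Vec nx => lD q.1 q.2)
    (hk : k ≤ K) {ε : ℝ≥0∞} (hε : ε ≠ 0) :
    ∃ a : (Fin k → Output nx) → Collection nx, MeasurableColl a ∧ ∀ᵐ z ∂S.outLaw A k,
      S.bellmanValue lD lam (S.valueFn K lD lam (k + 1)) (a z) (S.iterBelief A k z)
        ≤ S.valueFn K lD lam k (S.iterBelief A k z) + ε := by
  obtain ⟨B, hB, hB1, hBA⟩ := S.exists_measurableBelief_eq_iterBelief A k
  obtain ⟨c, hc, hcode⟩ := S.exists_collection_code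
  obtain ⟨F, hF, hF1⟩ := S.lowerSemianalytic_bellmanValue hlD lam
    (S.lowerSemianalyticBelief_valueFn hlD (K := K) (lam := lam) (k := k + 1))
    (Θ := (Fin k → Output nx) × (ℕ → ℕ)) (a := fun p => c p.2) (b := fun p => B p.1)
    (hc.comp measurable_snd) (hB.comp measurable_fst) fun p => hB1 p.1
  -- The Bellman value is itself only an infimum of the measurable `F`, so the selection runs over
  -- pairs of a collection code and an auxiliary parameter; only the code is kept.
  obtain ⟨g, hg, hgF⟩ := LowerSemianalytic.exists_selector (T := (ℕ → ℕ) × (ℕ → ℕ))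
    (F := fun q => F ((q.1, q.2.1), q.2.2)) (hF.comp (by fun_prop)) (S.outLaw A k)
    (ε := fun _ => ε) measurable_const fun _ => hε
  refine ⟨fun z => c (g z).1, hc.comp (measurable_fst.comp hg), ?_⟩
  filter_upwards [hBA, hgF] with z hz hgz
  have h1 : ⨅ t : (ℕ → ℕ) × (ℕ → ℕ), F ((z, t.1), t.2) = S.valueFn K lD lam k (B z) := by
    rw [iInf_prod, S.valueFn_eq hk, S.valueIter_succ_eq_iInf_code hcode]
    exact iInf_congr fun i => (hF1 (z, i)).symm
  rw [← hz]
  refine ((hF1 (z, (g z).1)).le.trans (iInf_le _ (g z).2)).trans (hgz.trans ?_)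
  rw [h1]

variable (A) in
/-- Measurable selection of nearly optimal reconstructions. -/
lemma exists_reconstruction_distortionLoss_le
    (hlD : Measurable fun q : Vec nx × Vec nx => lD q.1 q.2) (k : ℕ) {ε : ℝ≥0∞} (hε : ε ≠ 0) :
    ∃ g : (Fin k → Output nx) → Vec nx, Measurable g ∧ ∀ᵐ z ∂S.outLaw A k,
      S.distortionLoss lD (A.coll k z) (S.iterBelief A k z) (g z)
        ≤ (⨅ xt, S.distortionLoss lD (A.coll k z) (S.iterBelief A k z) xt) + ε :=
  LowerSemianalytic.exists_selector
    (S.measurable_distortionLoss hlD (A.measurable_coll k) (S.measurableBelief_iterBelief A k))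
    (S.outLaw A k) (ε := fun _ => ε) measurable_const fun _ => hε

lemma condExpOutputs_distortion_update (hlD : Measurable fun q : Vec nx × Vec nx => lD q.1 q.2)
    (hlD0 : ∀ x, lD x x = 0) (hk : k ≤ K) (R : ReconstructionPolicy nx)
    {g : (Fin k → Output nx) → Vec nx} (hg : Measurable g) :
    ∀ᵐ ω ∂S.law K A, S.condExpOutputs K A k (Traj.distortion lD (R.update k g hg) k) ω
      = S.distortionLoss lD (A.coll k (Traj.outputs k ω)) (S.iterBelief A k (Traj.outputs k ω))
          (g (Traj.outputs k ω)) := by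
  filter_upwards [S.condExpOutputs_distortion A hk hlD (R.update k g hg)] with ω hω
  rw [hω]
  simp only [ReconstructionPolicy.update_snoc]
  exact S.distortionLoss_eq_stepExp hlD0 _ _ fun _ => rfl

/-- Backward induction in which the collection, the reconstruction and the continuation each lose at
most `ε / 3`. The collection at time `k` is fixed before the continuation is chosen, so the
continuation starts from the right beliefs. The reconstruction at time `k` is changed last, which
does not affect the later costs. -/
theorem exists_policy_costToGo_le (hlD : Measurable fun q : Vec nx × Vec nx => lD q.1 q.2)
    (hlD0 : ∀ x, lD x x = 0) (hk : k ≤ K + 1) :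
    ∀ (A : SamplingPolicy nx) {ε : ℝ≥0∞}, ε ≠ 0 →
      ∃ (A' : SamplingPolicy nx) (R : ReconstructionPolicy nx), (∀ j < k, A'.coll j = A.coll j) ∧
        ∀ᵐ ω ∂S.law K A', S.costToGo K lD lam A' R k ω
          ≤ S.valueFn K lD lam k (S.iterBelief A' k (Traj.outputs k ω)) + ε := by
  induction hk using Nat.decreasingInduction with
  | self =>
    intro A ε _
    exact ⟨A, Classical.arbitrary _, fun _ _ => rfl, .of_forall fun ω => by
      rw [costToGo_last]; exact zero_le⟩
  | of_succ k hk ih =>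
    intro A ε hε
    have hk : k ≤ K := by omega
    have hε3 : ε / 3 ≠ 0 := by simp [hε, ENNReal.div_eq_zero_iff]
    obtain ⟨a, ha, haA⟩ := S.exists_collection_bellmanValue_le A hlD hk (lam := lam) hε3
    obtain ⟨A', R, hA', hR⟩ := ih (A.update k a ha) hε3
    have hAk : ∀ j < k, A'.coll j = A.coll j := fun j hj => by
      rw [hA' j (Nat.lt_succ_of_lt hj)]
      exact Function.update_of_ne hj.ne _ _
    have hAa : A'.coll k = a := by
      rw [hA' k (Nat.lt_succ_self k)]
      exact Function.update_self _ _ _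
    obtain ⟨g, hg, hgA⟩ := S.exists_reconstruction_distortionLoss_le A' hlD k hε3
    refine ⟨A', R.update k g hg, hAk, ?_⟩
    have hcost : S.costToGo K lD lam A' (R.update k g hg) (k + 1) = S.costToGo K lD lam A' R (k + 1) :=
      S.costToGo_congr fun j hj => R.update_of_ne (by omega) g hg
    rw [← S.outLaw_congr hAk, ← S.iterBelief_congr hAk, ← hAa] at haA
    have hlsa : S.LowerSemianalyticBelief (S.valueFn K lD lam (k + 1)) :=
      S.lowerSemianalyticBelief_valueFn hlD
    have hnext : S.condExpOutputs K A' k (S.costToGo K lD lam A' R (k + 1)) ≤ᵐ[S.law K A'] fun ω =>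
        S.stepExp (A'.coll k (Traj.outputs k ω)) (S.iterBelief A' k (Traj.outputs k ω))
          (fun z' _ => S.valueFn K lD lam (k + 1)
            (S.update (S.iterBelief A' k (Traj.outputs k ω)) (A'.coll k (Traj.outputs k ω)) z')) + ε / 3 := by
      have h1 := S.condExpOutputs_mono A' (k := k) hR
      have h2 : S.condExpOutputs K A' k (fun ω =>
            S.valueFn K lD lam (k + 1) (S.iterBelief A' (k + 1) (Traj.outputs (k + 1) ω)) + ε / 3)
          =ᵐ[S.law K A'] fun ω => S.condExpOutputs K A' k (fun ω =>
            S.valueFn K lD lam (k + 1) (S.iterBelief A' (k + 1) (Traj.outputs (k + 1) ω))) ω + ε / 3 := by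
        have h3 := S.condExpOutputs_add A' (K := K) (k := k) (f := fun _ => ε / 3) aemeasurable_const (fun ω =>
          S.valueFn K lD lam (k + 1) (S.iterBelief A' (k + 1) (Traj.outputs (k + 1) ω)))
        have h4 : S.condExpOutputs K A' k (fun _ => ε / 3) = fun _ => ε / 3 :=
          condLExp_const outSigma_le _ _
        simp only [add_comm _ (ε / 3)]
        filter_upwards [h3] with ω h3
        rw [h3, h4]
      filter_upwards [h1, h2, S.condExpOutputs_next A' hk hlsa] with ω h1 h2 h3
      rw [← h3, ← h2]
      exact h1
    filter_upwards [S.costToGo_eq_add A' hk (R.update k g hg) (lD := lD) (lam := lam),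
      S.condExpOutputs_distortion_update hlD hlD0 hk R hg, hnext,
      S.ae_law_of_ae_outLaw (K := K) A' (Nat.le_succ_of_le hk) haA,
      S.ae_law_of_ae_outLaw (K := K) A' (Nat.le_succ_of_le hk) hgA] with ω h1 h2 h3 h4 h5
    rw [h1, h2, hcost]
    refine (add_le_add (add_le_add_left h5 _) h3).trans ?_
    have h6 : ε = ε / 3 + ε / 3 + ε / 3 := (ENNReal.add_thirds ε).symm
    conv_rhs => rw [h6]
    calc _ = S.bellmanValue lD lam (S.valueFn K lD lam (k + 1)) (A'.coll k (Traj.outputs k ω))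
          (S.iterBelief A' k (Traj.outputs k ω)) + ε / 3 + ε / 3 := by
            rw [bellmanValue]; ring
      _ ≤ _ := (add_le_add_left (add_le_add_left h4 _) _).trans (by simp only [add_assoc, le_refl])

/-- Any measurable lower bound for all competing policies lies below the value function up to the
error of each nearly optimal policy. Errors `1/n` suffice, so only countably many null sets arise,
all for the common law of the past outputs. -/
theorem isOptimalCostToGo (hlD : Measurable fun q : Vec nx × Vec nx => lD q.1 q.2)
    (hlD0 : ∀ x, lD x x = 0) (hk : k ≤ K) (A : SamplingPolicy nx) :
    S.IsOptimalCostToGo K lD lam A k (fun z => S.valueFn K lD lam k (S.belief K A k z)) := by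
  have hk' : k ≤ K + 1 := Nat.le_succ_of_le hk
  have hae : ∀ᵐ z ∂S.outLaw A k, S.valueFn K lD lam k (S.belief K A k z)
      = S.valueFn K lD lam k (S.iterBelief A k z) := by
    filter_upwards [S.belief_ae_eq_iterBelief A hk] with z hz using S.valueFn_congr hz
  have hv := S.aemeasurable_comp_iterBelief A (S.lowerSemianalyticBelief_valueFn hlD (K := K) (lam := lam) (k := k))
  refine ⟨?_, fun A' hA' R => ?_, fun U hU h => ?_⟩
  · rw [S.map_outputs_eq_outLaw A hk']
    exact hv.congr (hae.mono fun z hz => hz.symm)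
  · rw [← S.outLaw_congr hA'] at hae
    filter_upwards [S.valueFn_le_costToGo A' hlD R hk', S.ae_law_of_ae_outLaw A' hk' hae] with ω h1 h2
    rw [h2, ← S.iterBelief_congr hA']
    exact h1
  · obtain ⟨v, hvm, hvA⟩ := hv
    -- For `n = 0` the error is ∞ and the bound is void.
    have hstep : ∀ n : ℕ, ∀ᵐ z ∂S.outLaw A k, U z ≤ v z + (n : ℝ≥0∞)⁻¹ := by
      intro n
      obtain ⟨A', R, hA', hR⟩ := S.exists_policy_costToGo_le hlD hlD0 hk' A (lam := lam)
        (ENNReal.inv_ne_zero.2 (ENNReal.natCast_ne_top n))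
      have hvA' := hvA
      rw [← S.outLaw_congr hA'] at hvA' ⊢
      refine S.ae_outLaw_of_ae_law A' hk' hU (hvm.add_const _) ?_
      filter_upwards [h A' hA' R, hR, S.ae_law_of_ae_outLaw A' hk' hvA'] with ω h1 h2 h3
      rw [← h3, ← S.iterBelief_congr hA']
      exact h1.trans h2
    have hUv : ∀ᵐ z ∂S.outLaw A k, U z ≤ S.valueFn K lD lam k (S.belief K A k z) := by
      filter_upwards [ae_all_iff.2 hstep, hvA, hae] with z h1 h2 h3
      rw [h3, h2]
      have : Filter.Tendsto (fun n : ℕ => v z + (n : ℝ≥0∞)⁻¹) Filter.atTop (nhds (v z + 0)) :=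
        tendsto_const_nhds.add ENNReal.tendsto_inv_nat_nhds_zero
      rw [add_zero] at this
      exact ge_of_tendsto' this h1
    exact S.ae_law_of_ae_outLaw (K := K) A hk'
      (P := fun z => U z ≤ S.valueFn K lD lam k (S.belief K A k z)) hUv

end PrivateSystem

end OptimalPolicies

/-! ### Divergence as a difference of parts, and the Markov property of the inputs -/

section MutualInformation

open Set

variable {nx ny : ℕ}

/-- Between probability measures the divergence is the integral of the log-likelihood ratio when
this is integrable. Otherwise the finite negative part forces the positive part to be infinite, and
both sides are ∞. -/
lemma klDiv_eq_lintegral_sub {α : Type*} [MeasurableSpace α] {μ ν : Measure α} [IsProbabilityMeasure μ]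
    [IsProbabilityMeasure ν] (hμν : μ ≪ ν) {g : α → ℝ} (hg : llr μ ν =ᵐ[μ] g)
    (hneg : ∫⁻ x, ENNReal.ofReal (-g x) ∂μ ≠ ∞) :
    InformationTheory.klDiv μ ν
      = ∫⁻ x, ENNReal.ofReal (g x) ∂μ - ∫⁻ x, ENNReal.ofReal (-g x) ∂μ := by
  have h1 : ∫⁻ x, ENNReal.ofReal (g x) ∂μ = ∫⁻ x, ENNReal.ofReal (llr μ ν x) ∂μ :=
    lintegral_congr_ae (hg.mono fun x hx => by simp only [hx])
  have h2 : ∫⁻ x, ENNReal.ofReal (-g x) ∂μ = ∫⁻ x, ENNReal.ofReal (-llr μ ν x) ∂μ :=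
    lintegral_congr_ae (hg.mono fun x hx => by simp only [hx])
  rw [h2] at hneg
  rw [h1, h2]
  by_cases hint : Integrable (llr μ ν) μ
  · rw [InformationTheory.klDiv_of_ac_of_integrable hμν hint,
      integral_eq_lintegral_pos_part_sub_lintegral_neg_part hint]
    have hpos : ∫⁻ x, ENNReal.ofReal (llr μ ν x) ∂μ ≠ ∞ := hint.lintegral_lt_top.ne
    simp only [probReal_univ, add_sub_cancel_right]
    rw [ENNReal.ofReal_sub _ ENNReal.toReal_nonneg, ENNReal.ofReal_toReal hpos, ENNReal.ofReal_toReal hneg]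
  · rw [InformationTheory.klDiv_of_not_integrable hint]
    have hpos : ∫⁻ x, ENNReal.ofReal (llr μ ν x) ∂μ = ∞ := by
      by_contra hpos
      refine hint ⟨(measurable_llr μ ν).aestronglyMeasurable, ?_⟩
      rw [hasFiniteIntegral_iff_norm]
      have h3 : ∀ x, ENNReal.ofReal ‖llr μ ν x‖
          ≤ ENNReal.ofReal (llr μ ν x) + ENNReal.ofReal (-llr μ ν x) := fun x => by
        rcases le_total 0 (llr μ ν x) with h | h
        · rw [Real.norm_of_nonneg h]; exact le_self_add
        · rw [Real.norm_of_nonpos h]; exact le_add_self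
      refine (lintegral_mono h3).trans_lt ?_
      rw [lintegral_add_left (measurable_llr μ ν).ennreal_ofReal]
      exact ENNReal.add_lt_top.2 ⟨lt_top_iff_ne_top.2 hpos, lt_top_iff_ne_top.2 hneg⟩
    rw [hpos, ENNReal.top_sub hneg]

/-- A law gives no mass to the zero set of its density, and the density is almost everywhere finite
because its integral is the finite mass of `P`. This justifies splitting logarithms of quotients. -/
lemma ae_density_ne_zero_ne_top {Ω β : Type*} [MeasurableSpace Ω] [MeasurableSpace β] {P : Measure Ω}
    [IsFiniteMeasure P] {T : Ω → β} (hT : Measurable T) {ν : Measure β} {d : β → ℝ≥0∞}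
    (hd : Measurable d) (h : P.map T = ν.withDensity d) : ∀ᵐ ω ∂P, d (T ω) ≠ 0 ∧ d (T ω) ≠ ∞ := by
  have h1 : ∀ᵐ ω ∂P, d (T ω) ≠ 0 := by
    have : ∀ᵐ t ∂P.map T, d t ≠ 0 := by
      rw [h, ae_withDensity_iff hd]
      exact .of_forall fun _ h => h
    exact ae_of_ae_map hT.aemeasurable this
  have h2 : ∫⁻ t, d t ∂ν ≠ ∞ := by
    have : ν.withDensity d univ = P univ := by
      rw [← h, Measure.map_apply hT MeasurableSet.univ, preimage_univ]
    rw [withDensity_apply _ MeasurableSet.univ, setLIntegral_univ] at this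
    rw [this]
    exact measure_ne_top P univ
  have h3 : ∀ᵐ ω ∂P, d (T ω) < ∞ := PrivateSystem.ae_law_of_ae_withDensity hT h (ae_lt_top hd h2)
  filter_upwards [h1, h3] with ω h1 h3 using ⟨h1, h3.ne⟩

lemma ae_eq_of_map_eq_withDensity {Ω β : Type*} [MeasurableSpace Ω] [MeasurableSpace β] {P : Measure Ω}
    {T : Ω → β} (hT : Measurable T) {ν : Measure β} [SigmaFinite ν] {d d' : β → ℝ≥0∞}
    (hd : Measurable d) (hd' : Measurable d') (h : P.map T = ν.withDensity d)
    (h' : P.map T = ν.withDensity d') : ∀ᵐ ω ∂P, d (T ω) = d' (T ω) :=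
  PrivateSystem.ae_law_of_ae_withDensity hT h
    ((withDensity_eq_iff_of_sigmaFinite hd.aemeasurable hd'.aemeasurable).1 (h.symm.trans h'))

namespace PrivateSystem

variable (S : PrivateSystem nx ny) (A : SamplingPolicy nx) {k K : ℕ}

/-- The conditional density of `Y^k` given `Z^{k-1}`, computed from the explicit belief state. -/
def iterPrior (k : ℕ) (z : Fin k → Output nx) (y : Fin (k + 1) → Vec ny) : ℝ≥0∞ :=
  S.priorInputs (S.iterBelief A k z) y

/-- The density of `Y^k`. -/
def inputDensity (k : ℕ) (y : Fin (k + 1) → Vec ny) : ℝ≥0∞ :=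
  ∫⁻ z, S.iterPrior A k z y ∂S.outLaw A k

lemma measurable_iterPrior (k : ℕ) :
    Measurable fun q : (Fin k → Output nx) × (Fin (k + 1) → Vec ny) => S.iterPrior A k q.1 q.2 :=
  S.measurable_priorInputs (S.measurableBelief_iterBelief A k)

lemma measurable_inputDensity (k : ℕ) : Measurable (S.inputDensity A k) :=
  Measurable.lintegral_prod_left' (S.measurable_iterPrior A k)

lemma map_inputs (hk : k ≤ K) :
    (S.law K A).map (Traj.inputs k) = (S.refInputs k).withDensity (S.inputDensity A k) := by
  refine Measure.ext_of_lintegral _ fun f hf => ?_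
  have h1 : ∫⁻ p, f p.2 ∂(S.law K A).map (fun ω => (Traj.outputs k ω, Traj.inputs k ω))
      = ∫⁻ ω, f (Traj.inputs k ω) ∂S.law K A :=
    lintegral_map (hf.comp measurable_snd) ((Traj.measurable_outputs k).prodMk (Traj.measurable_inputs k))
  have hm : Measurable fun q : (Fin k → Output nx) × (Fin (k + 1) → Vec ny) =>
      S.iterPrior A k q.1 q.2 * f q.2 := (S.measurable_iterPrior A k).mul (hf.comp measurable_snd)
  rw [lintegral_map hf (Traj.measurable_inputs k), ← h1, S.map_outputs_inputs A hk,
    lintegral_withDensity_eq_lintegral_mul _ (S.measurable_inputDensity A k) hf,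
    S.map_outputs_eq_outLaw A (Nat.le_succ_of_le hk)]
  refine (lintegral_withDensity_eq_lintegral_mul _ (S.measurable_iterPrior A k) (hf.comp measurable_snd)).trans ?_
  refine (lintegral_prod_symm _ hm.aemeasurable).trans (lintegral_congr fun y => ?_)
  exact lintegral_mul_const (f y) ((S.measurable_iterPrior A k).comp (measurable_id.prodMk measurable_const))

/-- The next private input depends on the present one only. -/
lemma lintegral_law_outputs_inputs_succ (k : ℕ)
    {F : (Fin (k + 1) → Output nx) × (Fin (k + 2) → Vec ny) → ℝ≥0∞} (hF : Measurable F) :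
    ∫⁻ ω, F (Traj.outputs (k + 1) ω, Traj.inputs (k + 1) ω) ∂S.law (k + 1) A
      = ∫⁻ ω, ∫⁻ y, S.py y (Traj.inputs k ω (Fin.last k))
          * F (Traj.outputs (k + 1) ω, Fin.snoc (α := fun _ => Vec ny) (Traj.inputs k ω) y) ∂S.refY
          ∂S.law k A := by
  have hG : Measurable fun ω : Traj nx ny (k + 1) => F (Traj.outputs (k + 1) ω, Traj.inputs (k + 1) ω) :=
    hF.comp ((Traj.measurable_outputs _).prodMk (Traj.measurable_inputs _))
  rw [S.lintegral_law_succ A k hG]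
  refine lintegral_congr_ae ?_
  filter_upwards [S.ae_law_of_ae_refTraj A (S.ae_refTraj_x k k),
      S.ae_law_of_ae_refTraj A (S.ae_refTraj_y k k)] with ω hx hy
  have hy' : Traj.inputs k ω (Fin.last k) = ω.y k := by simp [Traj.inputs]
  have h1 : ∀ p : Vec nx × Vec ny, ∀ n, F (Traj.outputs (k + 1) (ω.extend p n), Traj.inputs (k + 1) (ω.extend p n))
      = F (Traj.outputs (k + 1) ω, Fin.snoc (α := fun _ => Vec ny) (Traj.inputs k ω) p.2) := fun p n => by
    rw [Traj.extend_outputs _ _ _ le_rfl, Traj.extend_inputs_last]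
  have h2 : Measurable fun x' => (S.px x' (ω.x k) (ω.y k) : ℝ≥0∞) :=
    S.measurable_px_comp measurable_id measurable_const measurable_const
  have h3 : Measurable fun y' => (S.py y' (ω.y k) : ℝ≥0∞)
      * F (Traj.outputs (k + 1) ω, Fin.snoc (α := fun _ => Vec ny) (Traj.inputs k ω) y') :=
    (S.measurable_py_comp measurable_id measurable_const).mul
      (hF.comp (measurable_const.prodMk (measurable_const.fin_snoc measurable_id)))
  have h4 := lintegral_prod_mul (μ := S.refX) (ν := S.refY) h2.aemeasurable h3.aemeasurable
  have h5 : ∫⁻ x', (S.px x' (ω.x k) (ω.y k) : ℝ≥0∞) ∂S.refX = 1 := S.lintegral_px _ hx _ hy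
  rw [h5, one_mul] at h4
  rw [hy', ← h4]
  refine lintegral_congr fun p => ?_
  rw [h1, h1, ← add_mul, Collection.prob_add, one_mul, transDensity, mul_assoc]

/-- Given the outputs and inputs up to time `k`, the next input depends on the present input only.
The prior at time `k + 1` is therefore the posterior at time `k` times the transition density. -/
lemma map_outputs_succ_inputs_succ (hk : k + 1 ≤ K) :
    (S.law K A).map (fun ω => (Traj.outputs (k + 1) ω, Traj.inputs (k + 1) ω))
      = (((S.law K A).map (Traj.outputs (k + 1))).prod (S.refInputs (k + 1))).withDensity
          (fun q => S.iterPosterior A k q.1 (Fin.init q.2)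
            * S.py (q.2 (Fin.last (k + 1))) (q.2 (Fin.last k).castSucc)) := by
  have hD := S.measurable_iterPosterior A k
  have hd : Measurable fun q : (Fin (k + 1) → Output nx) × (Fin (k + 2) → Vec ny) =>
      S.iterPosterior A k q.1 (Fin.init q.2)
            * S.py (q.2 (Fin.last (k + 1))) (q.2 (Fin.last k).castSucc) :=
    (hD.comp (f := fun q : (Fin (k + 1) → Output nx) × (Fin (k + 2) → Vec ny) =>
      (q.1, (Fin.init q.2 : Fin (k + 1) → Vec ny))) (by fun_prop)).mul
      (S.measurable_py_comp (by fun_prop) (by fun_prop))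
  refine Measure.ext_of_lintegral _ fun F hF => ?_
  have hG : Measurable fun ω : Traj nx ny (k + 1) => F (Traj.outputs (k + 1) ω, Traj.inputs (k + 1) ω) :=
    hF.comp ((Traj.measurable_outputs _).prodMk (Traj.measurable_inputs _))
  have hL : ∫⁻ ω, F (Traj.outputs (k + 1) ω, Traj.inputs (k + 1) ω) ∂S.law K A
      = ∫⁻ ω, F (Traj.outputs (k + 1) ω, Traj.inputs (k + 1) ω) ∂S.law (k + 1) A := by
    refine Eq.trans (lintegral_congr fun ω => ?_) (S.lintegral_law_upTo A hk hG)
    rw [Traj.upTo_outputs _ (Nat.le_succ _), Traj.upTo_inputs _ le_rfl]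
  have hI : Measurable fun q : (Fin (k + 1) → Output nx) × (Fin (k + 1) → Vec ny) =>
      ∫⁻ y, S.py y (q.2 (Fin.last k)) * F (q.1, Fin.snoc (α := fun _ => Vec ny) q.2 y) ∂S.refY :=
    Measurable.lintegral_prod_right' (f := fun r : ((Fin (k + 1) → Output nx) × (Fin (k + 1) → Vec ny)) × Vec ny =>
      S.py r.2 (r.1.2 (Fin.last k)) * F (r.1.1, Fin.snoc (α := fun _ => Vec ny) r.1.2 r.2))
      ((S.measurable_py_comp (by fun_prop) (by fun_prop)).mul (hF.comp (by fun_prop)))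
  have hDI : Measurable fun q : (Fin (k + 1) → Output nx) × (Fin (k + 1) → Vec ny) =>
      S.iterPosterior A k q.1 q.2
        * ∫⁻ y, S.py y (q.2 (Fin.last k)) * F (q.1, Fin.snoc (α := fun _ => Vec ny) q.2 y) ∂S.refY := hD.mul hI
  have hdF : Measurable fun q : (Fin (k + 1) → Output nx) × (Fin (k + 2) → Vec ny) =>
      S.iterPosterior A k q.1 (Fin.init q.2)
            * S.py (q.2 (Fin.last (k + 1))) (q.2 (Fin.last k).castSucc) * F q := hd.mul hF
  rw [lintegral_map hF ((Traj.measurable_outputs _).prodMk (Traj.measurable_inputs _)), hL,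
    S.lintegral_law_outputs_inputs_succ A k hF, S.map_outputs_eq_outLaw A (Nat.le_succ_of_le hk),
    lintegral_withDensity_eq_lintegral_mul _ hd hF,
    ← lintegral_map (f := fun q : (Fin (k + 1) → Output nx) × (Fin (k + 1) → Vec ny) =>
      ∫⁻ y, S.py y (q.2 (Fin.last k)) * F (q.1, Fin.snoc (α := fun _ => Vec ny) q.2 y) ∂S.refY) hI
      ((Traj.measurable_outputs _).prodMk (Traj.measurable_inputs k)),
    S.map_outputs_succ_inputs A le_rfl, lintegral_withDensity_eq_lintegral_mul _ hD hI,
    S.map_outputs_eq_outLaw A le_rfl]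
  refine (lintegral_prod _ hDI.aemeasurable).trans (Eq.trans ?_ (lintegral_prod _ hdF.aemeasurable).symm)
  refine lintegral_congr fun z => ?_
  refine Eq.trans ?_ (S.lintegral_refInputs_succ k (hdF.comp (measurable_const.prodMk measurable_id))).symm
  refine lintegral_congr fun y => ?_
  simp only [Function.comp_def, id, Fin.init_snoc, Fin.snoc_last, Fin.snoc_castSucc, mul_assoc]
  exact (lintegral_const_mul _ ((S.measurable_py_comp measurable_id measurable_const).mul
    (hF.comp (measurable_const.prodMk (measurable_const.fin_snoc measurable_id))))).symm

/-- The marginal density of the inputs acquires the same transition factor as the prior, which is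
why the factor cancels in the chain rule. -/
lemma map_inputs_succ (hk : k + 1 ≤ K) :
    (S.law K A).map (Traj.inputs (k + 1)) = (S.refInputs (k + 1)).withDensity
      (fun y => S.inputDensity A k (Fin.init y) * S.py (y (Fin.last (k + 1))) (y (Fin.last k).castSucc)) := by
  have hD := S.measurable_inputDensity A k
  have hd : Measurable fun y : Fin (k + 2) → Vec ny =>
      S.inputDensity A k (Fin.init y) * S.py (y (Fin.last (k + 1))) (y (Fin.last k).castSucc) :=
    (hD.comp (measurable_fin_init _)).mul (S.measurable_py_comp (by fun_prop) (by fun_prop))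
  refine Measure.ext_of_lintegral _ fun F hF => ?_
  have hG : Measurable fun ω : Traj nx ny (k + 1) => F (Traj.inputs (k + 1) ω) :=
    hF.comp (Traj.measurable_inputs _)
  have hL : ∫⁻ ω, F (Traj.inputs (k + 1) ω) ∂S.law K A = ∫⁻ ω, F (Traj.inputs (k + 1) ω) ∂S.law (k + 1) A := by
    refine Eq.trans (lintegral_congr fun ω => ?_) (S.lintegral_law_upTo A hk hG)
    rw [Traj.upTo_inputs _ le_rfl]
  have hI : Measurable fun q : Fin (k + 1) → Vec ny =>
      ∫⁻ y, S.py y (q (Fin.last k)) * F (Fin.snoc (α := fun _ => Vec ny) q y) ∂S.refY :=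
    Measurable.lintegral_prod_right' (f := fun r : (Fin (k + 1) → Vec ny) × Vec ny =>
      S.py r.2 (r.1 (Fin.last k)) * F (Fin.snoc (α := fun _ => Vec ny) r.1 r.2))
      ((S.measurable_py_comp (by fun_prop) (by fun_prop)).mul (hF.comp (by fun_prop)))
  have hdF : Measurable fun y : Fin (k + 2) → Vec ny =>
      S.inputDensity A k (Fin.init y) * S.py (y (Fin.last (k + 1))) (y (Fin.last k).castSucc) * F y := hd.mul hF
  rw [lintegral_map hF (Traj.measurable_inputs _), hL,
    S.lintegral_law_outputs_inputs_succ A k (F := fun q => F q.2) (hF.comp measurable_snd),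
    lintegral_withDensity_eq_lintegral_mul _ hd hF,
    ← lintegral_map (f := fun q : Fin (k + 1) → Vec ny =>
      ∫⁻ y, S.py y (q (Fin.last k)) * F (Fin.snoc (α := fun _ => Vec ny) q y) ∂S.refY) hI
      (Traj.measurable_inputs k), S.map_inputs A le_rfl, lintegral_withDensity_eq_lintegral_mul _ hD hI]
  refine Eq.trans ?_ (S.lintegral_refInputs_succ k hdF).symm
  refine lintegral_congr fun y => ?_
  simp only [Fin.init_snoc, Fin.snoc_last, Fin.snoc_castSucc, mul_assoc]
  exact (lintegral_const_mul _ ((S.measurable_py_comp measurable_id measurable_const).mul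
    (hF.comp (measurable_const.fin_snoc measurable_id)))).symm

end PrivateSystem

end MutualInformation

/-! ### The chain rule for mutual information and the optimal value -/

section Objective

open Set

variable {nx ny : ℕ}

namespace PrivateSystem

variable (S : PrivateSystem nx ny) (A : SamplingPolicy nx) {k K : ℕ}

lemma iterGain_eq (ω : Traj nx ny K) :
    S.iterGain A k (Traj.outputs k ω) (ω.z k) (Traj.bstate k ω)
      = Real.log (S.iterPosterior A k (Traj.outputs (k + 1) ω) (Traj.inputs k ω)
          / S.iterPrior A k (Traj.outputs k ω) (Traj.inputs k ω)).toReal := by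
  rw [iterPosterior, Traj.outputs_succ, Fin.init_snoc, Fin.snoc_last]
  rfl

lemma iterPosterior_ne (hk : k ≤ K) : ∀ᵐ ω ∂S.law K A,
    S.iterPosterior A k (Traj.outputs (k + 1) ω) (Traj.inputs k ω) ≠ 0 ∧
      S.iterPosterior A k (Traj.outputs (k + 1) ω) (Traj.inputs k ω) ≠ ∞ :=
  ae_density_ne_zero_ne_top ((Traj.measurable_outputs _).prodMk (Traj.measurable_inputs k))
    (S.measurable_iterPosterior A k) (S.map_outputs_succ_inputs A hk)

lemma iterPrior_ne (hk : k ≤ K) : ∀ᵐ ω ∂S.law K A,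
    S.iterPrior A k (Traj.outputs k ω) (Traj.inputs k ω) ≠ 0 ∧
      S.iterPrior A k (Traj.outputs k ω) (Traj.inputs k ω) ≠ ∞ :=
  ae_density_ne_zero_ne_top ((Traj.measurable_outputs _).prodMk (Traj.measurable_inputs k))
    (S.measurable_iterPrior A k) (S.map_outputs_inputs A hk)

lemma inputDensity_ne (hk : k ≤ K) : ∀ᵐ ω ∂S.law K A,
    S.inputDensity A k (Traj.inputs k ω) ≠ 0 ∧ S.inputDensity A k (Traj.inputs k ω) ≠ ∞ :=
  ae_density_ne_zero_ne_top (Traj.measurable_inputs k)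
    (S.measurable_inputDensity A k) (S.map_inputs A hk)

lemma inputs_succ_init (ω : Traj nx ny K) : Fin.init (Traj.inputs (k + 1) ω) = Traj.inputs k ω := rfl

lemma iterPrior_succ_ae (hk : k + 1 ≤ K) : ∀ᵐ ω ∂S.law K A,
    S.iterPrior A (k + 1) (Traj.outputs (k + 1) ω) (Traj.inputs (k + 1) ω)
      = S.iterPosterior A k (Traj.outputs (k + 1) ω) (Traj.inputs k ω) * S.py (ω.y (k + 1)) (ω.y k) := by
  have : IsProbabilityMeasure ((S.law K A).map (Traj.outputs (k + 1))) :=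
    Measure.isProbabilityMeasure_map (Traj.measurable_outputs _).aemeasurable
  have hd : Measurable fun q : (Fin (k + 1) → Output nx) × (Fin (k + 2) → Vec ny) =>
      S.iterPosterior A k q.1 (Fin.init q.2)
            * S.py (q.2 (Fin.last (k + 1))) (q.2 (Fin.last k).castSucc) :=
    ((S.measurable_iterPosterior A k).comp (f := fun q : (Fin (k + 1) → Output nx) × (Fin (k + 2) → Vec ny) =>
      (q.1, (Fin.init q.2 : Fin (k + 1) → Vec ny))) (by fun_prop)).mul
      (S.measurable_py_comp (by fun_prop) (by fun_prop))
  filter_upwards [ae_eq_of_map_eq_withDensity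
    ((Traj.measurable_outputs (k + 1)).prodMk (Traj.measurable_inputs (k + 1)))
    (S.measurable_iterPrior A (k + 1)) hd (S.map_outputs_inputs A hk) (S.map_outputs_succ_inputs_succ A hk)]
    with ω hω
  rw [hω, inputs_succ_init]
  simp [Traj.inputs]

lemma inputDensity_succ_ae (hk : k + 1 ≤ K) : ∀ᵐ ω ∂S.law K A,
    S.inputDensity A (k + 1) (Traj.inputs (k + 1) ω)
      = S.inputDensity A k (Traj.inputs k ω) * S.py (ω.y (k + 1)) (ω.y k) := by
  have hd : Measurable fun y : Fin (k + 2) → Vec ny =>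
      S.inputDensity A k (Fin.init y) * S.py (y (Fin.last (k + 1))) (y (Fin.last k).castSucc) :=
    ((S.measurable_inputDensity A k).comp (measurable_fin_init _)).mul
      (S.measurable_py_comp (by fun_prop) (by fun_prop))
  filter_upwards [ae_eq_of_map_eq_withDensity (Traj.measurable_inputs (k + 1))
    (S.measurable_inputDensity A (k + 1)) hd (S.map_inputs A hk) (S.map_inputs_succ A hk)] with ω hω
  rw [hω, inputs_succ_init]
  simp [Traj.inputs]

/-- The chain rule for the log-likelihood ratio. -/
lemma sum_iterGain_ae (hk : k ≤ K) : ∀ᵐ ω ∂S.law K A,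
    ∑ j ∈ Finset.range (k + 1), S.iterGain A j (Traj.outputs j ω) (ω.z j) (Traj.bstate j ω)
      = Real.log (S.iterPosterior A k (Traj.outputs (k + 1) ω) (Traj.inputs k ω)
          / S.inputDensity A k (Traj.inputs k ω)).toReal := by
  induction k with
  | zero =>
    refine .of_forall fun ω => ?_
    refine (Finset.sum_range_one _).trans ?_
    -- Before any output the prior is the marginal density of the input.
    rw [iterGain_eq, inputDensity, outLaw_zero, lintegral_dirac, Subsingleton.elim (Traj.outputs 0 ω) default]
  | succ k ih =>
    have hk' : k ≤ K := by omega
    filter_upwards [ih hk', S.iterPosterior_ne A hk', S.iterPosterior_ne A hk, S.iterPrior_ne A hk,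
      S.inputDensity_ne A hk', S.inputDensity_ne A hk, S.iterPrior_succ_ae A hk, S.inputDensity_succ_ae A hk]
      with ω h1 h2 h3 h4 h5 h6 h7 h8
    -- The posterior at time `k` cancels against the prior at time `k + 1`, and the common
    -- transition factor cancels as well; all logarithms split because the densities involved are
    -- almost surely positive and finite.
    rw [Finset.sum_range_succ, h1, iterGain_eq]
    rw [h7] at h4 ⊢
    rw [h8] at h6 ⊢
    have hp : ((S.py (ω.y (k + 1)) (ω.y k) : ℝ≥0∞)).toReal ≠ 0 :=
      ENNReal.toReal_ne_zero.2 ⟨right_ne_zero_of_mul h4.1, ENNReal.coe_ne_top⟩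
    have hd := ENNReal.toReal_ne_zero.2 h2
    have hd' := ENNReal.toReal_ne_zero.2 h3
    have hq := ENNReal.toReal_ne_zero.2 h5
    rw [ENNReal.toReal_div, ENNReal.toReal_div, ENNReal.toReal_div, ENNReal.toReal_mul, ENNReal.toReal_mul,
      Real.log_div hd hq, Real.log_div hd' (mul_ne_zero hd hp), Real.log_div hd' (mul_ne_zero hq hp),
      Real.log_mul hd hp, Real.log_mul hq hp]
    ring

/-- The ratio of the joint density of `(Z^K, Y^K)` and the product of the marginal densities. -/
def jointRatio (K : ℕ) (q : (Fin (K + 1) → Output nx) × (Fin (K + 1) → Vec ny)) : ℝ≥0∞ :=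
  S.iterPosterior A K q.1 q.2 / S.inputDensity A K q.2

lemma measurable_jointRatio (K : ℕ) : Measurable (S.jointRatio A K) :=
  (S.measurable_iterPosterior A K).div ((S.measurable_inputDensity A K).comp measurable_snd)

lemma ae_iterPosterior_eq_zero : ∀ᵐ q ∂(S.outLaw A (K + 1)).prod (S.refInputs K),
    S.inputDensity A K q.2 ≠ ∞ ∧ (S.inputDensity A K q.2 = 0 → S.iterPosterior A K q.1 q.2 = 0) := by
  have h1 : ∀ᵐ q ∂(S.outLaw A (K + 1)).prod (S.refInputs K), S.inputDensity A K q.2 ≠ ∞ := by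
    have h2 : ∫⁻ y, S.inputDensity A K y ∂S.refInputs K ≠ ∞ := by
      have : (S.refInputs K).withDensity (S.inputDensity A K) univ = S.law K A univ := by
        rw [← S.map_inputs A le_rfl, Measure.map_apply (Traj.measurable_inputs K) MeasurableSet.univ,
          preimage_univ]
      rw [withDensity_apply _ MeasurableSet.univ, setLIntegral_univ] at this
      rw [this]
      exact measure_ne_top _ _
    exact Measure.quasiMeasurePreserving_snd.ae
      ((ae_lt_top (S.measurable_inputDensity A K) h2).mono fun y hy => hy.ne)
  have h2 : ∀ᵐ q ∂(S.outLaw A (K + 1)).prod (S.refInputs K),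
      S.inputDensity A K q.2 = 0 → S.iterPosterior A K q.1 q.2 = 0 := by
    have h3 := S.inputDensity_ne A (le_refl K)
    have hs : MeasurableSet {y | S.inputDensity A K y = 0} :=
      S.measurable_inputDensity A K (measurableSet_singleton 0)
    have h4 := S.map_outputs_succ_inputs A (le_refl K)
    rw [S.map_outputs_eq_outLaw A le_rfl] at h4
    have hm := (Traj.measurable_outputs (K + 1)).prodMk (Traj.measurable_inputs (nx := nx) (ny := ny) (K := K) K)
    have h5 : ∀ᵐ q ∂((S.outLaw A (K + 1)).prod (S.refInputs K)).withDensity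
        (fun q => S.iterPosterior A K q.1 q.2), S.inputDensity A K q.2 ≠ 0 := by
      rw [← h4]
      exact (ae_map_iff hm.aemeasurable (p := fun q => S.inputDensity A K q.2 ≠ 0)
        (measurable_snd hs).compl).2 (h3.mono fun ω hω => hω.1)
    rw [ae_withDensity_iff (S.measurable_iterPosterior A K)] at h5
    filter_upwards [h5] with q hq h0
    by_contra h
    exact hq h h0
  exact h1.and h2

lemma map_eq_withDensity_jointRatio (K : ℕ) :
    (S.law K A).map (fun ω => (Traj.outputs (K + 1) ω, Traj.inputs K ω))
      = (((S.law K A).map (Traj.outputs (K + 1))).prod ((S.law K A).map (Traj.inputs K))).withDensity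
          (S.jointRatio A K) := by
  have hQ : Measurable fun q : (Fin (K + 1) → Output nx) × (Fin (K + 1) → Vec ny) =>
    S.inputDensity A K q.2 := (S.measurable_inputDensity A K).comp measurable_snd
  rw [S.map_outputs_succ_inputs A le_rfl, S.map_inputs A le_rfl, S.map_outputs_eq_outLaw A le_rfl,
    prod_withDensity_right (S.measurable_inputDensity A K),
    ← withDensity_mul _ hQ (S.measurable_jointRatio A K)]
  refine withDensity_congr_ae ?_
  filter_upwards [S.ae_iterPosterior_eq_zero A] with q hq
  rw [Pi.mul_apply, jointRatio, ENNReal.mul_div_cancel' hq.2 fun h => absurd h hq.1]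

/-- The positive part of a sum is not the sum of the positive parts. The chain rule is therefore
integrated in a form without subtraction, positive part plus all negative gains equals negative part
plus all positive gains, after which the finite terms are cancelled. -/
lemma klDiv_eq (K : ℕ) :
    InformationTheory.klDiv ((S.law K A).map fun ω => (Traj.outputs (K + 1) ω, Traj.inputs K ω))
        (((S.law K A).map (Traj.outputs (K + 1))).prod ((S.law K A).map (Traj.inputs K)))
      = ∑ j ∈ Finset.range (K + 1),
          (∫⁻ ω, S.gainPos A j ω ∂S.law K A - ∫⁻ ω, S.gainNeg A j ω ∂S.law K A) := by
  have hT : Measurable fun ω : Traj nx ny K => (Traj.outputs (K + 1) ω, Traj.inputs K ω) :=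
    (Traj.measurable_outputs (K + 1)).prodMk (Traj.measurable_inputs K)
  have : IsProbabilityMeasure ((S.law K A).map fun ω => (Traj.outputs (K + 1) ω, Traj.inputs K ω)) :=
    Measure.isProbabilityMeasure_map hT.aemeasurable
  have : IsProbabilityMeasure ((S.law K A).map (Traj.outputs (K + 1))) :=
    Measure.isProbabilityMeasure_map (Traj.measurable_outputs _).aemeasurable
  have : IsProbabilityMeasure ((S.law K A).map (Traj.inputs K)) :=
    Measure.isProbabilityMeasure_map (Traj.measurable_inputs _).aemeasurable
  have hmap := S.map_eq_withDensity_jointRatio A K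
  have hgm : Measurable fun q => Real.log (S.jointRatio A K q).toReal :=
    Real.measurable_log.comp (S.measurable_jointRatio A K).ennreal_toReal
  have hac : (S.law K A).map (fun ω => (Traj.outputs (K + 1) ω, Traj.inputs K ω))
      ≪ ((S.law K A).map (Traj.outputs (K + 1))).prod ((S.law K A).map (Traj.inputs K)) := by
    rw [hmap]
    exact withDensity_absolutelyContinuous _ _
  have hllr : llr ((S.law K A).map fun ω => (Traj.outputs (K + 1) ω, Traj.inputs K ω))
        (((S.law K A).map (Traj.outputs (K + 1))).prod ((S.law K A).map (Traj.inputs K)))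
      =ᵐ[(S.law K A).map fun ω => (Traj.outputs (K + 1) ω, Traj.inputs K ω)]
        fun q => Real.log (S.jointRatio A K q).toReal := by
    refine hac.ae_eq ?_
    have h1 := Measure.rnDeriv_withDensity (((S.law K A).map (Traj.outputs (K + 1))).prod
      ((S.law K A).map (Traj.inputs K))) (S.measurable_jointRatio A K)
    rw [← hmap] at h1
    filter_upwards [h1] with q hq
    rw [llr, hq]
  have hsum := S.sum_iterGain_ae A (le_refl K)
  have hN : ∑ j ∈ Finset.range (K + 1), ∫⁻ ω, S.gainNeg A j ω ∂S.law K A ≠ ∞ := by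
    refine ENNReal.sum_ne_top.2 fun j hj => ?_
    exact ((S.lintegral_gainNeg_le A (Nat.lt_succ_iff.1 (Finset.mem_range.1 hj))).trans_lt
      ENNReal.one_lt_top).ne
  have hpos : ∫⁻ q, ENNReal.ofReal (Real.log (S.jointRatio A K q).toReal)
        ∂(S.law K A).map (fun ω => (Traj.outputs (K + 1) ω, Traj.inputs K ω))
      = ∫⁻ ω, ENNReal.ofReal (∑ j ∈ Finset.range (K + 1),
          S.iterGain A j (Traj.outputs j ω) (ω.z j) (Traj.bstate j ω)) ∂S.law K A := by
    rw [lintegral_map hgm.ennreal_ofReal hT]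
    refine lintegral_congr_ae ?_
    filter_upwards [hsum] with ω hω
    rw [hω, jointRatio]
  have hneg : ∫⁻ q, ENNReal.ofReal (-Real.log (S.jointRatio A K q).toReal)
        ∂(S.law K A).map (fun ω => (Traj.outputs (K + 1) ω, Traj.inputs K ω))
      = ∫⁻ ω, ENNReal.ofReal (-∑ j ∈ Finset.range (K + 1),
          S.iterGain A j (Traj.outputs j ω) (ω.z j) (Traj.bstate j ω)) ∂S.law K A := by
    have hgn : Measurable fun q => ENNReal.ofReal (-Real.log (S.jointRatio A K q).toReal) :=
      hgm.neg.ennreal_ofReal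
    rw [lintegral_map hgn hT]
    refine lintegral_congr_ae ?_
    filter_upwards [hsum] with ω hω
    rw [hω, jointRatio]
  have hgj : ∀ j, Measurable fun ω : Traj nx ny K =>
      S.iterGain A j (Traj.outputs j ω) (ω.z j) (Traj.bstate j ω) := fun j =>
    (S.measurable_iterGain A j).comp (measurable_outputs_z_bstate j)
  have hgsum : Measurable fun ω : Traj nx ny K => ∑ j ∈ Finset.range (K + 1),
      S.iterGain A j (Traj.outputs j ω) (ω.z j) (Traj.bstate j ω) :=
    Finset.measurable_fun_sum _ fun j _ => hgj j
  have hposneg : ∀ x : ℝ, x = (ENNReal.ofReal x).toReal - (ENNReal.ofReal (-x)).toReal := fun x => by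
    rcases le_total 0 x with h | h
    · rw [ENNReal.toReal_ofReal h, ENNReal.ofReal_of_nonpos (by linarith)]; simp
    · rw [ENNReal.ofReal_of_nonpos h, ENNReal.toReal_ofReal (show 0 ≤ -x by linarith)]; simp
  have hpt : ∀ ω : Traj nx ny K, ENNReal.ofReal (∑ j ∈ Finset.range (K + 1),
          S.iterGain A j (Traj.outputs j ω) (ω.z j) (Traj.bstate j ω))
        + ∑ j ∈ Finset.range (K + 1), S.gainNeg A j ω
      = ENNReal.ofReal (-∑ j ∈ Finset.range (K + 1),
          S.iterGain A j (Traj.outputs j ω) (ω.z j) (Traj.bstate j ω))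
        + ∑ j ∈ Finset.range (K + 1), S.gainPos A j ω := fun ω => by
    have hPt : ∑ j ∈ Finset.range (K + 1), S.gainPos A j ω ≠ ∞ :=
      ENNReal.sum_ne_top.2 fun j _ => ENNReal.ofReal_ne_top
    have hNt : ∑ j ∈ Finset.range (K + 1), S.gainNeg A j ω ≠ ∞ :=
      ENNReal.sum_ne_top.2 fun j _ => ENNReal.ofReal_ne_top
    rw [← ENNReal.toReal_eq_toReal_iff' (ENNReal.add_ne_top.2 ⟨ENNReal.ofReal_ne_top, hNt⟩)
      (ENNReal.add_ne_top.2 ⟨ENNReal.ofReal_ne_top, hPt⟩), ENNReal.toReal_add ENNReal.ofReal_ne_top hNt,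
      ENNReal.toReal_add ENNReal.ofReal_ne_top hPt,
      ENNReal.toReal_sum (f := fun j => S.gainNeg A j ω) fun j _ => ENNReal.ofReal_ne_top,
      ENNReal.toReal_sum (f := fun j => S.gainPos A j ω) fun j _ => ENNReal.ofReal_ne_top]
    have h1 := hposneg (∑ j ∈ Finset.range (K + 1),
      S.iterGain A j (Traj.outputs j ω) (ω.z j) (Traj.bstate j ω))
    have h2 : ∑ j ∈ Finset.range (K + 1), S.iterGain A j (Traj.outputs j ω) (ω.z j) (Traj.bstate j ω)
        = ∑ j ∈ Finset.range (K + 1), (S.gainPos A j ω).toReal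
          - ∑ j ∈ Finset.range (K + 1), (S.gainNeg A j ω).toReal := by
      rw [← Finset.sum_sub_distrib]
      exact Finset.sum_congr rfl fun j _ => hposneg _
    linarith
  have hint := lintegral_congr (μ := S.law K A) hpt
  have hgsn : Measurable fun ω : Traj nx ny K => ENNReal.ofReal (-∑ j ∈ Finset.range (K + 1),
      S.iterGain A j (Traj.outputs j ω) (ω.z j) (Traj.bstate j ω)) := hgsum.neg.ennreal_ofReal
  rw [lintegral_add_left hgsum.ennreal_ofReal, lintegral_add_left hgsn,
    lintegral_finsetSum _ fun j _ => S.measurable_gainNeg A j,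
    lintegral_finsetSum _ fun j _ => S.measurable_gainPos A j] at hint
  have hnegle : ∫⁻ ω, ENNReal.ofReal (-∑ j ∈ Finset.range (K + 1),
          S.iterGain A j (Traj.outputs j ω) (ω.z j) (Traj.bstate j ω)) ∂S.law K A
      ≤ ∑ j ∈ Finset.range (K + 1), ∫⁻ ω, S.gainNeg A j ω ∂S.law K A := by
    rw [← lintegral_finsetSum _ fun j _ => S.measurable_gainNeg A j]
    refine lintegral_mono fun ω => ?_
    rw [← Finset.sum_neg_distrib]
    exact Finset.le_sum_of_subadditive ENNReal.ofReal ENNReal.ofReal_zero.le (fun _ _ => ENNReal.ofReal_add_le) _ _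
  have hnegtop := (hnegle.trans_lt (lt_top_iff_ne_top.2 hN)).ne
  rw [klDiv_eq_lintegral_sub hac hllr (by rw [hneg]; exact hnegtop), hpos, hneg]
  have hNP : ∀ j ∈ Finset.range (K + 1),
      ∫⁻ ω, S.gainNeg A j ω ∂S.law K A ≤ ∫⁻ ω, S.gainPos A j ω ∂S.law K A := fun j hj => by
    rw [← S.lintegral_condExpOutputs A (k := j) (S.gainNeg A j),
      ← S.lintegral_condExpOutputs A (k := j) (S.gainPos A j)]
    exact lintegral_mono_ae (S.condExpOutputs_gainNeg_le A le_rfl (Nat.lt_succ_iff.1 (Finset.mem_range.1 hj)))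
  have hR : ∑ j ∈ Finset.range (K + 1),
          (∫⁻ ω, S.gainPos A j ω ∂S.law K A - ∫⁻ ω, S.gainNeg A j ω ∂S.law K A)
        + ∑ j ∈ Finset.range (K + 1), ∫⁻ ω, S.gainNeg A j ω ∂S.law K A
      = ∑ j ∈ Finset.range (K + 1), ∫⁻ ω, S.gainPos A j ω ∂S.law K A := by
    rw [← Finset.sum_add_distrib]
    exact Finset.sum_congr rfl fun j hj => tsub_add_cancel_of_le (hNP j hj)
  rw [← hR, ← add_assoc] at hint
  have hint' := (ENNReal.add_left_inj hN).1 hint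
  rw [hint', ENNReal.add_sub_cancel_left hnegtop]

/-- The objective is the expected cost-to-go at time `0`. -/
lemma objective_eq (lD : Vec nx → Vec nx → ℝ≥0) (lam : ℝ≥0) (R : ReconstructionPolicy nx) :
    S.objective K lD lam A R = ∫⁻ ω, S.costToGo K lD lam A R 0 ω ∂S.law K A := by
  have h1 : ∀ j ∈ Finset.range (K + 1), ∫⁻ ω, S.condInfoGain K A j 0 ω ∂S.law K A
      = ∫⁻ ω, S.gainPos A j ω ∂S.law K A - ∫⁻ ω, S.gainNeg A j ω ∂S.law K A := fun j hj => by
    have hj : j ≤ K := Nat.lt_succ_iff.1 (Finset.mem_range.1 hj)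
    rw [lintegral_congr_ae (S.condInfoGain_ae A hj (k := 0)), lintegral_sub (S.measurable_condExpOutputs A _)
      _ (S.condExpOutputs_gainNeg_le A (Nat.zero_le j) hj), lintegral_condExpOutputs, lintegral_condExpOutputs]
    rw [lintegral_condExpOutputs]
    exact ((S.lintegral_gainNeg_le A hj).trans_lt ENNReal.one_lt_top).ne
  have h2 : Finset.Icc 0 K = Finset.range (K + 1) := by
    ext j; simp
  unfold costToGo
  have h3 : ∀ j, Measurable fun ω : Traj nx ny K =>
      S.condExpOutputs K A 0 (Traj.distortion lD R j) ω + lam * S.condInfoGain K A j 0 ω := fun j =>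
    (S.measurable_condExpOutputs A _).add ((S.measurable_condInfoGain A j 0).const_mul _)
  rw [objective, klDiv_eq, h2, lintegral_finsetSum _ fun j _ => h3 j, Finset.mul_sum, ← Finset.sum_add_distrib]
  refine Finset.sum_congr rfl fun j hj => ?_
  rw [lintegral_add_left (S.measurable_condExpOutputs A _), lintegral_condExpOutputs,
    lintegral_const_mul _ (S.measurable_condInfoGain A j 0), h1 j hj]

theorem iInf_objective {lD : Vec nx → Vec nx → ℝ≥0}
    (hlD : Measurable fun q : Vec nx × Vec nx => lD q.1 q.2) (hlD0 : ∀ x, lD x x = 0) (lam : ℝ≥0) :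
    (⨅ (A : SamplingPolicy nx) (R : ReconstructionPolicy nx), S.objective K lD lam A R)
      = S.valueFn K lD lam 0 S.initialBelief := by
  refine le_antisymm ?_ (le_iInf fun A => le_iInf fun R => ?_)
  · refine ENNReal.le_of_forall_pos_le_add fun ε hε _ => ?_
    -- Any policy serves as a starting point, since at time 0 there is no past to agree with.
    let A₀ : SamplingPolicy nx := ⟨fun _ _ => ⟨fun n _ _ => if n then 1 else 0, fun n => measurable_const,
      fun _ _ => by simp⟩, fun _ _ => measurable_const⟩
    obtain ⟨A, R, -, hR⟩ := S.exists_policy_costToGo_le (K := K) hlD hlD0 (Nat.zero_le _) A₀ (lam := lam)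
      (ENNReal.coe_ne_zero.2 hε.ne')
    refine (iInf₂_le A R).trans ?_
    rw [objective_eq]
    refine (lintegral_mono_ae hR).trans ?_
    simp [iterBelief]
  · rw [objective_eq]
    -- The belief at time 0 is deterministic, so the expected lower bound is a constant.
    have h := lintegral_mono_ae (S.valueFn_le_costToGo A hlD R (lam := lam) (Nat.zero_le (K + 1)))
    refine le_trans (le_of_eq ?_) h
    simp [iterBelief]

end PrivateSystem

end Objective

/-! ### Transfer from the explicit belief to the conditional density -/

section BeliefState

open Set

variable {nx ny : ℕ}

namespace PrivateSystem

variable (S : PrivateSystem nx ny) (A : SamplingPolicy nx) {k K : ℕ}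

/-- The set where two measurable families agree up to null sets is the zero set of a measurable
function of the parameter, the measure of a section. This is needed because
`HasBeliefLaw.ae_outLaw_succ` asks for a measurable property. -/
lemma measurableSet_ae_eq {Θ : Type*} [MeasurableSpace Θ] {b b' : Θ → Belief nx ny k}
    (hb : MeasurableBelief b) (hb' : MeasurableBelief b') :
    MeasurableSet {θ | b θ =ᵐ[S.refState k] b' θ} := by
  have hs : MeasurableSet {q : Θ × BState nx ny k | b q.1 q.2 = b' q.1 q.2} := measurableSet_eq_fun hb hb'
  exact measurable_measure_prodMk_left (ν := S.refState k) hs.compl (measurableSet_singleton 0)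

/-- The update respects almost everywhere equality for almost every output. Comparison with the
explicit belief, not with the conditional density at the next time, admits `k = K`, which the
expected next value requires. -/
lemma update_belief_ae_eq (hk : k ≤ K) : ∀ᵐ ω ∂S.law K A,
    S.update (S.belief K A k (Traj.outputs k ω)) (A.coll k (Traj.outputs k ω)) (ω.z k)
      =ᵐ[S.refState (k + 1)] S.iterBelief A (k + 1) (Traj.outputs (k + 1) ω) := by
  have hm : Measurable fun ζ : Fin (k + 1) → Output nx => ((Fin.init ζ : Fin k → Output nx), ζ (Fin.last k)) := by
    fun_prop
  have hsucc := S.ae_law_of_ae_outLaw (K := K) A (Nat.succ_le_succ hk)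
    (HasBeliefLaw.ae_outLaw_succ S A (S.hasBeliefLaw A k).1
      (P := fun ζ => S.update (S.belief K A k (Fin.init ζ)) (A.coll k (Fin.init ζ)) (ζ (Fin.last k))
        =ᵐ[S.refState (k + 1)] S.iterBelief A (k + 1) ζ)
      (S.measurableSet_ae_eq
        (MeasurableBelief.comp (S.measurableBelief_update (A.measurable_coll k) (S.measurableBelief_belief A k)) hm)
        (S.measurableBelief_iterBelief A (k + 1))) ?_)
  · filter_upwards [hsucc] with ω hω
    rw [Traj.outputs_succ, Fin.init_snoc, Fin.snoc_last] at hω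
    rwa [Traj.outputs_succ]
  · filter_upwards [S.belief_ae_eq_iterBelief (K := K) A hk] with z hz
    have hz : S.AgreeAE (A.coll k z) (A.coll k z) (S.belief K A k z) (S.iterBelief A k z) := .of_ae_eq hz
    simp only [iterBelief, Fin.init_snoc, Fin.snoc_last]
    refine Filter.Eventually.mono (S.ae_refOutput_iff.2 ⟨hz.update_inl, hz.update_inr⟩) fun z' hz' _ => hz'

lemma agreeAE_belief_iterBelief (hk : k ≤ K) : ∀ᵐ ω ∂S.law K A,
    S.AgreeAE (A.coll k (Traj.outputs k ω)) (A.coll k (Traj.outputs k ω))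
      (S.belief K A k (Traj.outputs k ω)) (S.iterBelief A k (Traj.outputs k ω)) :=
  (S.ae_law_of_ae_outLaw A (Nat.le_succ_of_le hk) (S.belief_ae_eq_iterBelief A hk)).mono
    fun _ h => .of_ae_eq h

/-- The belief state is updated by `Φ`. -/
theorem belief_succ (hk : k < K) : ∀ᵐ ω ∂S.law K A,
    S.belief K A (k + 1) (Traj.outputs (k + 1) ω) =ᵐ[S.refState (k + 1)]
      S.update (S.belief K A k (Traj.outputs k ω)) (A.coll k (Traj.outputs k ω)) (ω.z k) := by
  filter_upwards [S.update_belief_ae_eq A hk.le,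
    S.ae_law_of_ae_outLaw A (Nat.le_succ_of_le hk) (S.belief_ae_eq_iterBelief A hk)] with ω h1 h2
  exact h2.trans h1.symm

variable {lD : Vec nx → Vec nx → ℝ≥0} {lam : ℝ≥0}

/-- The expected distortion lies above the distortion loss of the policy's own reconstruction of a
discarded sample, hence above the infimum. It lies below the infimum by comparison with nearly
optimal reconstructions that reproduce retained samples, the optimality given the present output
being conditioned down to the past. All these quantities therefore coincide. -/
theorem condExpOutputs_distortion_of_isOptimal (hlD : Measurable fun q : Vec nx × Vec nx => lD q.1 q.2)
    (hlD0 : ∀ x, lD x x = 0) (hk : k ≤ K) {R : ReconstructionPolicy nx}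
    (hR : S.IsOptimalReconstruction K lD A R k) :
    ∀ᵐ ω ∂S.law K A,
      S.condExpOutputs K A k (Traj.distortion lD R k) ω
        = S.distortionLoss lD (A.coll k (Traj.outputs k ω)) (S.belief K A k (Traj.outputs k ω))
            (R.val k (Fin.snoc (α := fun _ => Output nx) (Traj.outputs k ω) (Sum.inr ()))) ∧
      S.condExpOutputs K A k (Traj.distortion lD R k) ω
        = ⨅ xt : Vec nx, S.distortionLoss lD (A.coll k (Traj.outputs k ω))
            (S.belief K A k (Traj.outputs k ω)) xt := by
  have hle : ∀ n : ℕ, ∀ᵐ ω ∂S.law K A, S.condExpOutputs K A k (Traj.distortion lD R k) ω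
      ≤ (⨅ xt, S.distortionLoss lD (A.coll k (Traj.outputs k ω)) (S.iterBelief A k (Traj.outputs k ω)) xt)
        + ((n : ℝ≥0∞) + 1)⁻¹ := fun n => by
    obtain ⟨g, hg, hgle⟩ := S.exists_reconstruction_distortionLoss_le (A := A) hlD k
      (ε := ((n : ℝ≥0∞) + 1)⁻¹) (by simp)
    filter_upwards [S.condExpOutputs_mono A (k := k) (hR (R.update k g hg)),
      S.condExpOutputs_tower A (Nat.le_succ k) (Traj.distortion lD R k),
      S.condExpOutputs_tower A (Nat.le_succ k) (Traj.distortion lD (R.update k g hg) k),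
      S.condExpOutputs_distortion_update hlD hlD0 hk R hg,
      S.ae_law_of_ae_outLaw (K := K) A (Nat.le_succ_of_le hk) hgle] with ω h1 h2 h3 h4 h5
    rw [← h2]
    refine h1.trans ?_
    rw [h3, h4]
    exact h5
  filter_upwards [ae_all_iff.2 hle, S.condExpOutputs_distortion A hk hlD R,
    S.agreeAE_belief_iterBelief A hk] with ω h1 h2 h3
  have hinf : S.condExpOutputs K A k (Traj.distortion lD R k) ω
      ≤ ⨅ xt, S.distortionLoss lD (A.coll k (Traj.outputs k ω)) (S.iterBelief A k (Traj.outputs k ω)) xt := by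
    have ht : Filter.Tendsto (fun n : ℕ => ((n : ℝ≥0∞) + 1)⁻¹) Filter.atTop (nhds 0) := by
      simpa using (Filter.tendsto_add_atTop_iff_nat 1).2 ENNReal.tendsto_inv_nat_nhds_zero
    refine ge_of_tendsto' (f := fun n : ℕ => (⨅ xt, S.distortionLoss lD (A.coll k (Traj.outputs k ω))
      (S.iterBelief A k (Traj.outputs k ω)) xt) + ((n : ℝ≥0∞) + 1)⁻¹) (x := Filter.atTop) ?_ h1
    simpa using ht.const_add
      (⨅ xt, S.distortionLoss lD (A.coll k (Traj.outputs k ω)) (S.iterBelief A k (Traj.outputs k ω)) xt)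
  have hge : S.distortionLoss lD (A.coll k (Traj.outputs k ω)) (S.iterBelief A k (Traj.outputs k ω))
      (R.val k (Fin.snoc (α := fun _ => Output nx) (Traj.outputs k ω) (Sum.inr ())))
      ≤ S.condExpOutputs K A k (Traj.distortion lD R k) ω := by
    rw [h2]
    exact S.distortionLoss_le_stepExp lD _ _
      (fun z' => R.val k (Fin.snoc (α := fun _ => Output nx) (Traj.outputs k ω) z'))
  simp only [h3.distortionLoss lD]
  exact ⟨le_antisymm (hinf.trans (iInf_le _ _)) hge, le_antisymm hinf ((iInf_le _ _).trans hge)⟩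

theorem condInfoGain_self_belief (hk : k ≤ K) : ∀ᵐ ω ∂S.law K A,
    S.condInfoGain K A k k ω
      = S.infoLoss (A.coll k (Traj.outputs k ω)) (S.belief K A k (Traj.outputs k ω)) := by
  filter_upwards [S.condInfoGain_self A hk, S.agreeAE_belief_iterBelief A hk] with ω h1 h2
  rw [h1, h2.infoLoss]

theorem condExpOutputs_valueFn_update (hlD : Measurable fun q : Vec nx × Vec nx => lD q.1 q.2) (hk : k ≤ K) :
    ∀ᵐ ω ∂S.law K A,
      S.condExpOutputs K A k
          (fun ω' => S.valueFn K lD lam (k + 1) (S.update (S.belief K A k (Traj.outputs k ω'))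
            (A.coll k (Traj.outputs k ω')) (ω'.z k))) ω
        = S.stepExp (A.coll k (Traj.outputs k ω)) (S.belief K A k (Traj.outputs k ω))
            (fun z _ => S.valueFn K lD lam (k + 1) (S.update (S.belief K A k (Traj.outputs k ω))
              (A.coll k (Traj.outputs k ω)) z)) := by
  filter_upwards [S.condExpOutputs_congr A (k := k)
      ((S.update_belief_ae_eq A hk).mono fun ω h => S.valueFn_congr (K := K) (lD := lD) (lam := lam) h),
    S.condExpOutputs_next A hk (S.lowerSemianalyticBelief_valueFn hlD (K := K) (lam := lam)),
    S.agreeAE_belief_iterBelief A hk] with ω h1 h2 h3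
  rw [h1, h2]
  refine (h3.stepExp (.of_forall fun _ => S.valueFn_congr h3.update_inr) ?_).symm
  refine ae_refState_of_ae_state (P := fun x => S.valueFn K lD lam (k + 1)
      (S.update (S.belief K A k (Traj.outputs k ω)) (A.coll k (Traj.outputs k ω)) (Sum.inl x))
    = S.valueFn K lD lam (k + 1)
      (S.update (S.iterBelief A k (Traj.outputs k ω)) (A.coll k (Traj.outputs k ω)) (Sum.inl x))) ?_
  filter_upwards [h3.update_inl] with x hx using S.valueFn_congr hx

/-- A policy that attains the optimal cost-to-go attains the infimum in the Bellman equation. -/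
theorem valueFn_eq_bellmanValue_of_attained (hlD : Measurable fun q : Vec nx × Vec nx => lD q.1 q.2)
    (hk : k ≤ K) {R : ReconstructionPolicy nx}
    (hR : S.costToGo K lD lam A R k =ᵐ[S.law K A]
      fun ω => S.valueFn K lD lam k (S.belief K A k (Traj.outputs k ω))) :
    ∀ᵐ ω ∂S.law K A,
      S.valueFn K lD lam k (S.belief K A k (Traj.outputs k ω))
        = S.bellmanValue lD lam (S.valueFn K lD lam (k + 1)) (A.coll k (Traj.outputs k ω))
            (S.belief K A k (Traj.outputs k ω)) := by
  filter_upwards [hR, S.bellmanValue_le_costToGo A hlD hk R (lam := lam), S.agreeAE_belief_iterBelief A hk]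
    with ω h1 h2 h3
  -- The value function lies below the Bellman expression at the policy's own collection, which lies
  -- below the cost; attainment closes the chain.
  refine le_antisymm ?_ ?_
  · rw [S.valueFn_eq_iInf hk]
    exact iInf_le _ _
  · rw [← h1, h3.bellmanValue lD lam fun _ _ => S.valueFn_congr]
    exact h2

end PrivateSystem

end BeliefState

end

theorem mainTheorem1 {nx ny : ℕ} (S : PrivateSystem nx ny) (K : ℕ)
    (lD : Vec nx → Vec nx → ℝ≥0) (hlD : Measurable fun q : Vec nx × Vec nx => lD q.1 q.2)
    (hlD0 : ∀ x, lD x x = 0) (lam : ℝ≥0) (hlam : 0 < lam) :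
    ∃ V : (k : ℕ) → Belief nx ny k → ℝ≥0∞,
      -- terminal value and Bellman equation
      (∀ b, V (K + 1) b = 0) ∧
      (∀ k ≤ K, ∀ b, V k b = ⨅ a : Collection nx, S.bellmanValue lD lam (V (k + 1)) a b) ∧
      -- the optimal value of the sampling problem
      (⨅ (A : SamplingPolicy nx) (R : ReconstructionPolicy nx), S.objective K lD lam A R)
        = V 0 S.initialBelief ∧
      ∀ A : SamplingPolicy nx,
        -- the initial belief state and the update of the belief state
        (∀ z, S.belief K A 0 z =ᵐ[S.refState 0] S.initialBelief) ∧
        (∀ k < K, ∀ᵐ ω ∂S.law K A,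
          S.belief K A (k + 1) (Traj.outputs (k + 1) ω) =ᵐ[S.refState (k + 1)]
            S.update (S.belief K A k (Traj.outputs k ω)) (A.coll k (Traj.outputs k ω))
              (ω.z k)) ∧
        ∀ k ≤ K,
          -- `b_k` is the conditional density of `(X_k, M_k, Y^k)` given `Z^{k-1}`
          (S.law K A).map (fun ω => (Traj.outputs k ω, Traj.bstate k ω))
            = (((S.law K A).map (Traj.outputs k)).prod (S.refState k)).withDensity
                (fun q => S.belief K A k q.1 q.2) ∧
          -- the optimal cost-to-go is `V_k(b_k)`
          S.IsOptimalCostToGo K lD lam A k (fun z => V k (S.belief K A k z)) ∧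
          -- the distortion loss, with an optimal reconstruction
          (∀ R : ReconstructionPolicy nx, S.IsOptimalReconstruction K lD A R k →
            ∀ᵐ ω ∂S.law K A,
              S.condExpOutputs K A k (Traj.distortion lD R k) ω
                = S.distortionLoss lD (A.coll k (Traj.outputs k ω))
                    (S.belief K A k (Traj.outputs k ω))
                    (R.val k (Fin.snoc (α := fun _ => Output nx) (Traj.outputs k ω)
                      (Sum.inr ()))) ∧
              S.condExpOutputs K A k (Traj.distortion lD R k) ω
                = ⨅ xt : Vec nx, S.distortionLoss lD (A.coll k (Traj.outputs k ω))
                    (S.belief K A k (Traj.outputs k ω)) xt) ∧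
          -- the information loss
          (∀ᵐ ω ∂S.law K A,
            S.condInfoGain K A k k ω
              = S.infoLoss (A.coll k (Traj.outputs k ω)) (S.belief K A k (Traj.outputs k ω))) ∧
          -- the expected cost-to-go of the next time
          (∀ᵐ ω ∂S.law K A,
            S.condExpOutputs K A k
                (fun ω' => V (k + 1) (S.update (S.belief K A k (Traj.outputs k ω'))
                  (A.coll k (Traj.outputs k ω')) (ω'.z k))) ω
              = S.stepExp (A.coll k (Traj.outputs k ω)) (S.belief K A k (Traj.outputs k ω))
                  (fun z _ => V (k + 1) (S.update (S.belief K A k (Traj.outputs k ω))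
                    (A.coll k (Traj.outputs k ω)) z))) ∧
          -- if the optimal cost-to-go is attained, then so is the minimum in the Bellman equation
          (∀ R : ReconstructionPolicy nx,
            (S.costToGo K lD lam A R k =ᵐ[S.law K A]
              fun ω => V k (S.belief K A k (Traj.outputs k ω))) →
            ∀ᵐ ω ∂S.law K A,
              V k (S.belief K A k (Traj.outputs k ω))
                = S.bellmanValue lD lam (V (k + 1)) (A.coll k (Traj.outputs k ω))
                    (S.belief K A k (Traj.outputs k ω))) := by
  -- These functions come from the Bellman recursion alone, so one choice serves all sampling
  -- policies.
  refine ⟨fun k => S.valueFn K lD lam k, S.valueFn_last, fun k hk b => S.valueFn_eq_iInf hk b,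
    S.iInf_objective hlD hlD0 lam, fun A => ⟨S.belief_zero A, fun k hk => S.belief_succ A hk, fun k hk =>
      ⟨S.map_outputs_bstate_belief A hk, S.isOptimalCostToGo hlD hlD0 hk A,
        fun R hR => S.condExpOutputs_distortion_of_isOptimal A hlD hlD0 hk hR,
        S.condInfoGain_self_belief A hk, S.condExpOutputs_valueFn_update A hlD hk,
        fun R hR => S.valueFn_eq_bellmanValue_of_attained A hlD hk hR⟩⟩⟩
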